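/- **Conventions.** Let $n\ge 1$. A *strict globular $n$-category* is a set $\mathcal C$ of $n$-cells with partially defined compositions $\circ_0,\dots,\circ_{n-1}$ such that each $(\mathcal C,\circ_p)$ is a category (in arrows-only form), with set of identities $\mathcal C^p$ (and $\mathcal C^n:=\mathcal C$); $\mathcal C^q\subset\mathcal C^p$ and $\mathcal C^p\circ_q\mathcal C^p\subset\mathcal C^p$ for $q<p$; and, for $q<p$, whenever $(x\circ_p y)\circ_q(w\circ_p z)$ exists, so does $(x\circ_q w)\circ_p(y\circ_q z)$ and the two are equal. Every cell $x$ has a unique $p$-source $s_p(x)$ and $p$-target $t_p(x)$ in $\mathcal C^p$. For $a,b\in\mathcal C^{n-1}$ the block $\mathcal C_{ab}$ is the set of $x\in\mathcal C$ with $s_{n-1}(x)=b$, $t_{n-1}(x)=a$. A *totally involutive $n$-C\*-category* is a strict globular $n$-category $\mathcal C$ with maps $*_0,\dots,*_{n-1}:\mathcal C\to\mathcal C$, a blockwise linear structure and a norm such that: - the $*_q$ are commuting involutions that preserve each $\mathcal C^p$, with $(x\circ_q y)^{*_q}=y^{*_q}\circ_q x^{*_q}$ and $(x\circ_p y)^{*_q}=x^{*_q}\circ_p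 y^{*_q}$ for $p\ne q$; - for all $a,b\in\mathcal C^{n-1}$ in globular position (equal $q$-sources and equal $q$-targets for all $q<n-1$), $\mathcal C_{ab}$ is a complex Banach space; all $\circ_p$ are blockwise bilinear and all $*_p$ blockwise conjugate-linear; - $\|x\circ_p y\|\le\|x\|\,\|y\|$ whenever $x\circ_p y$ exists; - for all $p<n$ and all $x\in\mathcal C$, $x^{*_p}\circ_p x$ exists, $\|x^{*_p}\circ_p x\|=\|x\|^2$, and $x^{*_p}\circ_p x$ is a positive element of $\mathcal C_{ee}$, where $e=s_p(x)$ (that is, it lies in $\mathcal C_{ee}$ and equals $y^{*_p}\circ_p y$ for some $y\in\mathcal C_{ee}$). It is *small* if its cells form a set in a fixed universe. A *\*-functor* is a map that preserves all compositions, identities and involutions and is blockwise complex-linear; it is *invertible* if it has an inverse \*-functor. Let $\Phi,\Psi:\mathcal A\to\mathcal B$ be invertible \*-functors. A map $\Xi$ from $\mathcal A^0$ to $\mathcal B$ *intertwines* $\Phi,\Psi$ if $\Psi(x)\circ_0\Xi(s_0(x))=\Xi(t_0(x))\circ_0\Phi(x)$ (both sides existing) for all $x\in\mathcal A$. A *bounded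 strict $n$-transfor* from $\mathcal A$ to $\mathcal B$ between $\Phi$ and $\Psi$ is a map $\Xi:\mathcal A^0\to\mathcal B$ with $s_0(\Xi(A))=\Phi(A)$, $t_0(\Xi(A))=\Psi(A)$ and $\sup_A\|\Xi(A)\|<\infty$, such that $\Xi$ and all the maps $A\mapsto s_k(\Xi(A))$, $A\mapsto t_k(\Xi(A))$, $0<k<n$, intertwine $\Phi,\Psi$. **Theorem.** Let $n\ge1$. The bounded strict $n$-transfors between invertible \*-functors of small totally involutive $n$-C\*-categories are the $(n+1)$-cells of a totally involutive $(n+1)$-C\*-category with the following operations. - For $Y:\mathcal A\to\mathcal B$ between $\Phi_1,\Psi_1$ and $X:\mathcal B\to\mathcal C$ between $\Phi_2,\Psi_2$, the composite $X\circ_0Y$ is the transfor between $\Phi_2\Phi_1$ and $\Psi_2\Psi_1$ with $(X\circ_0Y)(A)=X(\Psi_1(A))\circ_0\Phi_2(Y(A))$; these are the only pairs composable for $\circ_0$. - For $0\le k<n$ and $X,Y:\mathcal A\to\mathcal B$, $X\circ_{k+1}Y$ has components $X(A)\circ_kY(A)$. It is defined exactly when all these exist and, for $k=0$, the target functor of $Y$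 is the source functor of $X$; for $k>0$, $X$ and $Y$ have the same source functor and the same target functor. - For $X:\mathcal A\to\mathcal B$ between $\Phi,\Psi$: $X^{*_0}:\mathcal B\to\mathcal A$ is the transfor between $\Phi^{-1}$ and $\Psi^{-1}$ with $X^{*_0}(B)=\Phi^{-1}\big(X(\Psi^{-1}(B))^{*_0}\big)$; and $X^{*_{k+1}}(A)=X(A)^{*_k}$ for $0\le k<n$, between $\Psi,\Phi$ if $k=0$ and between $\Phi,\Psi$ if $k>0$. - Sums (of transfors in a common block) and scalar multiples are componentwise, and $\|X\|=\sup_{A\in\mathcal A^0}\|X(A)\|$ (which is $0$ if $\mathcal A$ is empty). -/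

import Mathlib

universe u

/-- The operations of a totally involutive strict globular `n`-C*-category, presented by its
`n`-cells: partially defined compositions `∘_p` and involutions `*_p` for `p = 0, …, n - 1`, and a
partial linear structure and norm. The values of `plus` matter only for two cells in a common
block. -/
structure CellOps (n : ℕ) (C : Type u) where
  comp : Fin n → C → C → Part C
  star : Fin n → C → C
  plus : C → C → C
  scale : ℂ → C → C
  nrm : C → ℝ

namespace CellOps

variable {n : ℕ} {C : Type u} (D : CellOps n C)

/-- `e` is a partial identity for `∘_q`; the set of these is `C^q`. -/
def IsIdent (q : Fin n) (e : C) : Prop :=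
  (∀ h k, k ∈ D.comp q h e → k = h) ∧ (∀ h k, k ∈ D.comp q e h → k = h)

/-- `e` is a `q`-source of `x`. -/
def IsSource (q : Fin n) (x e : C) : Prop := D.IsIdent q e ∧ (D.comp q x e).Dom

/-- `e` is a `q`-target of `x`. -/
def IsTarget (q : Fin n) (x e : C) : Prop := D.IsIdent q e ∧ (D.comp q e x).Dom

/-- The `q`-source of `x` (it exists and is unique under the axioms of a category). -/
noncomputable def source (q : Fin n) (x : C) : C :=
  @Classical.epsilon C ⟨x⟩ (D.IsSource q x)

/-- The `q`-target of `x` (it exists and is unique under the axioms of a category). -/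
noncomputable def target (q : Fin n) (x : C) : C :=
  @Classical.epsilon C ⟨x⟩ (D.IsTarget q x)

/-- `(C, ∘_q)` is a 1-category, in the arrows-only axiomatization. -/
structure IsOneCategory (q : Fin n) : Prop where
  assoc : ∀ f g h k : C,
    (∃ m, m ∈ D.comp q g h ∧ k ∈ D.comp q f m) ↔ (∃ m, m ∈ D.comp q f g ∧ k ∈ D.comp q m h)
  exists_source : ∀ f, ∃ r, D.IsSource q f r
  exists_target : ∀ f, ∃ l, D.IsTarget q f l
  comp_dom : ∀ f g e, D.IsSource q f e → D.IsTarget q g e → (D.comp q f g).Dom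

theorem IsOneCategory.source_unique {D : CellOps n C} {q : Fin n} (h : D.IsOneCategory q)
    {x e e' : C} (he : D.IsSource q x e) (he' : D.IsSource q x e') : e = e' := by
  obtain ⟨hi, hd⟩ := he
  obtain ⟨hi', hd'⟩ := he'
  have h1 : x ∈ D.comp q x e := by
    have h2 := Part.get_mem hd
    rwa [hi.1 _ _ h2] at h2
  obtain ⟨k, hk⟩ := Part.dom_iff_mem.1 hd'
  obtain ⟨m, hm, -⟩ := (h.assoc x e e' k).2 ⟨x, h1, hk⟩
  exact (hi'.1 _ _ hm).symm.trans (hi.2 _ _ hm)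

theorem IsOneCategory.target_unique {D : CellOps n C} {q : Fin n} (h : D.IsOneCategory q)
    {x e e' : C} (he : D.IsTarget q x e) (he' : D.IsTarget q x e') : e = e' := by
  obtain ⟨hi, hd⟩ := he
  obtain ⟨hi', hd'⟩ := he'
  have h1 : x ∈ D.comp q e x := by
    have h2 := Part.get_mem hd
    rwa [hi.2 _ _ h2] at h2
  obtain ⟨k, hk⟩ := Part.dom_iff_mem.1 hd'
  obtain ⟨m, hm, -⟩ := (h.assoc e' e x k).1 ⟨x, h1, hk⟩
  exact (hi'.2 _ _ hm).symm.trans (hi.1 _ _ hm)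

theorem IsOneCategory.isSource_source {D : CellOps n C} {q : Fin n} (h : D.IsOneCategory q)
    (x : C) : D.IsSource q x (D.source q x) :=
  @Classical.epsilon_spec_aux C ⟨x⟩ (D.IsSource q x) (h.exists_source x)

theorem IsOneCategory.isTarget_target {D : CellOps n C} {q : Fin n} (h : D.IsOneCategory q)
    (x : C) : D.IsTarget q x (D.target q x) :=
  @Classical.epsilon_spec_aux C ⟨x⟩ (D.IsTarget q x) (h.exists_target x)

/-- Strict globular `n`-categories (with the usual exchange property). -/
structure IsGlobularCategory : Prop where
  oneCategory : ∀ q, D.IsOneCategory q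
  ident_mono : ∀ q p : Fin n, q < p → ∀ e, D.IsIdent q e → D.IsIdent p e
  ident_comp : ∀ q p : Fin n, q < p → ∀ x y z,
    D.IsIdent p x → D.IsIdent p y → z ∈ D.comp q x y → D.IsIdent p z
  exchange : ∀ q p : Fin n, q < p → ∀ x y w z u v r,
    u ∈ D.comp p x y → v ∈ D.comp p w z → r ∈ D.comp q u v →
      ∃ s t, s ∈ D.comp q x w ∧ t ∈ D.comp q y z ∧ r ∈ D.comp p s t

/-- The `*_q` are commuting involutions, `*_q` being contravariant for `∘_q` and covariant for the
other compositions. -/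
structure IsFullyInvolutive : Prop where
  star_star : ∀ q x, D.star q (D.star q x) = x
  star_comm : ∀ p q x, D.star p (D.star q x) = D.star q (D.star p x)
  star_comp_of_ne : ∀ p q, p ≠ q → ∀ x y z, z ∈ D.comp p x y →
    D.star q z ∈ D.comp p (D.star q x) (D.star q y)
  star_comp_self : ∀ q x y z, z ∈ D.comp q x y →
    D.star q z ∈ D.comp q (D.star q y) (D.star q x)
  star_ident : ∀ p q e, D.IsIdent p e → D.IsIdent p (D.star q e)

section Blocks

variable [NeZero n]

/-- The block `C_{ab}` of `n`-cells with `(n-1)`-source `b` and `(n-1)`-target `a`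
(`⊤ : Fin n` is the index `n - 1`). -/
def Block (a b : C) : Type u := {x : C // D.source ⊤ x = b ∧ D.target ⊤ x = a}

/-- `x` and `y` lie in a common block. -/
def SameBlock (x y : C) : Prop := D.source ⊤ x = D.source ⊤ y ∧ D.target ⊤ x = D.target ⊤ y

/-- `a` and `b` are `(n-1)`-cells in globular position, i.e. with the same sources and targets of
all lower orders. Only then can the block `C_{ab}` be nonempty. -/
def Parallel (a b : C) : Prop :=
  D.IsIdent ⊤ a ∧ D.IsIdent ⊤ b ∧
    ∀ q : Fin n, q < ⊤ → D.source q a = D.source q b ∧ D.target q a = D.target q b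

/-- `z` is a positive element of the C*-algebra `(C_{ee}, ∘_p, *_p)`, where `e` is a
`p`-identity: `z = y^{*_p} ∘_p y` for some `y` in `C_{ee}`. -/
def IsPositiveAt (p : Fin n) (e z : C) : Prop :=
  (D.source ⊤ z = e ∧ D.target ⊤ z = e) ∧
    ∃ y, (D.source ⊤ y = e ∧ D.target ⊤ y = e) ∧ z ∈ D.comp p (D.star p y) y

/-- Totally (fully) involutive strict globular `n`-C*-categories. -/
structure IsCStarCategory : Prop where
  globular : D.IsGlobularCategory
  involutive : D.IsFullyInvolutive
  banach : ∀ a b, D.Parallel a b →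
    ∃ (_ : NormedAddCommGroup (D.Block a b)) (_ : NormedSpace ℂ (D.Block a b)),
      CompleteSpace (D.Block a b) ∧
      (∀ x y : D.Block a b, (x + y).1 = D.plus x.1 y.1) ∧
      (∀ (c : ℂ) (x : D.Block a b), (c • x).1 = D.scale c x.1) ∧
      (∀ x : D.Block a b, ‖x‖ = D.nrm x.1)
  plus_comp : ∀ p x x' y z z', D.SameBlock x x' → z ∈ D.comp p x y → z' ∈ D.comp p x' y →
    D.plus z z' ∈ D.comp p (D.plus x x') y
  comp_plus : ∀ p x y y' z z', D.SameBlock y y' → z ∈ D.comp p x y → z' ∈ D.comp p x y' →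
    D.plus z z' ∈ D.comp p x (D.plus y y')
  scale_comp : ∀ p (c : ℂ) x y z, z ∈ D.comp p x y → D.scale c z ∈ D.comp p (D.scale c x) y
  comp_scale : ∀ p (c : ℂ) x y z, z ∈ D.comp p x y → D.scale c z ∈ D.comp p x (D.scale c y)
  star_plus : ∀ p x y, D.SameBlock x y →
    D.star p (D.plus x y) = D.plus (D.star p x) (D.star p y)
  star_scale : ∀ p (c : ℂ) x, D.star p (D.scale c x) = D.scale (starRingEnd ℂ c) (D.star p x)
  nrm_comp_le : ∀ p x y z, z ∈ D.comp p x y → D.nrm z ≤ D.nrm x * D.nrm y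
  nrm_star_comp : ∀ p x, ∃ z, z ∈ D.comp p (D.star p x) x ∧ D.nrm z = D.nrm x ^ 2
  positive : ∀ p x z, z ∈ D.comp p (D.star p x) x → D.IsPositiveAt p (D.source p x) z

end Blocks

end CellOps

/-- Small totally involutive `n`-C*-categories. -/
structure SmallCStarCat (n : ℕ) [NeZero n] : Type (u + 1) where
  Cell : Type u
  ops : CellOps n Cell
  isCStar : ops.IsCStarCategory

namespace SmallCStarCat

variable {n : ℕ} [NeZero n]

/-- The set of objects `A^0`. -/
def Ob (A : SmallCStarCat.{u} n) : Type u := {a : A.Cell // A.ops.IsIdent 0 a}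

/-- `*`-functors: functors for all the compositions that preserve all the involutions and are
linear on the blocks. -/
structure IsStarFunctor (A B : SmallCStarCat.{u} n) (f : A.Cell → B.Cell) : Prop where
  map_comp : ∀ q x y z, z ∈ A.ops.comp q x y → f z ∈ B.ops.comp q (f x) (f y)
  map_ident : ∀ q e, A.ops.IsIdent q e → B.ops.IsIdent q (f e)
  map_star : ∀ q x, f (A.ops.star q x) = B.ops.star q (f x)
  map_plus : ∀ x y, A.ops.SameBlock x y → f (A.ops.plus x y) = B.ops.plus (f x) (f y)
  map_scale : ∀ (c : ℂ) x, f (A.ops.scale c x) = B.ops.scale c (f x)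

/-- Invertible `*`-functors. -/
structure StarIso (A B : SmallCStarCat.{u} n) : Type u where
  toEquiv : A.Cell ≃ B.Cell
  isStarFunctor : IsStarFunctor A B toEquiv
  isStarFunctor_symm : IsStarFunctor B A toEquiv.symm

namespace StarIso

variable {A B C : SmallCStarCat.{u} n}

instance : CoeFun (StarIso A B) (fun _ => A.Cell → B.Cell) := ⟨fun φ => φ.toEquiv⟩

/-- The inverse `*`-functor. -/
def symm (φ : StarIso A B) : StarIso B A where
  toEquiv := φ.toEquiv.symm
  isStarFunctor := φ.isStarFunctor_symm
  isStarFunctor_symm := φ.isStarFunctor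

/-- The action on objects. -/
def ob (φ : StarIso A B) (a : A.Ob) : B.Ob := ⟨φ a.1, φ.isStarFunctor.map_ident 0 _ a.2⟩

end StarIso

variable {A B : SmallCStarCat.{u} n}

/-- The intertwining condition `Ψ(x) ∘_0 Ξ(x_0) = Ξ(_0 x) ∘_0 Φ(x)` for all cells `x` of `A`, where
`x_0` and `_0 x` are the source and target objects of `x`. -/
def Intertwines (Φ Ψ : StarIso A B) (Ξ : A.Ob → B.Cell) : Prop :=
  ∀ (x : A.Cell) (a b : A.Ob), A.ops.IsSource 0 x a.1 → A.ops.IsTarget 0 x b.1 →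
    ∃ z, z ∈ B.ops.comp 0 (Ψ x) (Ξ a) ∧ z ∈ B.ops.comp 0 (Ξ b) (Φ x)

/-- Bounded strict `n`-transfors from `A` to `B`, between invertible `*`-functors `Φ` and `Ψ`.
For `0 < k < n` the `k`-transfors `Φ^{(k)}`, `Ψ^{(k)}` between which `Ξ` runs are determined by `Ξ`:
their values at an object are the `k`-source and the `k`-target of the value of `Ξ`. So unfolding
the recursive definition of an `n`-transfor between `(n-1)`-transfors, …, between functors leaves
the conditions below. -/
@[ext]
structure Transfor (A B : SmallCStarCat.{u} n) : Type u where
  Φ : StarIso A B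
  Ψ : StarIso A B
  Ξ : A.Ob → B.Cell
  source_zero : ∀ a, B.ops.IsSource 0 (Ξ a) (Φ a.1)
  target_zero : ∀ a, B.ops.IsTarget 0 (Ξ a) (Ψ a.1)
  intertwines : Intertwines Φ Ψ Ξ
  intertwines_source : ∀ k : Fin n, 0 < k → Intertwines Φ Ψ (fun a => B.ops.source k (Ξ a))
  intertwines_target : ∀ k : Fin n, 0 < k → Intertwines Φ Ψ (fun a => B.ops.target k (Ξ a))
  bounded : ∃ M : ℝ, ∀ a, B.ops.nrm (Ξ a) ≤ M

/-- The `(n+1)`-cells: bounded `n`-transfors between invertible `*`-functors of small totally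
involutive `n`-C*-categories. -/
structure TransforCell (n : ℕ) [NeZero n] : Type (u + 1) where
  dom : SmallCStarCat.{u} n
  cod : SmallCStarCat.{u} n
  transfor : Transfor dom cod

/-- `Z = X ∘_0 Y`, with `Z(a) = X(Ψ_Y(a)) ∘_0 Φ_X(Y(a))`. -/
inductive IsCompZero : TransforCell.{u} n → TransforCell.{u} n → TransforCell.{u} n → Prop
  | mk (A B C : SmallCStarCat.{u} n) (X : Transfor B C) (Y : Transfor A B) (Z : Transfor A C)
      (hΦ : ∀ x, Z.Φ x = X.Φ (Y.Φ x)) (hΨ : ∀ x, Z.Ψ x = X.Ψ (Y.Ψ x))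
      (hΞ : ∀ a, Z.Ξ a ∈ C.ops.comp 0 (X.Ξ (Y.Ψ.ob a)) (X.Φ (Y.Ξ a))) :
      IsCompZero ⟨B, C, X⟩ ⟨A, B, Y⟩ ⟨A, C, Z⟩

/-- `Z = X ∘_{k+1} Y`, with `Z(a) = X(a) ∘_k Y(a)`. -/
inductive IsCompSucc (k : Fin n) :
    TransforCell.{u} n → TransforCell.{u} n → TransforCell.{u} n → Prop
  | mk (A B : SmallCStarCat.{u} n) (X Y Z : Transfor A B)
      (h_zero : k = 0 → X.Φ = Y.Ψ ∧ Z.Φ = Y.Φ ∧ Z.Ψ = X.Ψ)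
      (h_pos : 0 < k → X.Φ = Y.Φ ∧ X.Ψ = Y.Ψ ∧ Z.Φ = X.Φ ∧ Z.Ψ = X.Ψ)
      (hΞ : ∀ a, Z.Ξ a ∈ B.ops.comp k (X.Ξ a) (Y.Ξ a)) :
      IsCompSucc k ⟨A, B, X⟩ ⟨A, B, Y⟩ ⟨A, B, Z⟩

/-- `Z = X^{*_0}`, with `Z(b) = Φ⁻¹(X(Ψ⁻¹(b))^{*_0})`, running between `Φ⁻¹` and `Ψ⁻¹`. -/
inductive IsStarZero : TransforCell.{u} n → TransforCell.{u} n → Prop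
  | mk (A B : SmallCStarCat.{u} n) (X : Transfor A B) (Z : Transfor B A)
      (hΦ : Z.Φ = X.Φ.symm) (hΨ : Z.Ψ = X.Ψ.symm)
      (hΞ : ∀ b, Z.Ξ b = X.Φ.symm (B.ops.star 0 (X.Ξ (X.Ψ.symm.ob b)))) :
      IsStarZero ⟨A, B, X⟩ ⟨B, A, Z⟩

/-- `Z = X^{*_{k+1}}`, with `Z(a) = X(a)^{*_k}`. -/
inductive IsStarSucc (k : Fin n) : TransforCell.{u} n → TransforCell.{u} n → Prop
  | mk (A B : SmallCStarCat.{u} n) (X Z : Transfor A B)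
      (h_zero : k = 0 → Z.Φ = X.Ψ ∧ Z.Ψ = X.Φ)
      (h_pos : 0 < k → Z.Φ = X.Φ ∧ Z.Ψ = X.Ψ)
      (hΞ : ∀ a, Z.Ξ a = B.ops.star k (X.Ξ a)) :
      IsStarSucc k ⟨A, B, X⟩ ⟨A, B, Z⟩

/-- The operations `D` on bounded `n`-transfors are the standard ones: the compositions and
involutions over objects and over higher cells, componentwise sums and scalar multiples, and the
supremum norm. -/
structure IsTransforOps (D : CellOps (n + 1) (TransforCell.{u} n)) : Prop where
  comp_zero : ∀ X Y Z, Z ∈ D.comp 0 X Y ↔ IsCompZero X Y Z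
  comp_succ : ∀ (k : Fin n) X Y Z, Z ∈ D.comp k.succ X Y ↔ IsCompSucc k X Y Z
  star_zero : ∀ X, IsStarZero X (D.star 0 X)
  star_succ : ∀ (k : Fin n) X, IsStarSucc k X (D.star k.succ X)
  plus : ∀ (A B : SmallCStarCat.{u} n) (X Y : Transfor A B), X.Φ = Y.Φ → X.Ψ = Y.Ψ →
    (∀ a, B.ops.SameBlock (X.Ξ a) (Y.Ξ a)) →
      ∃ Z : Transfor A B, D.plus ⟨A, B, X⟩ ⟨A, B, Y⟩ = ⟨A, B, Z⟩ ∧ Z.Φ = X.Φ ∧ Z.Ψ = X.Ψ ∧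
        ∀ a, Z.Ξ a = B.ops.plus (X.Ξ a) (Y.Ξ a)
  scale : ∀ (c : ℂ) (A B : SmallCStarCat.{u} n) (X : Transfor A B),
    ∃ Z : Transfor A B, D.scale c ⟨A, B, X⟩ = ⟨A, B, Z⟩ ∧ Z.Φ = X.Φ ∧ Z.Ψ = X.Ψ ∧
      ∀ a, Z.Ξ a = B.ops.scale c (X.Ξ a)
  nrm : ∀ (A B : SmallCStarCat.{u} n) (X : Transfor A B),
    D.nrm ⟨A, B, X⟩ = ⨆ a, B.ops.nrm (X.Ξ a)

end SmallCStarCat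

/-! Up to transport along the functors, all operations on transfors are componentwise, so most
axioms hold because they hold in the target category at each object. Four points need an argument.

Naturality survives the operations. For `∘_k` with `k > 0`, write `Ψ(x) = Ψ(x) ∘_k Ψ(s_k x)` and use
exchange. For `∘_0`, paste two naturality equations. For an involution, apply naturality to the
starred cell and take adjoints. Naturality is also what proves the laws mixing orders 0 and 1:
exchange, and the covariance of `*_1` for `∘_0` and of `*_0` for `∘_1`.

`*_0` commutes with `*_1`. This amounts to `Φ⁻¹(X(Ψ⁻¹ b)) = Ψ⁻¹(X(Φ⁻¹ b))`
(`Transfor.symm_apply_eq`). Put `θ = Φ Ψ⁻¹` and `T(c) = X(Ψ⁻¹ c)`. Then `T` is natural from `θ` to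
the identity, and the claim becomes `u = w` for `u = T(θ c)`, `w = θ(T c)`. Naturality at `t = T(c)`
gives only `t u = t w`, and `t` need not be cancellable. However, naturality at `θ⁻¹(u^*)` and at
`θ⁻¹(t^*)` shows that `u u^*` and `w w^*` both have the form `t^* r`. Since `u^* t^* = w^* t^*`, it
follows that `u^* u u^* = w^* u u^*` and `u^* w w^* = w^* w w^*`. The C*-identity allows the
right-hand adjoints to be cancelled (`cancel_star`), giving `u^* u = w^* u` and `u^* w = w^* w`.
Hence `(u - w)^* (u - w) = 0` and `u = w` (`eq_of_gram`, `apply_comm`). The difference makes sense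
only if `u` and `w` share a block. When `n > 1`, this is the same statement for the `(n-1)`-sources
and `(n-1)`-targets, where it is elementary: the positivity axiom forces cells of order less than
`n` to be unitary for the lower compositions (`star_mul_of_isIdent`, `apply_comm_of_isIdent`).

Positive elements have natural square roots. For a `k`-identity `e`, the block `C_{ee}` is a
C*-algebra under `∘_k` and `*_k`, so each component of `X^* X` has a square root. The pairs `(u, v)`
that intertwine at two given objects form a closed unital subalgebra of a product of two such
algebras. It is therefore stable under continuous functional calculus of self-adjoint elements, and
the roots again form a transfor (`EndAlg.intertwinesAt_cfc`, `Transfor.exists_root`).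

Norm and completeness. Homomorphisms of C*-algebras are contractive, so invertible `*`-functors are
isometric and the supremum norm inherits its laws from the components. A block of transfors is the
closed subspace of intertwining families in an `ℓ^∞`-sum of blocks, hence a Banach space
(`completeSpace_blockSpace`). -/

namespace SmallCStarCat

/-! ### Calculus of sources, targets and composites in one category -/

variable {n : ℕ} [NeZero n] {B : SmallCStarCat.{u} n} {p q : Fin n} {x y z w e : B.Cell}

/-- The composition `∘_q`, extended by the value `x` where it is undefined. -/
noncomputable def mul (B : SmallCStarCat.{u} n) (q : Fin n) (x y : B.Cell) : B.Cell :=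
  @dite _ (B.ops.comp q x y).Dom (Classical.propDecidable _) (fun h => (B.ops.comp q x y).get h)
    (fun _ => x)

theorem oneCat (B : SmallCStarCat.{u} n) (q : Fin n) : B.ops.IsOneCategory q :=
  B.isCStar.globular.oneCategory q

theorem isSource_source (q : Fin n) (x : B.Cell) : B.ops.IsSource q x (B.ops.source q x) :=
  (B.oneCat q).isSource_source x

theorem isTarget_target (q : Fin n) (x : B.Cell) : B.ops.IsTarget q x (B.ops.target q x) :=
  (B.oneCat q).isTarget_target x

theorem isIdent_source (q : Fin n) (x : B.Cell) : B.ops.IsIdent q (B.ops.source q x) :=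
  (isSource_source q x).1

theorem isIdent_target (q : Fin n) (x : B.Cell) : B.ops.IsIdent q (B.ops.target q x) :=
  (isTarget_target q x).1

theorem isSource_iff : B.ops.IsSource q x e ↔ B.ops.source q x = e :=
  ⟨fun h => (B.oneCat q).source_unique (isSource_source q x) h, fun h => h ▸ isSource_source q x⟩

theorem isTarget_iff : B.ops.IsTarget q x e ↔ B.ops.target q x = e :=
  ⟨fun h => (B.oneCat q).target_unique (isTarget_target q x) h, fun h => h ▸ isTarget_target q x⟩

theorem mem_comp_source (q : Fin n) (x : B.Cell) : x ∈ B.ops.comp q x (B.ops.source q x) := by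
  obtain ⟨hi, hd⟩ := isSource_source q x
  have h2 := Part.get_mem hd
  rwa [hi.1 _ _ h2] at h2

theorem target_mem_comp (q : Fin n) (x : B.Cell) : x ∈ B.ops.comp q (B.ops.target q x) x := by
  obtain ⟨hi, hd⟩ := isTarget_target q x
  have h2 := Part.get_mem hd
  rwa [hi.2 _ _ h2] at h2

/-- If `x ∘ y` exists, associativity applied to `(x ∘ s(x)) ∘ y` shows that `s(x) ∘ y` exists. So
`s(x)`, an identity, is the target of `y`. -/
theorem dom_iff : (B.ops.comp q x y).Dom ↔ B.ops.source q x = B.ops.target q y := by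
  constructor
  · intro h
    obtain ⟨k, hk⟩ := Part.dom_iff_mem.1 h
    obtain ⟨m, hm, -⟩ := ((B.oneCat q).assoc x _ y k).2 ⟨x, mem_comp_source q x, hk⟩
    exact (isTarget_iff.1 ⟨isIdent_source q x, Part.dom_iff_mem.2 ⟨m, hm⟩⟩).symm
  · intro h
    exact (B.oneCat q).comp_dom x y _ (isSource_source q x) (isTarget_iff.2 h.symm)

theorem mem_comp_iff :
    z ∈ B.ops.comp q x y ↔ B.ops.source q x = B.ops.target q y ∧ z = B.mul q x y := by
  constructor
  · intro h
    have hd : (B.ops.comp q x y).Dom := Part.dom_iff_mem.2 ⟨z, h⟩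
    refine ⟨dom_iff.1 hd, ?_⟩
    rw [mul, dif_pos hd]
    exact (Part.get_eq_of_mem h hd).symm
  · rintro ⟨h, rfl⟩
    have hd := dom_iff.2 h
    rw [mul, dif_pos hd]
    exact Part.get_mem hd

theorem mul_mem (h : B.ops.source q x = B.ops.target q y) :
    B.mul q x y ∈ B.ops.comp q x y := mem_comp_iff.2 ⟨h, rfl⟩

@[simp] theorem mul_source (q : Fin n) (x : B.Cell) : B.mul q x (B.ops.source q x) = x :=
  (mem_comp_iff.1 (mem_comp_source q x)).2.symm

@[simp] theorem target_mul (q : Fin n) (x : B.Cell) : B.mul q (B.ops.target q x) x = x :=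
  (mem_comp_iff.1 (target_mem_comp q x)).2.symm

theorem source_eq_of_isIdent (h : B.ops.IsIdent q e) : B.ops.source q e = e :=
  (h.2 _ _ (mem_comp_source q e)).symm

theorem target_eq_of_isIdent (h : B.ops.IsIdent q e) : B.ops.target q e = e :=
  (h.1 _ _ (target_mem_comp q e)).symm

theorem isIdent_of_le (hqp : q ≤ p) (h : B.ops.IsIdent q e) : B.ops.IsIdent p e := by
  rcases hqp.eq_or_lt with rfl | hlt
  · exact h
  · exact B.isCStar.globular.ident_mono q p hlt e h

theorem source_source_of_le (hqp : q ≤ p) (x : B.Cell) :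
    B.ops.source p (B.ops.source q x) = B.ops.source q x :=
  source_eq_of_isIdent (isIdent_of_le hqp (isIdent_source q x))

theorem target_source_of_le (hqp : q ≤ p) (x : B.Cell) :
    B.ops.target p (B.ops.source q x) = B.ops.source q x :=
  target_eq_of_isIdent (isIdent_of_le hqp (isIdent_source q x))

theorem source_target_of_le (hqp : q ≤ p) (x : B.Cell) :
    B.ops.source p (B.ops.target q x) = B.ops.target q x :=
  source_eq_of_isIdent (isIdent_of_le hqp (isIdent_target q x))

theorem target_target_of_le (hqp : q ≤ p) (x : B.Cell) :
    B.ops.target p (B.ops.target q x) = B.ops.target q x :=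
  target_eq_of_isIdent (isIdent_of_le hqp (isIdent_target q x))

/-- Exchange applied to `x = x ∘_p s_p(x)` and `s_q(x) = s_q(x) ∘_p s_q(x)` makes `s_p(x) ∘_q
s_q(x)` exist. The three analogues below pick other factors in the same way. -/
theorem source_source_of_lt (hqp : q < p) (x : B.Cell) :
    B.ops.source q (B.ops.source p x) = B.ops.source q x := by
  have hu : B.ops.source q x ∈ B.ops.comp p (B.ops.source q x) (B.ops.source q x) := by
    have := mem_comp_source p (B.ops.source q x)
    rwa [source_source_of_le hqp.le] at this
  obtain ⟨s, t, -, ht, -⟩ := B.isCStar.globular.exchange q p hqp x _ _ _ _ _ _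
    (mem_comp_source p x) hu (mem_comp_source q x)
  exact isSource_iff.1 ⟨isIdent_source q x, Part.dom_iff_mem.2 ⟨t, ht⟩⟩

theorem source_target_of_lt (hqp : q < p) (x : B.Cell) :
    B.ops.source q (B.ops.target p x) = B.ops.source q x := by
  have hu : B.ops.source q x ∈ B.ops.comp p (B.ops.source q x) (B.ops.source q x) := by
    have := mem_comp_source p (B.ops.source q x)
    rwa [source_source_of_le hqp.le] at this
  obtain ⟨s, t, hs, -, -⟩ := B.isCStar.globular.exchange q p hqp _ x _ _ _ _ _
    (target_mem_comp p x) hu (mem_comp_source q x)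
  exact isSource_iff.1 ⟨isIdent_source q x, Part.dom_iff_mem.2 ⟨s, hs⟩⟩

theorem target_source_of_lt (hqp : q < p) (x : B.Cell) :
    B.ops.target q (B.ops.source p x) = B.ops.target q x := by
  have hu : B.ops.target q x ∈ B.ops.comp p (B.ops.target q x) (B.ops.target q x) := by
    have := mem_comp_source p (B.ops.target q x)
    rwa [source_target_of_le hqp.le] at this
  obtain ⟨s, t, -, ht, -⟩ := B.isCStar.globular.exchange q p hqp _ _ x _ _ _ _
    hu (mem_comp_source p x) (target_mem_comp q x)
  exact isTarget_iff.1 ⟨isIdent_target q x, Part.dom_iff_mem.2 ⟨t, ht⟩⟩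

theorem target_target_of_lt (hqp : q < p) (x : B.Cell) :
    B.ops.target q (B.ops.target p x) = B.ops.target q x := by
  have hu : B.ops.target q x ∈ B.ops.comp p (B.ops.target q x) (B.ops.target q x) := by
    have := mem_comp_source p (B.ops.target q x)
    rwa [source_target_of_le hqp.le] at this
  obtain ⟨s, t, hs, -, -⟩ := B.isCStar.globular.exchange q p hqp _ _ _ x _ _ _
    hu (target_mem_comp p x) (target_mem_comp q x)
  exact isTarget_iff.1 ⟨isIdent_target q x, Part.dom_iff_mem.2 ⟨s, hs⟩⟩

@[simp] theorem source_source (q : Fin n) (x : B.Cell) :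
    B.ops.source q (B.ops.source q x) = B.ops.source q x := source_source_of_le le_rfl x

@[simp] theorem target_source (q : Fin n) (x : B.Cell) :
    B.ops.target q (B.ops.source q x) = B.ops.source q x := target_source_of_le le_rfl x

@[simp] theorem source_target (q : Fin n) (x : B.Cell) :
    B.ops.source q (B.ops.target q x) = B.ops.target q x := source_target_of_le le_rfl x

@[simp] theorem target_target (q : Fin n) (x : B.Cell) :
    B.ops.target q (B.ops.target q x) = B.ops.target q x := target_target_of_le le_rfl x

theorem mul_assoc (h₁ : B.ops.source q x = B.ops.target q y)
    (h₂ : B.ops.source q y = B.ops.target q z) :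
    B.mul q (B.mul q x y) z = B.mul q x (B.mul q y z) ∧
      B.ops.source q (B.mul q x y) = B.ops.source q y ∧
      B.ops.target q (B.mul q y z) = B.ops.target q y := by
  -- The source of a composite has to be known before a third factor can be attached. It comes from
  -- associativity with third factor `s(y)`.
  have hxy : ∀ {x y : B.Cell}, B.ops.source q x = B.ops.target q y →
      B.ops.source q (B.mul q x y) = B.ops.source q y := by
    intro x y h
    obtain ⟨m, hm, hk⟩ := ((B.oneCat q).assoc x y (B.ops.source q y) (B.mul q x y)).1
      ⟨y, mem_comp_source q y, mul_mem h⟩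
    obtain rfl := (mem_comp_iff.1 hm).2
    exact (mem_comp_iff.1 hk).1.trans (by simp)
  have h4 : B.ops.source q (B.mul q x y) = B.ops.target q z := (hxy h₁).trans h₂
  obtain ⟨m, hm, hk⟩ := ((B.oneCat q).assoc x y z _).2 ⟨_, mul_mem h₁, mul_mem h4⟩
  obtain rfl := (mem_comp_iff.1 hm).2
  obtain ⟨h5, h6⟩ := mem_comp_iff.1 hk
  exact ⟨h6, hxy h₁, h5.symm.trans h₁⟩

theorem source_mul_self (h : B.ops.source q x = B.ops.target q y) :
    B.ops.source q (B.mul q x y) = B.ops.source q y :=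
  (mul_assoc (z := B.ops.source q y) h (by simp)).2.1

theorem target_mul_self (h : B.ops.source q x = B.ops.target q y) :
    B.ops.target q (B.mul q x y) = B.ops.target q x :=
  (mul_assoc (x := B.ops.target q x) (y := x) (by simp) h).2.2

theorem source_mul_lt (hqp : q < p) (h : B.ops.source p x = B.ops.target p y) :
    B.ops.source q (B.mul p x y) = B.ops.source q x := by
  rw [← source_target_of_lt hqp, target_mul_self h, source_target_of_lt hqp]

theorem source_mul_lt' (hqp : q < p) (h : B.ops.source p x = B.ops.target p y) :
    B.ops.source q (B.mul p x y) = B.ops.source q y := by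
  rw [← source_source_of_lt hqp, source_mul_self h, source_source_of_lt hqp]

theorem target_mul_lt (hqp : q < p) (h : B.ops.source p x = B.ops.target p y) :
    B.ops.target q (B.mul p x y) = B.ops.target q x := by
  rw [← target_target_of_lt hqp, target_mul_self h, target_target_of_lt hqp]

theorem target_mul_lt' (hqp : q < p) (h : B.ops.source p x = B.ops.target p y) :
    B.ops.target q (B.mul p x y) = B.ops.target q y := by
  rw [← target_source_of_lt hqp, source_mul_self h, target_source_of_lt hqp]

theorem exchange (hqp : q < p) (h₁ : B.ops.source p x = B.ops.target p y)
    (h₂ : B.ops.source p w = B.ops.target p z) (h₃ : B.ops.source q x = B.ops.target q w) :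
    B.mul q (B.mul p x y) (B.mul p w z) = B.mul p (B.mul q x w) (B.mul q y z) := by
  have h4 : B.ops.source q (B.mul p x y) = B.ops.target q (B.mul p w z) := by
    rw [source_mul_lt hqp h₁, target_mul_lt hqp h₂, h₃]
  obtain ⟨s, t, hs, ht, hr⟩ := B.isCStar.globular.exchange q p hqp _ _ _ _ _ _ _
    (mul_mem h₁) (mul_mem h₂) (mul_mem h4)
  rw [(mem_comp_iff.1 hr).2, (mem_comp_iff.1 hs).2, (mem_comp_iff.1 ht).2]

/-- By exchange, `x ∘_q y` can be composed over `p` with `s_p(x) ∘_q s_p(y)`, and the latter is a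
`p`-identity because `C^p` is closed under `∘_q`. -/
theorem source_mul_gt (hqp : q < p) (h : B.ops.source q x = B.ops.target q y) :
    B.ops.source p (B.mul q x y) = B.mul q (B.ops.source p x) (B.ops.source p y) := by
  have e := exchange (x := x) (y := B.ops.source p x) (w := y) (z := B.ops.source p y) hqp
    (by simp) (by simp) h
  have h' : B.ops.source q (B.ops.source p x) = B.ops.target q (B.ops.source p y) := by
    rw [source_source_of_lt hqp, target_source_of_lt hqp, h]
  have hid : B.ops.IsIdent p (B.mul q (B.ops.source p x) (B.ops.source p y)) :=
    B.isCStar.globular.ident_comp q p hqp _ _ _ (isIdent_source p x) (isIdent_source p y)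
      (mul_mem h')
  obtain ⟨s, t, hs, ht, hr⟩ := B.isCStar.globular.exchange q p hqp _ _ _ _ _ _ _
    (mem_comp_source p x) (mem_comp_source p y) (mul_mem h)
  obtain rfl := (mem_comp_iff.1 hs).2
  obtain rfl := (mem_comp_iff.1 ht).2
  exact isSource_iff.1 ⟨hid, Part.dom_iff_mem.2 ⟨_, hr⟩⟩

theorem target_mul_gt (hqp : q < p) (h : B.ops.source q x = B.ops.target q y) :
    B.ops.target p (B.mul q x y) = B.mul q (B.ops.target p x) (B.ops.target p y) := by
  have h' : B.ops.source q (B.ops.target p x) = B.ops.target q (B.ops.target p y) := by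
    rw [source_target_of_lt hqp, target_target_of_lt hqp, h]
  have hid : B.ops.IsIdent p (B.mul q (B.ops.target p x) (B.ops.target p y)) :=
    B.isCStar.globular.ident_comp q p hqp _ _ _ (isIdent_target p x) (isIdent_target p y)
      (mul_mem h')
  obtain ⟨s, t, hs, ht, hr⟩ := B.isCStar.globular.exchange q p hqp _ _ _ _ _ _ _
    (target_mem_comp p x) (target_mem_comp p y) (mul_mem h)
  obtain rfl := (mem_comp_iff.1 hs).2
  obtain rfl := (mem_comp_iff.1 ht).2
  exact isTarget_iff.1 ⟨hid, Part.dom_iff_mem.2 ⟨_, hr⟩⟩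

/-! ### Involutions -/

@[simp] theorem star_star (q : Fin n) (x : B.Cell) : B.ops.star q (B.ops.star q x) = x :=
  B.isCStar.involutive.star_star q x

theorem star_comm (p q : Fin n) (x : B.Cell) :
    B.ops.star p (B.ops.star q x) = B.ops.star q (B.ops.star p x) :=
  B.isCStar.involutive.star_comm p q x

theorem isIdent_star (q : Fin n) (h : B.ops.IsIdent p e) : B.ops.IsIdent p (B.ops.star q e) :=
  B.isCStar.involutive.star_ident p q e h

/-- Read off from the existence of `x^* ∘ x`, which is part of the C*-axiom. -/
theorem source_star_self (q : Fin n) (x : B.Cell) :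
    B.ops.source q (B.ops.star q x) = B.ops.target q x := by
  obtain ⟨z, hz, -⟩ := B.isCStar.nrm_star_comp q x
  exact (mem_comp_iff.1 hz).1

theorem target_star_self (q : Fin n) (x : B.Cell) :
    B.ops.target q (B.ops.star q x) = B.ops.source q x := by
  rw [← source_star_self, star_star]

/-- `e^*` is again a `p`-identity, hence equal to its own `p`-source, and this is the `p`-target of
`e`. -/
theorem star_eq_of_isIdent (hqp : q ≤ p) (h : B.ops.IsIdent q e) : B.ops.star p e = e := by
  have h1 := isIdent_of_le hqp h
  rw [← source_eq_of_isIdent (isIdent_star p h1), source_star_self, target_eq_of_isIdent h1]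

theorem star_mul_self (h : B.ops.source q x = B.ops.target q y) :
    B.ops.star q (B.mul q x y) = B.mul q (B.ops.star q y) (B.ops.star q x) :=
  (mem_comp_iff.1 (B.isCStar.involutive.star_comp_self q _ _ _ (mul_mem h))).2

theorem star_mul_ne (hpq : p ≠ q) (h : B.ops.source p x = B.ops.target p y) :
    B.ops.star q (B.mul p x y) = B.mul p (B.ops.star q x) (B.ops.star q y) :=
  (mem_comp_iff.1 (B.isCStar.involutive.star_comp_of_ne p q hpq _ _ _ (mul_mem h))).2

theorem source_star_ne (hpq : p ≠ q) (x : B.Cell) :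
    B.ops.source p (B.ops.star q x) = B.ops.star q (B.ops.source p x) :=
  isSource_iff.1 ⟨isIdent_star q (isIdent_source p x), Part.dom_iff_mem.2 ⟨_,
    B.isCStar.involutive.star_comp_of_ne p q hpq _ _ _ (mem_comp_source p x)⟩⟩

theorem target_star_ne (hpq : p ≠ q) (x : B.Cell) :
    B.ops.target p (B.ops.star q x) = B.ops.star q (B.ops.target p x) :=
  isTarget_iff.1 ⟨isIdent_star q (isIdent_target p x), Part.dom_iff_mem.2 ⟨_,
    B.isCStar.involutive.star_comp_of_ne p q hpq _ _ _ (target_mem_comp p x)⟩⟩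

theorem source_star_lt (hpq : p < q) (x : B.Cell) :
    B.ops.source p (B.ops.star q x) = B.ops.source p x := by
  rw [source_star_ne hpq.ne, star_eq_of_isIdent hpq.le (isIdent_source p x)]

theorem target_star_lt (hpq : p < q) (x : B.Cell) :
    B.ops.target p (B.ops.star q x) = B.ops.target p x := by
  rw [target_star_ne hpq.ne, star_eq_of_isIdent hpq.le (isIdent_target p x)]

theorem source_star_mul (q : Fin n) (x : B.Cell) :
    B.ops.source ⊤ (B.mul q (B.ops.star q x) x) = B.ops.source q x :=
  (B.isCStar.positive q x _ (mul_mem (source_star_self q x))).1.1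

theorem target_star_mul (q : Fin n) (x : B.Cell) :
    B.ops.target ⊤ (B.mul q (B.ops.star q x) x) = B.ops.source q x :=
  (B.isCStar.positive q x _ (mul_mem (source_star_self q x))).1.2

/-- Cells of order less than `n` are unitary for all the lower compositions. -/
theorem star_mul_of_isIdent (hx : B.ops.IsIdent ⊤ x) (hq : q < ⊤) :
    B.mul q (B.ops.star q x) x = B.ops.source q x := by
  -- By positivity `x^* ∘_q x` has `(n-1)`-source `s_q(x)`. Its `(n-1)`-source is also computed
  -- factor by factor, and `x` is its own `(n-1)`-source.
  rw [← source_star_mul q x, source_mul_gt hq (source_star_self q x), source_star_ne hq.ne',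
    source_eq_of_isIdent hx]

/-! ### Norms -/

theorem nrm_star_mul (q : Fin n) (x : B.Cell) :
    B.ops.nrm (B.mul q (B.ops.star q x) x) = B.ops.nrm x ^ 2 := by
  obtain ⟨z, hz, h⟩ := B.isCStar.nrm_star_comp q x
  rw [← (mem_comp_iff.1 hz).2, h]

theorem nrm_mul_le (h : B.ops.source q x = B.ops.target q y) :
    B.ops.nrm (B.mul q x y) ≤ B.ops.nrm x * B.ops.nrm y :=
  B.isCStar.nrm_comp_le q _ _ _ (mul_mem h)

/-! ### Blocks -/

theorem parallel_target_source (x : B.Cell) :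
    B.ops.Parallel (B.ops.target ⊤ x) (B.ops.source ⊤ x) :=
  ⟨isIdent_target _ x, isIdent_source _ x, fun q hq => by
    rw [source_target_of_lt hq, source_source_of_lt hq, target_target_of_lt hq,
      target_source_of_lt hq]; exact ⟨rfl, rfl⟩⟩

/-- Pairs of `(n-1)`-cells in globular position. -/
structure Pair (B : SmallCStarCat.{u} n) : Type u where
  tgt : B.Cell
  src : B.Cell
  parallel : B.ops.Parallel tgt src

namespace Pair

/-- The block of a pair. -/
def Hom (e : B.Pair) : Type u := B.ops.Block e.tgt e.src

variable (e : B.Pair)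

noncomputable instance : NormedAddCommGroup e.Hom :=
  (B.isCStar.banach e.tgt e.src e.parallel).choose

noncomputable instance : NormedSpace ℂ e.Hom :=
  (B.isCStar.banach e.tgt e.src e.parallel).choose_spec.choose

instance : CompleteSpace e.Hom :=
  (B.isCStar.banach e.tgt e.src e.parallel).choose_spec.choose_spec.1

variable {e}

theorem coe_add (x y : e.Hom) : (x + y).1 = B.ops.plus x.1 y.1 :=
  (B.isCStar.banach e.tgt e.src e.parallel).choose_spec.choose_spec.2.1 x y

theorem coe_smul (c : ℂ) (x : e.Hom) : (c • x).1 = B.ops.scale c x.1 :=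
  (B.isCStar.banach e.tgt e.src e.parallel).choose_spec.choose_spec.2.2.1 c x

theorem norm_eq (x : e.Hom) : ‖x‖ = B.ops.nrm x.1 :=
  (B.isCStar.banach e.tgt e.src e.parallel).choose_spec.choose_spec.2.2.2 x

@[ext] theorem Hom.ext {x y : e.Hom} (h : x.1 = y.1) : x = y := Subtype.ext h

theorem source_coe (x : e.Hom) : B.ops.source ⊤ x.1 = e.src := x.2.1

theorem target_coe (x : e.Hom) : B.ops.target ⊤ x.1 = e.tgt := x.2.2

end Pair

/-- The pair of the `(n-1)`-target and the `(n-1)`-source of a cell. -/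
noncomputable def pair (x : B.Cell) : B.Pair := ⟨_, _, parallel_target_source x⟩

/-- A cell as an element of a block. -/
def toHom (e : B.Pair) (x : B.Cell) (hs : B.ops.source ⊤ x = e.src)
    (ht : B.ops.target ⊤ x = e.tgt) :
    e.Hom := ⟨x, hs, ht⟩

theorem nrm_nonneg (x : B.Cell) : 0 ≤ B.ops.nrm x := by
  have := (Pair.norm_eq (toHom (pair x) x rfl rfl))
  rw [show (toHom (pair x) x rfl rfl).1 = x from rfl] at this
  rw [← this]; exact norm_nonneg _

/-- The usual argument: `‖x‖² = ‖x^* x‖ ≤ ‖x^*‖ ‖x‖`, and the same for `x^*`. -/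
theorem nrm_star (q : Fin n) (x : B.Cell) : B.ops.nrm (B.ops.star q x) = B.ops.nrm x := by
  have key : ∀ x : B.Cell, B.ops.nrm x ≤ B.ops.nrm (B.ops.star q x) := by
    intro x
    have h1 := nrm_star_mul q x
    have h2 := nrm_mul_le (source_star_self q x)
    rw [h1, sq] at h2
    rcases (nrm_nonneg x).eq_or_lt with h | h
    · rw [← h]; exact nrm_nonneg _
    · exact le_of_mul_le_mul_right h2 h
  exact le_antisymm (by simpa using key (B.ops.star q x)) (key x)

/-- `e = e^* e` gives `‖e‖ = ‖e‖²`. The norm may be `0`, when the block is zero, so only an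
inequality is claimed; it serves to bound the transfors of sources and targets. -/
theorem nrm_le_one_of_isIdent (h : B.ops.IsIdent q e) : B.ops.nrm e ≤ 1 := by
  have h1 := nrm_star_mul q e
  have h2 : B.mul q e e = e := by
    simpa only [source_eq_of_isIdent h] using mul_source q e
  rw [star_eq_of_isIdent le_rfl h, h2] at h1
  nlinarith [nrm_nonneg e]

/-! ### Linear structure -/

theorem _root_.CellOps.SameBlock.source_eq (h : B.ops.SameBlock x y) (q : Fin n) :
    B.ops.source q x = B.ops.source q y := by
  rcases (le_top : q ≤ ⊤).eq_or_lt with rfl | hlt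
  · exact h.1
  · rw [← source_source_of_lt hlt x, h.1, source_source_of_lt hlt]

theorem _root_.CellOps.SameBlock.target_eq (h : B.ops.SameBlock x y) (q : Fin n) :
    B.ops.target q x = B.ops.target q y := by
  rcases (le_top : q ≤ ⊤).eq_or_lt with rfl | hlt
  · exact h.2
  · rw [← target_target_of_lt hlt x, h.2, target_target_of_lt hlt]

theorem _root_.CellOps.SameBlock.mul {x' y' : B.Cell} (h : B.ops.SameBlock x x')
    (h' : B.ops.SameBlock y y')
    (hc : B.ops.source q x = B.ops.target q y) :
    B.ops.SameBlock (B.mul q x y) (B.mul q x' y') := by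
  have hc' : B.ops.source q x' = B.ops.target q y' := by
    rw [← h.source_eq, ← h'.target_eq, hc]
  rcases (le_top : q ≤ ⊤).eq_or_lt with rfl | hlt
  · exact ⟨by rw [source_mul_self hc, source_mul_self hc', h'.1],
      by rw [target_mul_self hc, target_mul_self hc', h.2]⟩
  · exact ⟨by rw [source_mul_gt hlt hc, source_mul_gt hlt hc', h.1, h'.1],
      by rw [target_mul_gt hlt hc, target_mul_gt hlt hc', h.2, h'.2]⟩

theorem _root_.CellOps.SameBlock.star (h : B.ops.SameBlock x y) (q : Fin n) :
    B.ops.SameBlock (B.ops.star q x) (B.ops.star q y) := by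
  rcases (le_top : q ≤ ⊤).eq_or_lt with rfl | hlt
  · exact ⟨by rw [source_star_self, source_star_self, h.2],
      by rw [target_star_self, target_star_self, h.1]⟩
  · exact ⟨by rw [source_star_ne hlt.ne', source_star_ne hlt.ne', h.1],
      by rw [target_star_ne hlt.ne', target_star_ne hlt.ne', h.2]⟩

/-- The raw operation `plus` is total. That it stays in the block is known only through its
agreement with the addition of the Banach space. -/
theorem sameBlock_plus (h : B.ops.SameBlock x y) : B.ops.SameBlock (B.ops.plus x y) x := by
  have h1 := Pair.coe_add (toHom (pair x) x rfl rfl) (toHom (pair x) y h.1.symm h.2.symm)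
  have h2 := (toHom (pair x) x rfl rfl + toHom (pair x) y h.1.symm h.2.symm).2
  rw [h1] at h2
  exact h2

theorem sameBlock_scale (c : ℂ) (x : B.Cell) : B.ops.SameBlock (B.ops.scale c x) x := by
  have h1 := Pair.coe_smul c (toHom (pair x) x rfl rfl)
  have h2 := (c • toHom (pair x) x rfl rfl).2
  rw [h1] at h2
  exact h2

theorem plus_mul {x' : B.Cell} (h : B.ops.SameBlock x x')
    (hc : B.ops.source q x = B.ops.target q y) :
    B.mul q (B.ops.plus x x') y = B.ops.plus (B.mul q x y) (B.mul q x' y) :=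
  (mem_comp_iff.1 (B.isCStar.plus_comp q _ _ _ _ _ h (mul_mem hc)
    (mul_mem (by rw [← h.source_eq, hc])))).2.symm

theorem mul_plus {y' : B.Cell} (h : B.ops.SameBlock y y')
    (hc : B.ops.source q x = B.ops.target q y) :
    B.mul q x (B.ops.plus y y') = B.ops.plus (B.mul q x y) (B.mul q x y') :=
  (mem_comp_iff.1 (B.isCStar.comp_plus q _ _ _ _ _ h (mul_mem hc)
    (mul_mem (by rw [← h.target_eq, hc])))).2.symm

theorem scale_mul (c : ℂ) (hc : B.ops.source q x = B.ops.target q y) :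
    B.mul q (B.ops.scale c x) y = B.ops.scale c (B.mul q x y) :=
  (mem_comp_iff.1 (B.isCStar.scale_comp q c _ _ _ (mul_mem hc))).2.symm

theorem mul_scale (c : ℂ) (hc : B.ops.source q x = B.ops.target q y) :
    B.mul q x (B.ops.scale c y) = B.ops.scale c (B.mul q x y) :=
  (mem_comp_iff.1 (B.isCStar.comp_scale q c _ _ _ (mul_mem hc))).2.symm

theorem star_plus (q : Fin n) (h : B.ops.SameBlock x y) :
    B.ops.star q (B.ops.plus x y) = B.ops.plus (B.ops.star q x) (B.ops.star q y) :=
  B.isCStar.star_plus q x y h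

theorem star_scale (q : Fin n) (c : ℂ) (x : B.Cell) :
    B.ops.star q (B.ops.scale c x) = B.ops.scale (starRingEnd ℂ c) (B.ops.star q x) :=
  B.isCStar.star_scale q c x

/-- In a block, `x - y`. -/
noncomputable def minus (B : SmallCStarCat.{u} n) (x y : B.Cell) : B.Cell :=
  B.ops.plus x (B.ops.scale (-1) y)

theorem nrm_minus_eq_zero_iff (h : B.ops.SameBlock x y) : B.ops.nrm (B.minus x y) = 0 ↔ x = y := by
  set X := toHom (pair x) x rfl rfl
  set Y := toHom (pair x) y h.1.symm h.2.symm
  have h1 : (X - Y).1 = B.minus x y := by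
    rw [sub_eq_add_neg, ← neg_one_smul ℂ, Pair.coe_add, Pair.coe_smul]; rfl
  rw [← h1, ← Pair.norm_eq, norm_eq_zero, sub_eq_zero]
  exact ⟨fun h => congrArg Subtype.val h, fun h => Pair.Hom.ext h⟩

/-- Two cells of a block with equal Gram matrix agree. -/
theorem eq_of_gram (h : B.ops.SameBlock x y)
    (h₁ : B.mul q (B.ops.star q x) x = B.mul q (B.ops.star q y) x)
    (h₂ : B.mul q (B.ops.star q x) y = B.mul q (B.ops.star q y) y) : x = y := by
  have hb : B.ops.SameBlock x (B.ops.scale (-1) y) :=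
    ⟨h.1.trans (sameBlock_scale _ y).1.symm, h.2.trans (sameBlock_scale _ y).2.symm⟩
  have hm : B.ops.SameBlock (B.minus x y) x := sameBlock_plus hb
  have hb' := CellOps.SameBlock.star hb q
  have hs : B.ops.star q (B.minus x y) = B.ops.plus (B.ops.star q x) (B.ops.scale (-1)
      (B.ops.star q y)) := by
    rw [minus, star_plus q hb, star_scale]; simp
  have hyx : B.ops.source q (B.ops.star q y) = B.ops.target q x := by
    rw [source_star_self, ← h.target_eq]
  have hxy : B.ops.source q (B.ops.star q x) = B.ops.target q y := by
    rw [source_star_self, h.target_eq]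
  have e1 : B.mul q (B.ops.star q (B.minus x y)) x = B.minus (B.mul q (B.ops.star q x) x)
      (B.mul q (B.ops.star q y) x) := by
    rw [hs, plus_mul _ (source_star_self q x), scale_mul _ hyx]; rfl
    rw [star_scale] at hb'; simpa using hb'
  have e2 : B.mul q (B.ops.star q (B.minus x y)) y = B.minus (B.mul q (B.ops.star q x) y)
      (B.mul q (B.ops.star q y) y) := by
    rw [hs, plus_mul _ hxy, scale_mul _ (source_star_self q y)]; rfl
    rw [star_scale] at hb'; simpa using hb'
  have hmx : B.ops.source q (B.ops.star q (B.minus x y)) = B.ops.target q x := by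
    rw [source_star_self, hm.target_eq]
  have e3 : B.mul q (B.ops.star q (B.minus x y)) (B.minus x y) =
      B.minus (B.mul q (B.ops.star q (B.minus x y)) x)
        (B.mul q (B.ops.star q (B.minus x y)) y) := by
    conv_lhs => rw [minus, mul_plus hb (by rw [source_star_self]; exact hm.target_eq q),
      mul_scale _ (by rw [source_star_self, ← h.target_eq]; exact hm.target_eq q)]
    rfl
  -- Both sides are differences of a cell with itself, hence zeros of their blocks, and the two
  -- blocks coincide.
  have e4 : B.mul q (B.ops.star q (B.minus x y)) x = B.mul q (B.ops.star q (B.minus x y)) y := by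
    set zx := B.mul q (B.ops.star q y) x
    set zy := B.mul q (B.ops.star q y) y
    have hz : B.ops.SameBlock zx zy := CellOps.SameBlock.mul ⟨rfl, rfl⟩ h hyx
    rw [e1, e2, h₁, h₂]
    have hz0 : ∀ a : B.Cell, B.minus a a = (0 : (pair a).Hom).1 := by
      intro a
      have : (toHom (pair a) a rfl rfl - toHom (pair a) a rfl rfl).1 = B.minus a a := by
        rw [sub_eq_add_neg, ← neg_one_smul ℂ, Pair.coe_add, Pair.coe_smul]; rfl
      rw [← this, sub_self]
    have hp : pair zx = pair zy := by
      unfold pair; congr 1; exacts [hz.2, hz.1]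
    rw [hz0, hz0, hp]
  -- C*-identity: `‖x - y‖²` is the norm of `(x - y)^* (x - y)`, which is now zero.
  have e5 := nrm_star_mul q (B.minus x y)
  rw [e3, e4, (nrm_minus_eq_zero_iff ⟨rfl, rfl⟩).2 rfl] at e5
  exact (nrm_minus_eq_zero_iff h).1 (pow_eq_zero_iff (two_ne_zero) |>.1 e5.symm)

/-- Right cancellation: `y x x^* = y' x x^*` implies `y x = y' x`. -/
theorem cancel_star {y' : B.Cell} (h : B.ops.SameBlock y y')
    (hc : B.ops.source q y = B.ops.target q x)
    (he : B.mul q y (B.mul q x (B.ops.star q x)) = B.mul q y' (B.mul q x (B.ops.star q x))) :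
    B.mul q y x = B.mul q y' x := by
  have hc' : B.ops.source q y' = B.ops.target q x := by rw [← h.source_eq, hc]
  have hxs : B.ops.source q x = B.ops.target q (B.ops.star q x) := (target_star_self q x).symm
  -- `y x (w x)^* = y (x x^*) w^*`, which the hypothesis identifies with the same product for `y'`.
  -- The choices `w = y` and `w = y'` are the two Gram conditions for `(y x)^*` and `(y' x)^*`.
  have key : ∀ w : B.Cell, B.ops.source q w = B.ops.target q x →
      B.mul q (B.mul q y x) (B.ops.star q (B.mul q w x)) =
        B.mul q (B.mul q y' x) (B.ops.star q (B.mul q w x)) := by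
    intro w hw
    have h3 : B.ops.source q (B.ops.star q x) = B.ops.target q (B.ops.star q w) := by
      rw [source_star_self, target_star_self, hw]
    have h4 : ∀ v : B.Cell, B.ops.source q v = B.ops.target q x →
        B.mul q (B.mul q v x) (B.mul q (B.ops.star q x) (B.ops.star q w)) =
          B.mul q (B.mul q v (B.mul q x (B.ops.star q x))) (B.ops.star q w) := by
      intro v hv
      have hvx : B.ops.source q (B.mul q v x) = B.ops.target q (B.ops.star q x) := by
        rw [source_mul_self hv, hxs]
      rw [← (mul_assoc hvx h3).1, (mul_assoc hv hxs).1]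
    rw [star_mul_self hw, h4 y hc, h4 y' hc', he]
  have hb : B.ops.SameBlock (B.mul q y x) (B.mul q y' x) := CellOps.SameBlock.mul h ⟨rfl, rfl⟩ hc
  have := eq_of_gram (q := q) (CellOps.SameBlock.star hb q)
    (by rw [star_star, star_star, key y hc]) (by rw [star_star, star_star, key y' hc'])
  rw [← star_star q (B.mul q y x), this, star_star]

end SmallCStarCat

namespace SmallCStarCat

variable {n : ℕ} [NeZero n] {A B C : SmallCStarCat.{u} n} {p q k : Fin n}

/-! ### The C*-algebras `C_{ee}` -/

theorem source_eq_of_source_top {x e : B.Cell} (he : B.ops.IsIdent k e)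
    (hx : B.ops.source ⊤ x = e) : B.ops.source k x = e := by
  rcases (le_top : k ≤ ⊤).eq_or_lt with rfl | hlt
  · exact hx
  · rw [← source_source_of_lt hlt, hx, source_eq_of_isIdent he]

theorem target_eq_of_target_top {x e : B.Cell} (he : B.ops.IsIdent k e)
    (hx : B.ops.target ⊤ x = e) : B.ops.target k x = e := by
  rcases (le_top : k ≤ ⊤).eq_or_lt with rfl | hlt
  · exact hx
  · rw [← target_target_of_lt hlt, hx, target_eq_of_isIdent he]

theorem source_top_mul {x y e : B.Cell} (he : B.ops.IsIdent k e) (hx : B.ops.source ⊤ x = e)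
    (hy : B.ops.source ⊤ y = e) (hy' : B.ops.target ⊤ y = e) :
    B.ops.source ⊤ (B.mul k x y) = e := by
  have hc : B.ops.source k x = B.ops.target k y :=
    (source_eq_of_source_top he hx).trans (target_eq_of_target_top he hy').symm
  rcases (le_top : k ≤ ⊤).eq_or_lt with rfl | hlt
  · rw [source_mul_self hc, hy]
  · rw [source_mul_gt hlt hc, hx, hy]
    simpa only [source_eq_of_isIdent he] using mul_source k e

theorem target_top_mul {x y e : B.Cell} (he : B.ops.IsIdent k e) (hx : B.ops.source ⊤ x = e)
    (hx' : B.ops.target ⊤ x = e) (hy' : B.ops.target ⊤ y = e) :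
    B.ops.target ⊤ (B.mul k x y) = e := by
  have hc : B.ops.source k x = B.ops.target k y :=
    (source_eq_of_source_top he hx).trans (target_eq_of_target_top he hy').symm
  rcases (le_top : k ≤ ⊤).eq_or_lt with rfl | hlt
  · rw [target_mul_self hc, hx']
  · rw [target_mul_gt hlt hc, hx', hy']
    simpa only [source_eq_of_isIdent he] using mul_source k e

theorem source_top_star {x e : B.Cell} (he : B.ops.IsIdent k e) (hx : B.ops.source ⊤ x = e)
    (hx' : B.ops.target ⊤ x = e) : B.ops.source ⊤ (B.ops.star k x) = e := by
  rcases (le_top : k ≤ ⊤).eq_or_lt with rfl | hlt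
  · rw [source_star_self, hx']
  · rw [source_star_ne hlt.ne', hx, star_eq_of_isIdent le_rfl he]

theorem target_top_star {x e : B.Cell} (he : B.ops.IsIdent k e) (hx : B.ops.source ⊤ x = e)
    (hx' : B.ops.target ⊤ x = e) : B.ops.target ⊤ (B.ops.star k x) = e := by
  rcases (le_top : k ≤ ⊤).eq_or_lt with rfl | hlt
  · rw [target_star_self, hx]
  · rw [target_star_ne hlt.ne', hx', star_eq_of_isIdent le_rfl he]

/-- The pair `(e, e)`. -/
def endPair (B : SmallCStarCat.{u} n) (k : Fin n) (e : {e : B.Cell // B.ops.IsIdent k e}) :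
    B.Pair :=
  ⟨e, e, isIdent_of_le le_top e.2, isIdent_of_le le_top e.2, fun _ _ => ⟨rfl, rfl⟩⟩

/-- The block `C_{ee}` of a `k`-identity `e`, with the product `∘_k` and the involution `*_k`. -/
def EndAlg (B : SmallCStarCat.{u} n) (k : Fin n) (e : {e : B.Cell // B.ops.IsIdent k e}) :
    Type u := (B.endPair k e).Hom

namespace EndAlg

variable {e : {e : B.Cell // B.ops.IsIdent k e}}

noncomputable instance : NormedAddCommGroup (B.EndAlg k e) :=
  inferInstanceAs (NormedAddCommGroup (B.endPair k e).Hom)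

noncomputable instance : NormedSpace ℂ (B.EndAlg k e) :=
  inferInstanceAs (NormedSpace ℂ (B.endPair k e).Hom)

instance : CompleteSpace (B.EndAlg k e) := inferInstanceAs (CompleteSpace (B.endPair k e).Hom)

@[ext] theorem ext {x y : B.EndAlg k e} (h : x.1 = y.1) : x = y := Subtype.ext h

theorem coe_add (x y : B.EndAlg k e) : (x + y).1 = B.ops.plus x.1 y.1 := Pair.coe_add _ _

theorem coe_smul (c : ℂ) (x : B.EndAlg k e) : (c • x).1 = B.ops.scale c x.1 := Pair.coe_smul _ _

theorem norm_eq (x : B.EndAlg k e) : ‖x‖ = B.ops.nrm x.1 := Pair.norm_eq x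

theorem source_top (x : B.EndAlg k e) : B.ops.source ⊤ x.1 = e.1 := x.2.1

theorem target_top (x : B.EndAlg k e) : B.ops.target ⊤ x.1 = e.1 := x.2.2

theorem source_coe (x : B.EndAlg k e) : B.ops.source k x.1 = e.1 :=
  source_eq_of_source_top e.2 x.2.1

theorem target_coe (x : B.EndAlg k e) : B.ops.target k x.1 = e.1 :=
  target_eq_of_target_top e.2 x.2.2

theorem composable (x y : B.EndAlg k e) : B.ops.source k x.1 = B.ops.target k y.1 :=
  (source_coe x).trans (target_coe y).symm

theorem sameBlock (x y : B.EndAlg k e) : B.ops.SameBlock x.1 y.1 :=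
  ⟨x.2.1.trans y.2.1.symm, x.2.2.trans y.2.2.symm⟩

noncomputable instance : Mul (B.EndAlg k e) :=
  ⟨fun x y => ⟨B.mul k x.1 y.1, source_top_mul e.2 x.2.1 y.2.1 y.2.2,
    target_top_mul e.2 x.2.1 x.2.2 y.2.2⟩⟩

noncomputable instance : One (B.EndAlg k e) :=
  ⟨⟨e.1, source_eq_of_isIdent (isIdent_of_le le_top e.2),
    target_eq_of_isIdent (isIdent_of_le le_top e.2)⟩⟩

instance : Star (B.EndAlg k e) :=
  ⟨fun x => ⟨B.ops.star k x.1, source_top_star e.2 x.2.1 x.2.2, target_top_star e.2 x.2.1 x.2.2⟩⟩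

theorem coe_mul (x y : B.EndAlg k e) : (x * y).1 = B.mul k x.1 y.1 := rfl

theorem coe_one : (1 : B.EndAlg k e).1 = e.1 := rfl

theorem coe_star (x : B.EndAlg k e) : (star x).1 = B.ops.star k x.1 := rfl

theorem smul_mul (c : ℂ) (x y : B.EndAlg k e) : c • x * y = c • (x * y) :=
  ext (by rw [coe_mul, coe_smul, coe_smul, scale_mul c (composable x y), coe_mul])

theorem mul_smul' (c : ℂ) (x y : B.EndAlg k e) : x * c • y = c • (x * y) :=
  ext (by rw [coe_mul, coe_smul, coe_smul, mul_scale c (composable x y), coe_mul])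

noncomputable instance : NormedRing (B.EndAlg k e) where
  __ := (inferInstance : NormedAddCommGroup (B.EndAlg k e))
  left_distrib x y z := ext (by
    rw [coe_mul, coe_add, coe_add, mul_plus (sameBlock y z) (composable x y)]; rfl)
  right_distrib x y z := ext (by
    rw [coe_mul, coe_add, coe_add, plus_mul (sameBlock x y) (composable x z)]; rfl)
  -- Bilinearity is only blockwise, so absorption by zero is extracted from homogeneity at the
  -- scalar `0`.
  zero_mul x := by
    have := smul_mul 0 (0 : B.EndAlg k e) x
    rwa [zero_smul, zero_smul] at this
  mul_zero x := by
    have := mul_smul' 0 x (0 : B.EndAlg k e)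
    rwa [zero_smul, zero_smul] at this
  mul_assoc x y z := ext (mul_assoc (composable x y) (composable y z)).1
  one_mul x := ext (by rw [coe_mul, coe_one, ← target_coe x, target_mul])
  mul_one x := ext (by rw [coe_mul, coe_one, ← source_coe x, mul_source])
  norm_mul_le x y := by
    rw [norm_eq, norm_eq, norm_eq]; exact nrm_mul_le (composable x y)

noncomputable instance : Algebra ℂ (B.EndAlg k e) := Algebra.ofModule smul_mul mul_smul'

noncomputable instance : NormedAlgebra ℂ (B.EndAlg k e) where
  norm_smul_le c x := norm_smul_le c x

noncomputable instance : StarRing (B.EndAlg k e) where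
  star_involutive x := ext (star_star k x.1)
  star_mul x y := ext (star_mul_self (composable x y))
  star_add x y := ext (by
    rw [coe_star, coe_add, coe_add, star_plus k (sameBlock x y)]; rfl)

instance : StarModule ℂ (B.EndAlg k e) where
  star_smul c x := ext (by rw [coe_star, coe_smul, coe_smul, star_scale]; rfl)

instance : CStarRing (B.EndAlg k e) where
  norm_mul_self_le x := by
    rw [norm_eq, norm_eq, coe_mul, coe_star, nrm_star_mul, sq]

noncomputable instance : CStarAlgebra (B.EndAlg k e) where

end EndAlg

/-! ### Invertible `*`-functors -/

namespace StarIso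

theorem ext {φ ψ : StarIso A B} (h : ∀ x, φ x = ψ x) : φ = ψ := by
  obtain ⟨f, _, _⟩ := φ
  obtain ⟨g, _, _⟩ := ψ
  obtain rfl : f = g := Equiv.ext h
  rfl

/-- The identity functor. -/
def refl (A : SmallCStarCat.{u} n) : StarIso A A where
  toEquiv := Equiv.refl _
  isStarFunctor := ⟨fun _ _ _ _ h => h, fun _ _ h => h, fun _ _ => rfl, fun _ _ _ => rfl,
    fun _ _ => rfl⟩
  isStarFunctor_symm := ⟨fun _ _ _ _ h => h, fun _ _ h => h, fun _ _ => rfl, fun _ _ _ => rfl,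
    fun _ _ => rfl⟩

@[simp] theorem refl_apply (x : A.Cell) : refl A x = x := rfl

@[simp] theorem symm_apply_apply (φ : StarIso A B) (x : A.Cell) : φ.symm (φ x) = x :=
  φ.toEquiv.symm_apply_apply x

@[simp] theorem apply_symm_apply (φ : StarIso A B) (x : B.Cell) : φ (φ.symm x) = x :=
  φ.toEquiv.apply_symm_apply x

@[simp] theorem ob_coe (φ : StarIso A B) (a : A.Ob) : (φ.ob a).1 = φ a.1 := rfl

@[simp] theorem symm_ob_ob (φ : StarIso A B) (a : A.Ob) : φ.symm.ob (φ.ob a) = a :=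
  Subtype.ext (φ.symm_apply_apply a.1)

@[simp] theorem ob_symm_ob (φ : StarIso A B) (b : B.Ob) : φ.ob (φ.symm.ob b) = b :=
  Subtype.ext (φ.apply_symm_apply b.1)

variable (φ : StarIso A B) {x y e : A.Cell}

theorem map_isIdent (h : A.ops.IsIdent q e) : B.ops.IsIdent q (φ e) :=
  φ.isStarFunctor.map_ident q e h

theorem map_source (q : Fin n) (x : A.Cell) :
    φ (A.ops.source q x) = B.ops.source q (φ x) :=
  (isSource_iff.1 ⟨φ.map_isIdent (isIdent_source q x), Part.dom_iff_mem.2 ⟨_,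
    φ.isStarFunctor.map_comp q _ _ _ (mem_comp_source q x)⟩⟩).symm

theorem map_target (q : Fin n) (x : A.Cell) :
    φ (A.ops.target q x) = B.ops.target q (φ x) :=
  (isTarget_iff.1 ⟨φ.map_isIdent (isIdent_target q x), Part.dom_iff_mem.2 ⟨_,
    φ.isStarFunctor.map_comp q _ _ _ (target_mem_comp q x)⟩⟩).symm

theorem map_star (q : Fin n) (x : A.Cell) : φ (A.ops.star q x) = B.ops.star q (φ x) :=
  φ.isStarFunctor.map_star q x

theorem map_mul (h : A.ops.source q x = A.ops.target q y) :
    φ (A.mul q x y) = B.mul q (φ x) (φ y) :=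
  (mem_comp_iff.1 (φ.isStarFunctor.map_comp q _ _ _ (mul_mem h))).2

theorem map_plus (h : A.ops.SameBlock x y) :
    φ (A.ops.plus x y) = B.ops.plus (φ x) (φ y) := φ.isStarFunctor.map_plus x y h

theorem map_scale (c : ℂ) (x : A.Cell) :
    φ (A.ops.scale c x) = B.ops.scale c (φ x) := φ.isStarFunctor.map_scale c x

theorem map_sameBlock (h : A.ops.SameBlock x y) : B.ops.SameBlock (φ x) (φ y) :=
  ⟨by rw [← φ.map_source, ← φ.map_source, h.1], by rw [← φ.map_target, ← φ.map_target, h.2]⟩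

/-- The homomorphism of C*-algebras `A_{ee} → B_{φ(e) φ(e)}`. -/
noncomputable def endHom (k : Fin n) (e : {e : A.Cell // A.ops.IsIdent k e}) :
    A.EndAlg k e →⋆ₐ[ℂ] B.EndAlg k ⟨φ e.1, φ.map_isIdent e.2⟩ :=
  let f : A.EndAlg k e → B.EndAlg k ⟨φ e.1, φ.map_isIdent e.2⟩ := fun x =>
    ⟨φ x.1, by rw [← φ.map_source, x.2.1]; rfl, by rw [← φ.map_target, x.2.2]; rfl⟩
  have hs : ∀ (c : ℂ) x, f (c • x) = c • f x := fun c x => EndAlg.ext (by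
    rw [EndAlg.coe_smul]
    change φ _ = _
    rw [EndAlg.coe_smul, φ.map_scale])
  have h0 : f 0 = 0 := by simpa using hs 0 0
  have h1 : f 1 = 1 := rfl
  { toFun := f
    map_one' := h1
    map_mul' := fun x y => EndAlg.ext (φ.map_mul (EndAlg.composable x y))
    map_zero' := h0
    map_add' := fun x y => EndAlg.ext (by
      rw [EndAlg.coe_add]
      change φ _ = _
      rw [EndAlg.coe_add, φ.map_plus (EndAlg.sameBlock x y)])
    commutes' := fun c => by rw [Algebra.algebraMap_eq_smul_one, hs, h1,
      Algebra.algebraMap_eq_smul_one]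
    map_star' := fun x => EndAlg.ext (φ.map_star k x.1) }

/-- A homomorphism of C*-algebras is contractive. Applied to `x^* x` in the algebra at the
`(n-1)`-source of `x`, this gives the bound for `x` through the C*-identity. -/
theorem nrm_apply_le (x : A.Cell) : B.ops.nrm (φ x) ≤ A.ops.nrm x := by
  have hc := source_star_self ⊤ x
  let z : A.EndAlg ⊤ ⟨A.ops.source ⊤ x, isIdent_source ⊤ x⟩ :=
    ⟨A.mul ⊤ (A.ops.star ⊤ x) x, source_star_mul ⊤ x, target_star_mul ⊤ x⟩
  have h := NonUnitalStarAlgHom.norm_apply_le (φ.endHom ⊤ _) z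
  rw [EndAlg.norm_eq, EndAlg.norm_eq] at h
  change B.ops.nrm (φ (A.mul ⊤ (A.ops.star ⊤ x) x)) ≤ A.ops.nrm (A.mul ⊤ (A.ops.star ⊤ x) x) at h
  rw [φ.map_mul hc, φ.map_star, nrm_star_mul, nrm_star_mul] at h
  exact (sq_le_sq₀ (nrm_nonneg _) (nrm_nonneg _)).1 h

/-- Invertible `*`-functors are isometric. -/
theorem nrm_apply (x : A.Cell) : B.ops.nrm (φ x) = A.ops.nrm x :=
  (φ.nrm_apply_le x).antisymm (by simpa using φ.symm.nrm_apply_le (φ x))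

/-- The composite functor `ψ ∘ φ`. -/
def trans (φ : StarIso A B) (ψ : StarIso B C) : StarIso A C where
  toEquiv := φ.toEquiv.trans ψ.toEquiv
  isStarFunctor := {
    map_comp := fun q x y z h =>
      ψ.isStarFunctor.map_comp q _ _ _ (φ.isStarFunctor.map_comp q _ _ _ h)
    map_ident := fun q e h => ψ.map_isIdent (φ.map_isIdent h)
    map_star := fun q x => by
      change ψ (φ _) = C.ops.star q (ψ (φ _))
      rw [φ.map_star, ψ.map_star]
    map_plus := fun x y h => by
      change ψ (φ _) = C.ops.plus (ψ (φ _)) (ψ (φ _))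
      rw [φ.map_plus h, ψ.map_plus (φ.map_sameBlock h)]
    map_scale := fun c x => by
      change ψ (φ _) = C.ops.scale c (ψ (φ _))
      rw [φ.map_scale, ψ.map_scale] }
  isStarFunctor_symm := {
    map_comp := fun q x y z h => φ.symm.isStarFunctor.map_comp q _ _ _
      (ψ.symm.isStarFunctor.map_comp q _ _ _ h)
    map_ident := fun q e h => φ.symm.map_isIdent (ψ.symm.map_isIdent h)
    map_star := fun q x => by
      change φ.symm (ψ.symm _) = A.ops.star q (φ.symm (ψ.symm _))
      rw [ψ.symm.map_star, φ.symm.map_star]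
    map_plus := fun x y h => by
      change φ.symm (ψ.symm _) = A.ops.plus (φ.symm (ψ.symm _)) (φ.symm (ψ.symm _))
      rw [ψ.symm.map_plus h, φ.symm.map_plus (ψ.symm.map_sameBlock h)]
    map_scale := fun c x => by
      change φ.symm (ψ.symm _) = A.ops.scale c (φ.symm (ψ.symm _))
      rw [ψ.symm.map_scale, φ.symm.map_scale] }

@[simp] theorem trans_apply (φ : StarIso A B) (ψ : StarIso B C) (x : A.Cell) :
    φ.trans ψ x = ψ (φ x) := rfl

end StarIso

end SmallCStarCat

namespace SmallCStarCat

variable {n : ℕ} [NeZero n] {A B C : SmallCStarCat.{u} n} {p q k : Fin n}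

theorem pos_of_ne_zero (h : k ≠ 0) : 0 < k := Fin.pos_iff_ne_zero.2 h

/-! ### Intertwining at a pair of objects -/

/-- The intertwining condition for the values `u`, `v` at the objects `a`, `b`. -/
def IntertwinesAt (Φ Ψ : StarIso A B) (a b : A.Ob) (u v : B.Cell) : Prop :=
  ∀ x, A.ops.source 0 x = a.1 → A.ops.target 0 x = b.1 → B.mul 0 (Ψ x) u = B.mul 0 v (Φ x)

/-- The cell `u` runs from `Φ a` to `Ψ a`. -/
def Over (Φ Ψ : StarIso A B) (a : A.Ob) (u : B.Cell) : Prop :=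
  B.ops.source 0 u = Φ a.1 ∧ B.ops.target 0 u = Ψ a.1

variable {Φ Ψ Φ' : StarIso A B} {a b : A.Ob} {u v u' v' : B.Cell}

theorem Over.left_composable (h : Over Φ Ψ a u) {x : A.Cell} (hx : A.ops.source 0 x = a.1) :
    B.ops.source 0 (Ψ x) = B.ops.target 0 u := by rw [← Ψ.map_source, hx, h.2]

theorem Over.right_composable (h : Over Φ Ψ b v) {x : A.Cell} (hx : A.ops.target 0 x = b.1) :
    B.ops.source 0 v = B.ops.target 0 (Φ x) := by rw [← Φ.map_target, hx, h.1]

/-- Once the components have the right endpoints, both composites exist automatically and only an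
equation remains. -/
theorem intertwines_iff {Ξ : A.Ob → B.Cell} (h : ∀ a, Over Φ Ψ a (Ξ a)) :
    Intertwines Φ Ψ Ξ ↔ ∀ a b, IntertwinesAt Φ Ψ a b (Ξ a) (Ξ b) := by
  constructor
  · intro H a b x hs ht
    obtain ⟨z, hz, hz'⟩ := H x a b (isSource_iff.2 hs) (isTarget_iff.2 ht)
    rw [← (mem_comp_iff.1 hz).2, ← (mem_comp_iff.1 hz').2]
  · intro H x a b hs ht
    rw [isSource_iff] at hs
    rw [isTarget_iff] at ht
    refine ⟨_, mul_mem ((h a).left_composable hs), ?_⟩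
    rw [H a b x hs ht]
    exact mul_mem ((h b).right_composable ht)

theorem Over.mul_pos (hk : 0 < k) (h : Over Φ Ψ a u) (hc : B.ops.source k u = B.ops.target k u') :
    Over Φ Ψ a (B.mul k u u') :=
  ⟨by rw [source_mul_lt hk hc, h.1], by rw [target_mul_lt hk hc, h.2]⟩

theorem Over.mul_zero (h : Over Φ Ψ a u) (h' : Over Φ' Φ a u') : Over Φ' Ψ a (B.mul 0 u u') :=
  have hc : B.ops.source 0 u = B.ops.target 0 u' := h.1.trans h'.2.symm
  ⟨by rw [source_mul_self hc, h'.1], by rw [target_mul_self hc, h.2]⟩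

theorem Over.star_pos (hk : 0 < k) (h : Over Φ Ψ a u) : Over Φ Ψ a (B.ops.star k u) :=
  ⟨by rw [source_star_lt hk, h.1], by rw [target_star_lt hk, h.2]⟩

theorem Over.star_zero (h : Over Φ Ψ a u) : Over Ψ Φ a (B.ops.star 0 u) :=
  ⟨by rw [source_star_self, h.2], by rw [target_star_self, h.1]⟩

theorem Over.source_pos (hk : 0 < k) (h : Over Φ Ψ a u) : Over Φ Ψ a (B.ops.source k u) :=
  ⟨by rw [source_source_of_lt hk, h.1], by rw [target_source_of_lt hk, h.2]⟩

theorem Over.target_pos (hk : 0 < k) (h : Over Φ Ψ a u) : Over Φ Ψ a (B.ops.target k u) :=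
  ⟨by rw [source_target_of_lt hk, h.1], by rw [target_target_of_lt hk, h.2]⟩

/-- Exchange after writing `Ψ(x)` as `Ψ(x) ∘_k Ψ(s_k x)` and `Φ(x)` likewise. The second factor is
handled by naturality at `s_k x`, which has the same endpoints `a`, `b` as `x`. -/
theorem IntertwinesAt.mul_pos (hk : 0 < k) (hu : Over Φ Ψ a u) (hv : Over Φ Ψ b v)
    (hcu : B.ops.source k u = B.ops.target k u') (hcv : B.ops.source k v = B.ops.target k v')
    (h : IntertwinesAt Φ Ψ a b u v) (h' : IntertwinesAt Φ Ψ a b u' v') :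
    IntertwinesAt Φ Ψ a b (B.mul k u u') (B.mul k v v') := by
  intro x hs ht
  have hs' : A.ops.source 0 (A.ops.source k x) = a.1 := by rw [source_source_of_lt hk, hs]
  have ht' : A.ops.target 0 (A.ops.source k x) = b.1 := by rw [target_source_of_lt hk, ht]
  have e1 := exchange (x := Ψ x) (y := B.ops.source k (Ψ x)) hk (by simp) hcu
    (hu.left_composable hs)
  have e2 := exchange (w := Φ x) (z := B.ops.source k (Φ x)) hk hcv (by simp)
    (hv.right_composable ht)
  rw [mul_source] at e1 e2
  rw [e1, e2, h x hs ht, ← Ψ.map_source, ← Φ.map_source, h' _ hs' ht']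

theorem IntertwinesAt.mul_zero (hu : Over Φ Ψ a u) (hu' : Over Φ' Φ a u')
    (hv : Over Φ Ψ b v) (hv' : Over Φ' Φ b v')
    (h : IntertwinesAt Φ Ψ a b u v) (h' : IntertwinesAt Φ' Φ a b u' v') :
    IntertwinesAt Φ' Ψ a b (B.mul 0 u u') (B.mul 0 v v') := by
  intro x hs ht
  rw [← (mul_assoc (hu.left_composable hs) (hu.1.trans hu'.2.symm)).1, h x hs ht,
    (mul_assoc (hv.right_composable ht) (hu'.left_composable hs)).1, h' x hs ht,
    (mul_assoc (hv.1.trans hv'.2.symm) (hv'.right_composable ht)).1]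

/-- Adjoint of the hypothesis at `x^{*_k}`, which has the same endpoints as `x` because `k > 0`. -/
theorem IntertwinesAt.star_pos (hk : 0 < k) (hu : Over Φ Ψ a u) (hv : Over Φ Ψ b v)
    (h : IntertwinesAt Φ Ψ a b u v) :
    IntertwinesAt Φ Ψ a b (B.ops.star k u) (B.ops.star k v) := by
  intro x hs ht
  have hs' : A.ops.source 0 (A.ops.star k x) = a.1 := by rw [source_star_lt hk, hs]
  have ht' : A.ops.target 0 (A.ops.star k x) = b.1 := by rw [target_star_lt hk, ht]
  have e1 := star_mul_ne hk.ne (hu.left_composable hs')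
  rw [h _ hs' ht', star_mul_ne hk.ne (hv.right_composable ht'), ← Ψ.map_star, ← Φ.map_star,
    star_star] at e1
  exact e1.symm

/-- Adjoint of the hypothesis at `x^{*_0}`. This cell runs from `b` to `a`, whence the exchanged
objects in `h`. -/
theorem IntertwinesAt.star_zero (hu : Over Φ Ψ a u) (hv : Over Φ Ψ b v)
    (h : IntertwinesAt Φ Ψ b a v u) :
    IntertwinesAt Ψ Φ a b (B.ops.star 0 u) (B.ops.star 0 v) := by
  intro x hs ht
  have hs' : A.ops.source 0 (A.ops.star 0 x) = b.1 := by rw [source_star_self, ht]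
  have ht' : A.ops.target 0 (A.ops.star 0 x) = a.1 := by rw [target_star_self, hs]
  have e1 := star_mul_self (hv.left_composable hs')
  rw [h _ hs' ht', star_mul_self (hu.right_composable ht'), ← Ψ.map_star, ← Φ.map_star,
    star_star] at e1
  exact e1

theorem IntertwinesAt.plus (hu : Over Φ Ψ a u) (hv : Over Φ Ψ b v)
    (hbu : B.ops.SameBlock u u') (hbv : B.ops.SameBlock v v')
    (h : IntertwinesAt Φ Ψ a b u v) (h' : IntertwinesAt Φ Ψ a b u' v') :
    IntertwinesAt Φ Ψ a b (B.ops.plus u u') (B.ops.plus v v') := by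
  intro x hs ht
  rw [mul_plus hbu (hu.left_composable hs), plus_mul hbv (hv.right_composable ht), h x hs ht,
    h' x hs ht]

theorem IntertwinesAt.scale (c : ℂ) (hu : Over Φ Ψ a u) (hv : Over Φ Ψ b v)
    (h : IntertwinesAt Φ Ψ a b u v) :
    IntertwinesAt Φ Ψ a b (B.ops.scale c u) (B.ops.scale c v) := by
  intro x hs ht
  rw [mul_scale c (hu.left_composable hs), scale_mul c (hv.right_composable ht), h x hs ht]

theorem intertwinesAt_self (Φ : StarIso A B) (a b : A.Ob) :
    IntertwinesAt Φ Φ a b (Φ a.1) (Φ b.1) := by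
  intro x hs ht
  rw [← hs, ← ht, Φ.map_source, Φ.map_target, mul_source, target_mul]

/-! ### Continuity of the intertwining condition -/

/-- Composition with a fixed cell on the left, on a block. -/
noncomputable def mulLeft (q : Fin n) (x : B.Cell) (e : B.Pair)
    (h : ∀ y : e.Hom, B.ops.source q x = B.ops.target q y.1) :
    e.Hom →L[ℂ] (pair (B.mul q x (0 : e.Hom).1)).Hom :=
  have hb : ∀ y z : e.Hom, B.ops.SameBlock y.1 z.1 := fun y z =>
    ⟨y.2.1.trans z.2.1.symm, y.2.2.trans z.2.2.symm⟩
  -- All products lie in one block. The product with the zero of `e` serves to name it.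
  have hm : ∀ y : e.Hom, B.ops.SameBlock (B.mul q x y.1) (B.mul q x (0 : e.Hom).1) := fun y =>
    CellOps.SameBlock.mul ⟨rfl, rfl⟩ (hb y 0) (h y)
  LinearMap.mkContinuous
    { toFun := fun y => toHom _ (B.mul q x y.1) (hm y).1 (hm y).2
      map_add' := fun y z => Pair.Hom.ext (by
        have h1 := mul_plus (hb y z) (h y)
        rw [← Pair.coe_add] at h1
        exact h1.trans (Pair.coe_add (toHom _ _ _ _) (toHom _ _ _ _)).symm)
      map_smul' := fun c y => Pair.Hom.ext (by
        have h1 := mul_scale c (h y)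
        rw [← Pair.coe_smul] at h1
        exact h1.trans (Pair.coe_smul c (toHom _ _ _ _)).symm) }
    (B.ops.nrm x) fun y => by
      rw [Pair.norm_eq, Pair.norm_eq]; exact nrm_mul_le (h y)

/-- Composition with a fixed cell on the right, on a block. -/
noncomputable def mulRight (q : Fin n) (x : B.Cell) (e : B.Pair)
    (h : ∀ y : e.Hom, B.ops.source q y.1 = B.ops.target q x) :
    e.Hom →L[ℂ] (pair (B.mul q (0 : e.Hom).1 x)).Hom :=
  have hb : ∀ y z : e.Hom, B.ops.SameBlock y.1 z.1 := fun y z =>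
    ⟨y.2.1.trans z.2.1.symm, y.2.2.trans z.2.2.symm⟩
  have hm : ∀ y : e.Hom, B.ops.SameBlock (B.mul q y.1 x) (B.mul q (0 : e.Hom).1 x) := fun y =>
    CellOps.SameBlock.mul (hb y 0) ⟨rfl, rfl⟩ (h y)
  LinearMap.mkContinuous
    { toFun := fun y => toHom _ (B.mul q y.1 x) (hm y).1 (hm y).2
      map_add' := fun y z => Pair.Hom.ext (by
        have h1 := plus_mul (hb y z) (h y)
        rw [← Pair.coe_add] at h1
        exact h1.trans (Pair.coe_add (toHom _ _ _ _) (toHom _ _ _ _)).symm)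
      map_smul' := fun c y => Pair.Hom.ext (by
        have h1 := scale_mul c (h y)
        rw [← Pair.coe_smul] at h1
        exact h1.trans (Pair.coe_smul c (toHom _ _ _ _)).symm) }
    (B.ops.nrm x) fun y => by
      rw [Pair.norm_eq, Pair.norm_eq, mul_comm]; exact nrm_mul_le (h y)

/-- The two maps take values in blocks not known to be equal. A cell determines its block, so for
distinct blocks the set is empty; otherwise it is the equalizer of two continuous maps into a
Hausdorff space. -/
theorem isClosed_coe_eq {X : Type*} [TopologicalSpace X] {e f : B.Pair} {g : X → e.Hom}
    {h : X → f.Hom} (hg : Continuous g) (hh : Continuous h) :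
    IsClosed {t | (g t).1 = (h t).1} := by
  by_cases hef : e = f
  · subst hef
    have : {t | (g t).1 = (h t).1} = {t | g t = h t} := by
      ext t; exact ⟨fun H => Pair.Hom.ext H, fun H => congrArg Subtype.val H⟩
    rw [this]
    exact isClosed_eq hg hh
  · convert isClosed_empty
    ext t
    simp only [Set.mem_ofPred_eq, Set.mem_empty_iff_false, iff_false]
    intro H
    apply hef
    have h1 : e.src = f.src := by rw [← Pair.source_coe (g t), ← Pair.source_coe (h t), H]
    have h2 : e.tgt = f.tgt := by rw [← Pair.target_coe (g t), ← Pair.target_coe (h t), H]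
    cases e; cases f; cases h1; cases h2; rfl

theorem isClosed_intertwinesAt {e f : B.Pair} (he : ∀ y : e.Hom, Over Φ Ψ a y.1)
    (hf : ∀ y : f.Hom, Over Φ Ψ b y.1) :
    IsClosed {w : e.Hom × f.Hom | IntertwinesAt Φ Ψ a b w.1.1 w.2.1} := by
  simp only [IntertwinesAt, Set.ofPred_forall]
  refine isClosed_iInter fun x => isClosed_iInter fun hs => isClosed_iInter fun ht => ?_
  exact isClosed_coe_eq
    ((mulLeft 0 (Ψ x) e fun y => (he y).left_composable hs).continuous.comp continuous_fst)
    ((mulRight 0 (Φ x) f fun y => (hf y).right_composable ht).continuous.comp continuous_snd)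

/-! ### Square roots -/

/-- A closed subspace of a C*-algebra that contains `1` and is stable under products is stable under
the functional calculus of self-adjoint elements. -/
theorem exists_mem_map_eq_cfc {P R S : Type*} [CStarAlgebra P] [CStarAlgebra R] [CStarAlgebra S]
    {T : Set P} (hT : IsClosed T) (hone : 1 ∈ T) (hadd : ∀ x ∈ T, ∀ y ∈ T, x + y ∈ T)
    (hmul : ∀ x ∈ T, ∀ y ∈ T, x * y ∈ T) (hsmul : ∀ (c : ℂ), ∀ x ∈ T, c • x ∈ T) {w : P}
    (hw : IsSelfAdjoint w) (h : w ∈ T) (π₁ : P →⋆ₐ[ℂ] R) (π₂ : P →⋆ₐ[ℂ] S) {f : ℝ → ℝ}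
    (hf : Continuous f) : ∃ c ∈ T, π₁ c = cfc f (π₁ w) ∧ π₂ c = cfc f (π₂ w) := by
  let T' : Subalgebra ℝ P :=
    { carrier := T
      mul_mem' := fun hx hy => hmul _ hx _ hy
      add_mem' := fun hx hy => hadd _ hx _ hy
      algebraMap_mem' := fun r => by
        have h2 := hsmul (r : ℂ) 1 hone
        rwa [Complex.coe_smul, ← Algebra.algebraMap_eq_smul_one] at h2 }
  -- Since `w` is self-adjoint, the star algebra it generates is the plain algebra it generates, so
  -- `T` need not be stable under the involution.
  have h1 : Algebra.adjoin ℝ ({w} ∪ star {w}) ≤ T' := by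
    refine Algebra.adjoin_le ?_
    rw [Set.star_singleton, hw.star_eq, Set.union_self]
    exact Set.singleton_subset_iff.2 h
  have hc₁ : Continuous π₁ := AddMonoidHomClass.continuous_of_bound π₁ 1 fun x => by
    rw [one_mul]; exact NonUnitalStarAlgHom.norm_apply_le π₁ x
  have hc₂ : Continuous π₂ := AddMonoidHomClass.continuous_of_bound π₂ 1 fun x => by
    rw [one_mul]; exact NonUnitalStarAlgHom.norm_apply_le π₂ x
  exact ⟨cfc f w, closure_minimal (s := (Algebra.adjoin ℝ ({w} ∪ star {w}) : Set P)) h1 hT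
      (cfc_mem_elemental f w),
    StarAlgHomClass.map_cfc (π₁.restrictScalars ℝ) f w hf.continuousOn hc₁ hw (hw.map π₁),
    StarAlgHomClass.map_cfc (π₂.restrictScalars ℝ) f w hf.continuousOn hc₂ hw (hw.map π₂)⟩

namespace EndAlg

variable {e : {e : B.Cell // B.ops.IsIdent k e}} {ea eb : {e : B.Cell // B.ops.IsIdent k e}}

/-- The square root of a positive element. -/
noncomputable def root (z : B.EndAlg k e) : B.EndAlg k e := cfc Real.sqrt z

theorem star_root_mul_root {z : B.EndAlg k e} (hz : ∃ y, z = star y * y) :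
    star (root z) * root z = z := by
  have hsa : IsSelfAdjoint z := by obtain ⟨y, rfl⟩ := hz; exact IsSelfAdjoint.star_mul_self y
  have hpos : ∀ r ∈ spectrum ℝ z, 0 ≤ r := by
    obtain ⟨y, rfl⟩ := hz; exact fun r hr => spectrum_star_mul_self_nonneg r hr
  have h1 : star (root z) = root z := (cfc_predicate Real.sqrt z : IsSelfAdjoint _).star_eq
  rw [h1, root, ← cfc_mul Real.sqrt Real.sqrt z]
  conv_rhs => rw [← cfc_id ℝ z]
  exact cfc_congr fun r hr => Real.mul_self_sqrt (hpos r hr)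

/-- For `k > 0` the elements of the algebra inherit the endpoints of the identity `ea`. For `k = 0`
that identity is itself an object, equal to both `Φ a` and `Ψ a`, and the condition `Φ = Ψ` is what
the naturality of products requires. -/
theorem over_coe (he : Over Φ Ψ a ea.1) (w : B.EndAlg k ea) (hk : k = 0 → Φ = Ψ) :
    Over Φ Ψ a w.1 := by
  rcases eq_or_ne k 0 with rfl | hk'
  · exact ⟨by rw [source_coe, ← he.1, source_eq_of_isIdent ea.2],
      by rw [target_coe, ← he.2, target_eq_of_isIdent ea.2]⟩
  · have h0 : (0 : Fin n) < k := pos_of_ne_zero hk'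
    exact ⟨by rw [← source_source_of_lt h0, source_coe, he.1],
      by rw [← target_target_of_lt h0, target_coe, he.2]⟩

theorem intertwinesAt_mul (hk : k = 0 → Φ = Ψ) (hea : Over Φ Ψ a ea.1) (heb : Over Φ Ψ b eb.1)
    {u u' : B.EndAlg k ea} {v v' : B.EndAlg k eb} (h : IntertwinesAt Φ Ψ a b u.1 v.1)
    (h' : IntertwinesAt Φ Ψ a b u'.1 v'.1) :
    IntertwinesAt Φ Ψ a b (u * u').1 (v * v').1 := by
  rcases eq_or_ne k 0 with rfl | hk'
  · obtain rfl := hk rfl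
    exact IntertwinesAt.mul_zero (over_coe hea u hk) (over_coe hea u' hk) (over_coe heb v hk)
      (over_coe heb v' hk)
      h h'
  · exact IntertwinesAt.mul_pos (pos_of_ne_zero hk') (over_coe hea u hk) (over_coe heb v hk)
      (composable u u') (composable v v') h h'

/-- Intertwining pairs form a closed unital subalgebra of the product of the two C*-algebras, and
the functional calculus of `(u, v)` projects to that of `u` and of `v`. -/
theorem intertwinesAt_cfc (hk : k = 0 → Φ = Ψ) (hea : Over Φ Ψ a ea.1) (heb : Over Φ Ψ b eb.1)
    (hone : IntertwinesAt Φ Ψ a b ea.1 eb.1) {u : B.EndAlg k ea} {v : B.EndAlg k eb}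
    (hu : IsSelfAdjoint u) (hv : IsSelfAdjoint v) (h : IntertwinesAt Φ Ψ a b u.1 v.1)
    {f : ℝ → ℝ} (hf : Continuous f) :
    IntertwinesAt Φ Ψ a b (cfc f u).1 (cfc f v).1 := by
  have hw : IsSelfAdjoint (u, v) := Prod.ext hu hv
  obtain ⟨c, h3, e1, e2⟩ := exists_mem_map_eq_cfc (P := B.EndAlg k ea × B.EndAlg k eb)
    (T := {w | IntertwinesAt Φ Ψ a b w.1.1 w.2.1})
    (isClosed_intertwinesAt (e := B.endPair k ea) (f := B.endPair k eb)
      (fun y => over_coe hea y hk) (fun y => over_coe heb y hk))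
    hone
    (fun x hx y hy => by
      change IntertwinesAt Φ Ψ a b (x.1 + y.1).1 (x.2 + y.2).1
      rw [coe_add, coe_add]
      exact IntertwinesAt.plus (over_coe hea _ hk) (over_coe heb _ hk) (sameBlock _ _)
        (sameBlock _ _) hx hy)
    (fun x hx y hy => intertwinesAt_mul hk hea heb hx hy)
    (fun c w hw => by
      change IntertwinesAt Φ Ψ a b (c • w.1).1 (c • w.2).1
      rw [coe_smul, coe_smul]
      exact IntertwinesAt.scale c (over_coe hea _ hk) (over_coe heb _ hk) hw)
    hw h (StarAlgHom.fst ℂ _ _) (StarAlgHom.snd ℂ _ _) hf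
  change c.1 = cfc f u at e1
  change c.2 = cfc f v at e2
  rw [← e1, ← e2]
  exact h3

end EndAlg

/-! ### Transformations from an automorphism to the identity -/

section Automorphism

variable {θ : StarIso B B} {T : B.Ob → B.Cell}

/-- A natural cell from `θ` to the identity is preserved by `θ`, for cells of order less
than `n`. -/
theorem apply_comm_of_isIdent (hT : ∀ c, Over θ (StarIso.refl B) c (T c))
    (hnat : ∀ c d, IntertwinesAt θ (StarIso.refl B) c d (T c) (T d)) (h0 : (0 : Fin n) < ⊤)
    (hi : ∀ c, B.ops.IsIdent ⊤ (T c)) (c : B.Ob) : T (θ.ob c) = θ (T c) := by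
  have hs : B.ops.source 0 (T c) = (θ.ob c).1 := (hT c).1
  -- Naturality at the cell `T c : θ c → c` itself gives `T(c) ∘ T(θ c) = T(c) ∘ θ(T c)`. The factor
  -- `T(c)` can be removed because cells of lower order are unitary.
  have h1 := hnat (θ.ob c) c (T c) hs (hT c).2
  rw [StarIso.refl_apply] at h1
  have hss := source_star_self 0 (T c)
  have h2 : B.ops.source 0 (T c) = B.ops.target 0 (T (θ.ob c)) := hs.trans (hT (θ.ob c)).2.symm
  have h3 : B.ops.source 0 (T c) = B.ops.target 0 (θ (T c)) := by
    rw [← θ.map_target, (hT c).2]; exact (hT c).1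
  have h4 := congrArg (B.mul 0 (B.ops.star 0 (T c))) h1
  rw [← (mul_assoc hss h2).1, ← (mul_assoc hss h3).1, star_mul_of_isIdent (hi c) h0] at h4
  rw [h2, target_mul] at h4
  rwa [← h2, h3, target_mul] at h4

/-- A natural cell from `θ` to the identity is preserved by `θ`. -/
theorem apply_comm (hT : ∀ c, Over θ (StarIso.refl B) c (T c))
    (hnat : ∀ c d, IntertwinesAt θ (StarIso.refl B) c d (T c) (T d)) (c : B.Ob)
    (hb : B.ops.SameBlock (T (θ.ob c)) (θ (T c))) : T (θ.ob c) = θ (T c) := by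
  set w := θ (T c) with hw
  set u := T (θ.ob c) with hu
  set t := T c with ht
  have hts : B.ops.source 0 t = θ c.1 := (hT c).1
  have htt : B.ops.target 0 t = c.1 := (hT c).2
  have hut : B.ops.target 0 u = θ c.1 := (hT (θ.ob c)).2
  have hwt : B.ops.target 0 w = θ c.1 := by rw [hw, ← θ.map_target, htt]
  have hus : B.ops.source 0 u = θ (θ c.1) := (hT (θ.ob c)).1
  have hws : B.ops.source 0 w = θ (θ c.1) := by rw [hw, ← θ.map_source, hts]
  -- Naturality at `t`. Here `t` is an arbitrary `n`-cell and cannot be cancelled directly.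
  have h1 : B.mul 0 t u = B.mul 0 t w := hnat (θ.ob c) c t hts htt
  have h1' : B.mul 0 (B.ops.star 0 u) (B.ops.star 0 t) =
      B.mul 0 (B.ops.star 0 w) (B.ops.star 0 t) := by
    rw [← star_mul_self (hts.trans hut.symm), h1, star_mul_self (hts.trans hwt.symm)]
  -- products that factor through `t^*` on the left
  have key : ∀ r g, B.mul 0 g (B.ops.star 0 g) = B.mul 0 (B.ops.star 0 t) r →
      B.ops.target 0 r = c.1 → B.ops.target 0 g = θ c.1 →
      B.mul 0 (B.ops.star 0 u) g = B.mul 0 (B.ops.star 0 w) g := by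
    intro r g hr hrt hg
    have e1 : B.ops.source 0 (B.ops.star 0 u) = B.ops.target 0 (B.ops.star 0 t) := by
      rw [source_star_self, target_star_self, hut, hts]
    have e2 : B.ops.source 0 (B.ops.star 0 w) = B.ops.target 0 (B.ops.star 0 t) := by
      rw [source_star_self, target_star_self, hwt, hts]
    have e3 : B.ops.source 0 (B.ops.star 0 t) = B.ops.target 0 r := by
      rw [source_star_self, htt, hrt]
    refine cancel_star (hb.star 0) (by rw [source_star_self, hut, hg]) ?_
    rw [hr, ← (mul_assoc e1 e3).1, h1', (mul_assoc e2 e3).1]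
  have hu2 : B.mul 0 (B.ops.star 0 u) u = B.mul 0 (B.ops.star 0 w) u := by
    have hvs : B.ops.source 0 (θ.symm (B.ops.star 0 u)) = c.1 := by
      rw [← StarIso.map_source, source_star_self, hut]; simp
    have hvt : B.ops.target 0 (θ.symm (B.ops.star 0 u)) = (θ.ob c).1 := by
      rw [← StarIso.map_target, target_star_self, hus]; simp
    -- At the cell `θ⁻¹(u^*)`, naturality reads `θ⁻¹(u^*) ∘ t = u ∘ u^*`. Its adjoint writes `u ∘
    -- u^*` as `t^* ∘ r`.
    have e := hnat c (θ.ob c) _ hvs hvt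
    rw [StarIso.refl_apply, StarIso.apply_symm_apply] at e
    have e' := congrArg (B.ops.star 0) e
    rw [star_mul_self (hvs.trans htt.symm), star_mul_self (target_star_self 0 u).symm, star_star]
      at e'
    refine key _ u e'.symm ?_ hut
    rw [target_star_self, hvs]
  have hw2 : B.mul 0 (B.ops.star 0 u) w = B.mul 0 (B.ops.star 0 w) w := by
    have hvs : B.ops.source 0 (θ.symm (B.ops.star 0 t)) = (θ.symm.ob c).1 := by
      rw [← StarIso.map_source, source_star_self, htt]; simp
    have hvt : B.ops.target 0 (θ.symm (B.ops.star 0 t)) = c.1 := by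
      rw [← StarIso.map_target, target_star_self, hts]; simp
    -- At the cell `θ⁻¹(t^*)`, naturality reads `θ⁻¹(t^*) ∘ T(θ⁻¹ c) = t ∘ t^*`. Its image under `θ`
    -- writes `w ∘ w^*` as `t^* ∘ r`.
    have e := hnat (θ.symm.ob c) c _ hvs hvt
    rw [StarIso.refl_apply, StarIso.apply_symm_apply] at e
    have hrt : B.ops.target 0 (T (θ.symm.ob c)) = (θ.symm.ob c).1 := (hT _).2
    have e' := congrArg θ e
    rw [θ.map_mul (hvs.trans hrt.symm), θ.map_mul (target_star_self 0 t).symm, θ.map_star,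
      StarIso.apply_symm_apply] at e'
    refine key _ w e'.symm ?_ hwt
    rw [← θ.map_target, hrt]; simp
  exact eq_of_gram hb hu2 hw2

end Automorphism

end SmallCStarCat

namespace SmallCStarCat

variable {n : ℕ} [NeZero n] {A B C : SmallCStarCat.{u} n} {j k : Fin n}

theorem index_ne_zero_of_lt (h : j < k) : k ≠ 0 := ((Fin.zero_le j).trans_lt h).ne'

theorem source_source_top (q : Fin n) (x : B.Cell) :
    B.ops.source q (B.ops.source ⊤ x) = B.ops.source q x := by
  rcases (le_top : q ≤ ⊤).eq_or_lt with rfl | hlt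
  · exact source_source _ x
  · exact source_source_of_lt hlt x

theorem target_target_top (q : Fin n) (x : B.Cell) :
    B.ops.target q (B.ops.target ⊤ x) = B.ops.target q x := by
  rcases (le_top : q ≤ ⊤).eq_or_lt with rfl | hlt
  · exact target_target _ x
  · exact target_target_of_lt hlt x

theorem ob_eq_self (a : A.Ob) (k : Fin n) : A.ops.source k a.1 = a.1 ∧ A.ops.target k a.1 = a.1 :=
  have h := isIdent_of_le (Fin.zero_le k) a.2
  ⟨source_eq_of_isIdent h, target_eq_of_isIdent h⟩

/-! ### Intertwining for composites -/

section

variable {Φ Ψ Φ' Ψ' : StarIso A B} {a b : A.Ob} {u v u' v' : B.Cell}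

theorem Over.mul (h₀ : k = 0 → Φ = Ψ') (h₁ : k ≠ 0 → Φ = Φ' ∧ Ψ = Ψ') (h : Over Φ Ψ a u)
    (h' : Over Φ' Ψ' a u') (hc : B.ops.source k u = B.ops.target k u') :
    Over Φ' Ψ a (B.mul k u u') := by
  rcases eq_or_ne k 0 with rfl | hk
  · obtain rfl := h₀ rfl
    exact h.mul_zero h'
  · obtain ⟨rfl, rfl⟩ := h₁ hk
    exact h.mul_pos (pos_of_ne_zero hk) hc

theorem IntertwinesAt.mul (h₀ : k = 0 → Φ = Ψ') (h₁ : k ≠ 0 → Φ = Φ' ∧ Ψ = Ψ')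
    (hu : Over Φ Ψ a u) (hu' : Over Φ' Ψ' a u') (hv : Over Φ Ψ b v) (hv' : Over Φ' Ψ' b v')
    (hcu : B.ops.source k u = B.ops.target k u') (hcv : B.ops.source k v = B.ops.target k v')
    (h : IntertwinesAt Φ Ψ a b u v) (h' : IntertwinesAt Φ' Ψ' a b u' v') :
    IntertwinesAt Φ' Ψ a b (B.mul k u u') (B.mul k v v') := by
  rcases eq_or_ne k 0 with rfl | hk
  · obtain rfl := h₀ rfl
    exact h.mul_zero hu hu' hv hv' h'
  · obtain ⟨rfl, rfl⟩ := h₁ hk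
    exact h.mul_pos (pos_of_ne_zero hk) hu hv hcu hcv h'

theorem Over.precomp {Φ Ψ : StarIso B C} {a : A.Ob} {u : C.Cell} (χ : StarIso A B)
    (h : Over Φ Ψ (χ.ob a) u) : Over (χ.trans Φ) (χ.trans Ψ) a u := h

theorem IntertwinesAt.precomp {Φ Ψ : StarIso B C} {u v : C.Cell} (χ : StarIso A B)
    (h : IntertwinesAt Φ Ψ (χ.ob a) (χ.ob b) u v) :
    IntertwinesAt (χ.trans Φ) (χ.trans Ψ) a b u v := fun x hs ht =>
  h (χ x) (by rw [← χ.map_source, hs]; rfl) (by rw [← χ.map_target, ht]; rfl)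

theorem Over.postcomp (χ : StarIso B C) (h : Over Φ Ψ a u) :
    Over (Φ.trans χ) (Ψ.trans χ) a (χ u) :=
  ⟨by rw [← χ.map_source, h.1]; rfl, by rw [← χ.map_target, h.2]; rfl⟩

theorem IntertwinesAt.postcomp (χ : StarIso B C) (hu : Over Φ Ψ a u) (hv : Over Φ Ψ b v)
    (h : IntertwinesAt Φ Ψ a b u v) :
    IntertwinesAt (Φ.trans χ) (Ψ.trans χ) a b (χ u) (χ v) := fun x hs ht => by
  rw [StarIso.trans_apply, StarIso.trans_apply, ← χ.map_mul (hu.left_composable hs),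
    ← χ.map_mul (hv.right_composable ht), h x hs ht]

theorem Over.comp {Φ₂ Ψ₂ : StarIso B C} {w : C.Cell} (h : Over Φ₂ Ψ₂ (Ψ.ob a) w)
    (h' : Over Φ Ψ a u) : Over (Φ.trans Φ₂) (Ψ.trans Ψ₂) a (C.mul 0 w (Φ₂ u)) :=
  (h.precomp Ψ).mul_zero (h'.postcomp Φ₂)

theorem Over.composable {Φ₂ Ψ₂ : StarIso B C} {w : C.Cell} (h : Over Φ₂ Ψ₂ (Ψ.ob a) w)
    (h' : Over Φ Ψ a u) : C.ops.source 0 w = C.ops.target 0 (Φ₂ u) := by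
  rw [h.1, ← Φ₂.map_target, h'.2]; rfl

theorem IntertwinesAt.comp {Φ₂ Ψ₂ : StarIso B C} {w z : C.Cell} (hw : Over Φ₂ Ψ₂ (Ψ.ob a) w)
    (hz : Over Φ₂ Ψ₂ (Ψ.ob b) z) (hu : Over Φ Ψ a u) (hv : Over Φ Ψ b v)
    (h : IntertwinesAt Φ₂ Ψ₂ (Ψ.ob a) (Ψ.ob b) w z) (h' : IntertwinesAt Φ Ψ a b u v) :
    IntertwinesAt (Φ.trans Φ₂) (Ψ.trans Ψ₂) a b (C.mul 0 w (Φ₂ u)) (C.mul 0 z (Φ₂ v)) :=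
  (h.precomp Ψ).mul_zero (hw.precomp Ψ) (hu.postcomp Φ₂) (hz.precomp Ψ) (hv.postcomp Φ₂)
    (h'.postcomp Φ₂ hu hv)

theorem Over.adjoint {b : B.Ob} (h : Over Φ Ψ (Ψ.symm.ob b) u) :
    Over Φ.symm Ψ.symm b (Φ.symm (B.ops.star 0 u)) := by
  constructor
  · rw [← StarIso.map_source, source_star_self, h.2]; simp
  · rw [← StarIso.map_target, target_star_self, h.1]; simp

/-- Adjoints give a condition between `Ψ` and `Φ`. Following with `Φ⁻¹` and restricting along `Ψ⁻¹`
turns these two functors into `Φ⁻¹` and `Ψ⁻¹`. -/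
theorem IntertwinesAt.adjoint {b b' : B.Ob} (hu : Over Φ Ψ (Ψ.symm.ob b) u)
    (hv : Over Φ Ψ (Ψ.symm.ob b') v) (h : IntertwinesAt Φ Ψ (Ψ.symm.ob b') (Ψ.symm.ob b) v u) :
    IntertwinesAt Φ.symm Ψ.symm b b' (Φ.symm (B.ops.star 0 u)) (Φ.symm (B.ops.star 0 v)) := by
  have h1 := ((h.star_zero hu hv).postcomp Φ.symm hu.star_zero hv.star_zero).precomp Ψ.symm
  have e1 : Ψ.symm.trans (Ψ.trans Φ.symm) = Φ.symm := StarIso.ext fun x => by simp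
  have e2 : Ψ.symm.trans (Φ.trans Φ.symm) = Ψ.symm := StarIso.ext fun x => by simp
  rwa [e1, e2] at h1

end

/-! ### Constructions of transfors: sources, targets, composites, adjoints -/

namespace Transfor

variable (X Y : Transfor A B) {a b : A.Ob}

theorem over_coe (a : A.Ob) : Over X.Φ X.Ψ a (X.Ξ a) :=
  ⟨isSource_iff.1 (X.source_zero a), isTarget_iff.1 (X.target_zero a)⟩

theorem intertwinesAt (a b : A.Ob) : IntertwinesAt X.Φ X.Ψ a b (X.Ξ a) (X.Ξ b) :=
  (intertwines_iff X.over_coe).1 X.intertwines a b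

theorem intertwinesAt_source (hk : k ≠ 0) (a b : A.Ob) :
    IntertwinesAt X.Φ X.Ψ a b (B.ops.source k (X.Ξ a)) (B.ops.source k (X.Ξ b)) :=
  (intertwines_iff fun a => (X.over_coe a).source_pos (pos_of_ne_zero hk)).1
    (X.intertwines_source k (pos_of_ne_zero hk)) a b

theorem intertwinesAt_target (hk : k ≠ 0) (a b : A.Ob) :
    IntertwinesAt X.Φ X.Ψ a b (B.ops.target k (X.Ξ a)) (B.ops.target k (X.Ξ b)) :=
  (intertwines_iff fun a => (X.over_coe a).target_pos (pos_of_ne_zero hk)).1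
    (X.intertwines_target k (pos_of_ne_zero hk)) a b

/-- Construction of a transfor from equations between cells. -/
def ofIntertwinesAt (Φ Ψ : StarIso A B) (Ξ : A.Ob → B.Cell) (hover : ∀ a, Over Φ Ψ a (Ξ a))
    (h : ∀ a b, IntertwinesAt Φ Ψ a b (Ξ a) (Ξ b))
    (hs : ∀ k : Fin n, k ≠ 0 → ∀ a b,
      IntertwinesAt Φ Ψ a b (B.ops.source k (Ξ a)) (B.ops.source k (Ξ b)))
    (ht : ∀ k : Fin n, k ≠ 0 → ∀ a b,
      IntertwinesAt Φ Ψ a b (B.ops.target k (Ξ a)) (B.ops.target k (Ξ b)))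
    (hb : ∃ M : ℝ, ∀ a, B.ops.nrm (Ξ a) ≤ M) : Transfor A B where
  Φ := Φ
  Ψ := Ψ
  Ξ := Ξ
  source_zero a := isSource_iff.2 (hover a).1
  target_zero a := isTarget_iff.2 (hover a).2
  intertwines := (intertwines_iff hover).2 h
  intertwines_source k hk := (intertwines_iff fun a => (hover a).source_pos hk).2 (hs k hk.ne')
  intertwines_target k hk := (intertwines_iff fun a => (hover a).target_pos hk).2 (ht k hk.ne')
  bounded := hb

/-- The identity transfor of the identity functor. -/
def idZero (A : SmallCStarCat.{u} n) : Transfor A A :=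
  have hi := fun a b => intertwinesAt_self (StarIso.refl A) a b
  ofIntertwinesAt (StarIso.refl A) (StarIso.refl A) (fun a => a.1)
    (fun a => ob_eq_self a 0) hi
    (fun k _ a b => by rw [(ob_eq_self a k).1, (ob_eq_self b k).1]; exact hi a b)
    (fun k _ a b => by rw [(ob_eq_self a k).2, (ob_eq_self b k).2]; exact hi a b)
    ⟨1, fun a => nrm_le_one_of_isIdent a.2⟩

/-- The transfor of the `k`-sources of the components. -/
noncomputable def src (k : Fin n) : Transfor A B :=
  -- The `0`-source of a component at `a` is `Φ(a)`, so for `k = 0` the result is the identity of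
  -- `Φ`. For `k > 0` both functors are kept.
  have hi : ∀ a b, IntertwinesAt X.Φ (if k = 0 then X.Φ else X.Ψ) a b
      (B.ops.source k (X.Ξ a)) (B.ops.source k (X.Ξ b)) := fun a b => by
    split_ifs with hk
    · subst hk
      rw [(X.over_coe a).1, (X.over_coe b).1]
      exact intertwinesAt_self _ a b
    · exact X.intertwinesAt_source hk a b
  ofIntertwinesAt X.Φ (if k = 0 then X.Φ else X.Ψ) (fun a => B.ops.source k (X.Ξ a))
    (fun a => by
      split_ifs with hk
      · subst hk
        exact ⟨by rw [source_source, (X.over_coe a).1], by rw [target_source, (X.over_coe a).1]⟩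
      · exact (X.over_coe a).source_pos (pos_of_ne_zero hk))
    hi
    (fun j hj a b => by
      -- Below `k` the `j`-source of a `k`-source is that of the component; from `k` on, a
      -- `k`-source is its own `j`-source.
      rcases lt_or_ge j k with hjk | hjk
      · rw [source_source_of_lt hjk, source_source_of_lt hjk, if_neg (index_ne_zero_of_lt hjk)]
        exact X.intertwinesAt_source hj a b
      · rw [source_source_of_le hjk, source_source_of_le hjk]
        exact hi a b)
    (fun j hj a b => by
      rcases lt_or_ge j k with hjk | hjk
      · rw [target_source_of_lt hjk, target_source_of_lt hjk, if_neg (index_ne_zero_of_lt hjk)]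
        exact X.intertwinesAt_target hj a b
      · rw [target_source_of_le hjk, target_source_of_le hjk]
        exact hi a b)
    ⟨1, fun a => nrm_le_one_of_isIdent (isIdent_source k _)⟩

/-- The transfor of the `k`-targets of the components. -/
noncomputable def tgt (k : Fin n) : Transfor A B :=
  have hi : ∀ a b, IntertwinesAt (if k = 0 then X.Ψ else X.Φ) X.Ψ a b
      (B.ops.target k (X.Ξ a)) (B.ops.target k (X.Ξ b)) := fun a b => by
    split_ifs with hk
    · subst hk
      rw [(X.over_coe a).2, (X.over_coe b).2]
      exact intertwinesAt_self _ a b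
    · exact X.intertwinesAt_target hk a b
  ofIntertwinesAt (if k = 0 then X.Ψ else X.Φ) X.Ψ (fun a => B.ops.target k (X.Ξ a))
    (fun a => by
      split_ifs with hk
      · subst hk
        exact ⟨by rw [source_target, (X.over_coe a).2], by rw [target_target, (X.over_coe a).2]⟩
      · exact (X.over_coe a).target_pos (pos_of_ne_zero hk))
    hi
    (fun j hj a b => by
      rcases lt_or_ge j k with hjk | hjk
      · rw [source_target_of_lt hjk, source_target_of_lt hjk, if_neg (index_ne_zero_of_lt hjk)]
        exact X.intertwinesAt_source hj a b
      · rw [source_target_of_le hjk, source_target_of_le hjk]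
        exact hi a b)
    (fun j hj a b => by
      rcases lt_or_ge j k with hjk | hjk
      · rw [target_target_of_lt hjk, target_target_of_lt hjk, if_neg (index_ne_zero_of_lt hjk)]
        exact X.intertwinesAt_target hj a b
      · rw [target_target_of_le hjk, target_target_of_le hjk]
        exact hi a b)
    ⟨1, fun a => nrm_le_one_of_isIdent (isIdent_target k _)⟩

theorem nrm_mul_bounded {D : SmallCStarCat.{u} n} {ι : Type*} {f g : ι → D.Cell} {q : Fin n}
    (hc : ∀ i, D.ops.source q (f i) = D.ops.target q (g i)) (hf : ∃ M : ℝ, ∀ i, D.ops.nrm (f i) ≤ M)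
    (hg : ∃ M : ℝ, ∀ i, D.ops.nrm (g i) ≤ M) :
    ∃ M : ℝ, ∀ i, D.ops.nrm (D.mul q (f i) (g i)) ≤ M := by
  obtain ⟨M, hM⟩ := hf
  obtain ⟨N, hN⟩ := hg
  exact ⟨M * N, fun i => (nrm_mul_le (hc i)).trans
    (mul_le_mul (hM i) (hN i) (nrm_nonneg _) ((nrm_nonneg _).trans (hM i)))⟩

/-- The composite over objects. -/
noncomputable def compZero (X : Transfor B C) (Y : Transfor A B) : Transfor A C :=
  have hc := fun a => (X.over_coe (Y.Ψ.ob a)).composable (Y.over_coe a)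
  ofIntertwinesAt (Y.Φ.trans X.Φ) (Y.Ψ.trans X.Ψ)
    (fun a => C.mul 0 (X.Ξ (Y.Ψ.ob a)) (X.Φ (Y.Ξ a)))
    (fun a => (X.over_coe _).comp (Y.over_coe a))
    (fun a b => (X.intertwinesAt _ _).comp (X.over_coe _) (X.over_coe _) (Y.over_coe a)
      (Y.over_coe b) (Y.intertwinesAt a b))
    (fun j hj a b => by
      have hj' := pos_of_ne_zero hj
      rw [source_mul_gt hj' (hc a), source_mul_gt hj' (hc b), ← X.Φ.map_source, ← X.Φ.map_source]
      exact (X.intertwinesAt_source hj _ _).comp ((X.over_coe _).source_pos hj')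
        ((X.over_coe _).source_pos hj') ((Y.over_coe a).source_pos hj')
        ((Y.over_coe b).source_pos hj') (Y.intertwinesAt_source hj a b))
    (fun j hj a b => by
      have hj' := pos_of_ne_zero hj
      rw [target_mul_gt hj' (hc a), target_mul_gt hj' (hc b), ← X.Φ.map_target, ← X.Φ.map_target]
      exact (X.intertwinesAt_target hj _ _).comp ((X.over_coe _).target_pos hj')
        ((X.over_coe _).target_pos hj') ((Y.over_coe a).target_pos hj')
        ((Y.over_coe b).target_pos hj') (Y.intertwinesAt_target hj a b))
    (nrm_mul_bounded hc (X.bounded.imp fun _ h a => h _)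
      (by simpa only [StarIso.nrm_apply] using Y.bounded))

/-- The adjoint over objects. -/
noncomputable def starZero : Transfor B A :=
  ofIntertwinesAt X.Φ.symm X.Ψ.symm (fun b => X.Φ.symm (B.ops.star 0 (X.Ξ (X.Ψ.symm.ob b))))
    (fun b => (X.over_coe _).adjoint)
    (fun a b => IntertwinesAt.adjoint (X.over_coe _) (X.over_coe _) (X.intertwinesAt _ _))
    (fun j hj a b => by
      have hj' := pos_of_ne_zero hj
      rw [← X.Φ.symm.map_source, ← X.Φ.symm.map_source, source_star_ne hj, source_star_ne hj]
      exact IntertwinesAt.adjoint ((X.over_coe _).source_pos hj') ((X.over_coe _).source_pos hj')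
        (X.intertwinesAt_source hj _ _))
    (fun j hj a b => by
      have hj' := pos_of_ne_zero hj
      rw [← X.Φ.symm.map_target, ← X.Φ.symm.map_target, target_star_ne hj, target_star_ne hj]
      exact IntertwinesAt.adjoint ((X.over_coe _).target_pos hj') ((X.over_coe _).target_pos hj')
        (X.intertwinesAt_target hj _ _))
    (X.bounded.imp fun M h b => by rw [StarIso.nrm_apply, nrm_star]; exact h _)

/-- The adjoint over `k`-cells. -/
noncomputable def starSucc (k : Fin n) : Transfor A B :=
  have hst : ∀ {Φ Ψ : StarIso A B} {a : A.Ob} {u : B.Cell}, Over Φ Ψ a u →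
      Over (if k = 0 then Ψ else Φ) (if k = 0 then Φ else Ψ) a (B.ops.star k u) := by
    intro Φ Ψ a u h
    split_ifs with hk
    · subst hk; exact h.star_zero
    · exact h.star_pos (pos_of_ne_zero hk)
  have hin : ∀ {Φ Ψ : StarIso A B} {Ξ : A.Ob → B.Cell}, (∀ a, Over Φ Ψ a (Ξ a)) →
      (∀ a b, IntertwinesAt Φ Ψ a b (Ξ a) (Ξ b)) → ∀ a b,
      IntertwinesAt (if k = 0 then Ψ else Φ) (if k = 0 then Φ else Ψ) a b (B.ops.star k (Ξ a))
        (B.ops.star k (Ξ b)) := by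
    intro Φ Ψ Ξ h hi a b
    split_ifs with hk
    · subst hk; exact (hi b a).star_zero (h a) (h b)
    · exact (hi a b).star_pos (pos_of_ne_zero hk) (h a) (h b)
  ofIntertwinesAt (if k = 0 then X.Ψ else X.Φ) (if k = 0 then X.Φ else X.Ψ)
    (fun a => B.ops.star k (X.Ξ a))
    (fun a => hst (X.over_coe a))
    (hin X.over_coe X.intertwinesAt)
    (fun j hj a b => by
      rcases lt_trichotomy j k with hjk | rfl | hjk
      · rw [source_star_lt hjk, source_star_lt hjk, if_neg (index_ne_zero_of_lt hjk),
          if_neg (index_ne_zero_of_lt hjk)]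
        exact X.intertwinesAt_source hj a b
      · rw [source_star_self, source_star_self, if_neg hj, if_neg hj]
        exact X.intertwinesAt_target hj a b
      · rw [source_star_ne hjk.ne', source_star_ne hjk.ne']
        exact hin (fun a => (X.over_coe a).source_pos (pos_of_ne_zero hj))
          (X.intertwinesAt_source hj) a b)
    (fun j hj a b => by
      rcases lt_trichotomy j k with hjk | rfl | hjk
      · rw [target_star_lt hjk, target_star_lt hjk, if_neg (index_ne_zero_of_lt hjk),
          if_neg (index_ne_zero_of_lt hjk)]
        exact X.intertwinesAt_target hj a b
      · rw [target_star_self, target_star_self, if_neg hj, if_neg hj]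
        exact X.intertwinesAt_source hj a b
      · rw [target_star_ne hjk.ne', target_star_ne hjk.ne']
        exact hin (fun a => (X.over_coe a).target_pos (pos_of_ne_zero hj))
          (X.intertwinesAt_target hj) a b)
    (X.bounded.imp fun M h b => by rw [nrm_star]; exact h _)

/-! ### Composition over cells -/

section simps

@[simp] theorem src_Φ (k : Fin n) : (X.src k).Φ = X.Φ := rfl
theorem src_Ψ (k : Fin n) : (X.src k).Ψ = if k = 0 then X.Φ else X.Ψ := rfl
theorem tgt_Φ (k : Fin n) : (X.tgt k).Φ = if k = 0 then X.Ψ else X.Φ := rfl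
@[simp] theorem tgt_Ψ (k : Fin n) : (X.tgt k).Ψ = X.Ψ := rfl
@[simp] theorem compZero_Φ (X : Transfor B C) (Y : Transfor A B) :
    (X.compZero Y).Φ = Y.Φ.trans X.Φ := rfl
@[simp] theorem compZero_Ψ (X : Transfor B C) (Y : Transfor A B) :
    (X.compZero Y).Ψ = Y.Ψ.trans X.Ψ := rfl
@[simp] theorem compZero_Ξ (X : Transfor B C) (Y : Transfor A B) (a : A.Ob) :
    (X.compZero Y).Ξ a = C.mul 0 (X.Ξ (Y.Ψ.ob a)) (X.Φ (Y.Ξ a)) := rfl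
@[simp] theorem starZero_Φ : X.starZero.Φ = X.Φ.symm := rfl
@[simp] theorem starZero_Ψ : X.starZero.Ψ = X.Ψ.symm := rfl
@[simp] theorem starZero_Ξ (b : B.Ob) :
    X.starZero.Ξ b = X.Φ.symm (B.ops.star 0 (X.Ξ (X.Ψ.symm.ob b))) := rfl
theorem starSucc_Φ (k : Fin n) : (X.starSucc k).Φ = if k = 0 then X.Ψ else X.Φ := rfl
theorem starSucc_Ψ (k : Fin n) : (X.starSucc k).Ψ = if k = 0 then X.Φ else X.Ψ := rfl
@[simp] theorem starSucc_Ξ (k : Fin n) (a : A.Ob) :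
    (X.starSucc k).Ξ a = B.ops.star k (X.Ξ a) := rfl

end simps

variable {X Y}

/-- A single equation of transfors carries the whole composability condition for `∘_{k+1}`,
including the matching of functors that differs between `k = 0` and `k > 0`. -/
theorem src_eq_tgt_iff : X.src k = Y.tgt k ↔ (k = 0 → X.Φ = Y.Ψ) ∧
    (k ≠ 0 → X.Φ = Y.Φ ∧ X.Ψ = Y.Ψ) ∧ ∀ a, B.ops.source k (X.Ξ a) = B.ops.target k (Y.Ξ a) := by
  constructor
  · intro h
    have h1 := congrArg Transfor.Φ h
    have h2 := congrArg Transfor.Ψ h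
    rw [src_Φ, tgt_Φ] at h1
    rw [src_Ψ, tgt_Ψ] at h2
    refine ⟨fun hk => by rwa [if_pos hk] at h1, fun hk => ?_, fun a => congrFun
      (congrArg Transfor.Ξ h) a⟩
    rw [if_neg hk] at h1 h2
    exact ⟨h1, h2⟩
  · rintro ⟨h0, h1, h2⟩
    refine Transfor.ext ?_ ?_ (funext h2)
    · rw [src_Φ, tgt_Φ]; split_ifs with hk; exacts [h0 hk, (h1 hk).1]
    · rw [src_Ψ, tgt_Ψ]; split_ifs with hk; exacts [h0 hk, (h1 hk).2]

variable (X Y)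

/-- The composite over `k`-cells. -/
noncomputable def compSucc (k : Fin n) (h : X.src k = Y.tgt k) : Transfor A B :=
  have h' := src_eq_tgt_iff.1 h
  -- A nonzero `j ≤ k` excludes `k = 0`, so the functors of the two factors coincide.
  have hΨ : ∀ {j}, j ≤ k → j ≠ 0 → X.Φ = Y.Φ ∧ X.Ψ = Y.Ψ := fun hjk hj => h'.2.1 fun hk => hj
    (le_antisymm (hk ▸ hjk) (Fin.zero_le _))
  ofIntertwinesAt Y.Φ X.Ψ (fun a => B.mul k (X.Ξ a) (Y.Ξ a))
    (fun a => Over.mul h'.1 h'.2.1 (X.over_coe a) (Y.over_coe a) (h'.2.2 a))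
    (fun a b => IntertwinesAt.mul h'.1 h'.2.1 (X.over_coe a) (Y.over_coe a) (X.over_coe b)
      (Y.over_coe b) (h'.2.2 a) (h'.2.2 b) (X.intertwinesAt a b) (Y.intertwinesAt a b))
    (fun j hj a b => by
      rcases lt_trichotomy j k with hjk | rfl | hjk
      · rw [source_mul_lt hjk (h'.2.2 a), source_mul_lt hjk (h'.2.2 b), ← (hΨ hjk.le hj).1]
        exact X.intertwinesAt_source hj a b
      · rw [source_mul_self (h'.2.2 a), source_mul_self (h'.2.2 b), (hΨ le_rfl hj).2]
        exact Y.intertwinesAt_source hj a b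
      · have hj' := pos_of_ne_zero hj
        rw [source_mul_gt hjk (h'.2.2 a), source_mul_gt hjk (h'.2.2 b)]
        have hc : ∀ a, B.ops.source k (B.ops.source j (X.Ξ a)) =
            B.ops.target k (B.ops.source j (Y.Ξ a)) := fun a => by
          rw [source_source_of_lt hjk, target_source_of_lt hjk, h'.2.2 a]
        exact IntertwinesAt.mul h'.1 h'.2.1 ((X.over_coe a).source_pos hj')
          ((Y.over_coe a).source_pos hj') ((X.over_coe b).source_pos hj')
          ((Y.over_coe b).source_pos hj') (hc a) (hc b) (X.intertwinesAt_source hj a b)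
          (Y.intertwinesAt_source hj a b))
    (fun j hj a b => by
      rcases lt_trichotomy j k with hjk | rfl | hjk
      · rw [target_mul_lt hjk (h'.2.2 a), target_mul_lt hjk (h'.2.2 b), ← (hΨ hjk.le hj).1]
        exact X.intertwinesAt_target hj a b
      · rw [target_mul_self (h'.2.2 a), target_mul_self (h'.2.2 b), ← (hΨ le_rfl hj).1]
        exact X.intertwinesAt_target hj a b
      · have hj' := pos_of_ne_zero hj
        rw [target_mul_gt hjk (h'.2.2 a), target_mul_gt hjk (h'.2.2 b)]
        have hc : ∀ a, B.ops.source k (B.ops.target j (X.Ξ a)) =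
            B.ops.target k (B.ops.target j (Y.Ξ a)) := fun a => by
          rw [source_target_of_lt hjk, target_target_of_lt hjk, h'.2.2 a]
        exact IntertwinesAt.mul h'.1 h'.2.1 ((X.over_coe a).target_pos hj')
          ((Y.over_coe a).target_pos hj') ((X.over_coe b).target_pos hj')
          ((Y.over_coe b).target_pos hj') (hc a) (hc b) (X.intertwinesAt_target hj a b)
          (Y.intertwinesAt_target hj a b))
    (nrm_mul_bounded h'.2.2 X.bounded Y.bounded)

@[simp] theorem compSucc_Φ (h : X.src k = Y.tgt k) : (X.compSucc Y k h).Φ = Y.Φ := rfl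
@[simp] theorem compSucc_Ψ (h : X.src k = Y.tgt k) : (X.compSucc Y k h).Ψ = X.Ψ := rfl
@[simp] theorem compSucc_Ξ (h : X.src k = Y.tgt k) (a : A.Ob) :
    (X.compSucc Y k h).Ξ a = B.mul k (X.Ξ a) (Y.Ξ a) := rfl

/-- A bounded intertwining family of cells in the blocks given by two transfors. -/
def ofBlock (S T : Transfor A B) (hF : (⊤ : Fin n) ≠ 0 → S.Φ = T.Φ ∧ S.Ψ = T.Ψ)
    (Ξ : A.Ob → B.Cell) (hs : ∀ a, B.ops.source ⊤ (Ξ a) = S.Ξ a)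
    (ht : ∀ a, B.ops.target ⊤ (Ξ a) = T.Ξ a)
    (hi : ∀ a b, IntertwinesAt S.Φ T.Ψ a b (Ξ a) (Ξ b)) (hb : ∃ M : ℝ, ∀ a, B.ops.nrm (Ξ a) ≤ M) :
    Transfor A B :=
  have htop : ∀ {j : Fin n}, j ≠ 0 → (⊤ : Fin n) ≠ 0 := fun {j} hj h =>
    hj (le_antisymm (h ▸ le_top) (Fin.zero_le j))
  ofIntertwinesAt S.Φ T.Ψ Ξ
    (fun a => ⟨by rw [← source_source_top, hs, (S.over_coe a).1],
      by rw [← target_target_top, ht, (T.over_coe a).2]⟩)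
    hi
    -- Every lower source factors through the `(n-1)`-source, whose naturality belongs to `S`;
    -- targets factor through `T` in the same way.
    (fun j hj a b => by
      rw [← source_source_top j (Ξ a), ← source_source_top j (Ξ b), hs, hs, ← (hF (htop hj)).2]
      exact S.intertwinesAt_source hj a b)
    (fun j hj a b => by
      rw [← target_target_top j (Ξ a), ← target_target_top j (Ξ b), ht, ht, (hF (htop hj)).1]
      exact T.intertwinesAt_target hj a b)
    hb

theorem src_tgt_top_functors (X : Transfor A B) (h : (⊤ : Fin n) ≠ 0) :
    (X.src ⊤).Φ = (X.tgt ⊤).Φ ∧ (X.src ⊤).Ψ = (X.tgt ⊤).Ψ := by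
  rw [src_Φ, tgt_Φ, src_Ψ, tgt_Ψ, if_neg h, if_neg h]; exact ⟨rfl, rfl⟩

/-- A bounded intertwining family of cells in the blocks of the components of a transfor. -/
noncomputable def ofSameBlock (X : Transfor A B) (Ξ : A.Ob → B.Cell)
    (h : ∀ a, B.ops.SameBlock (Ξ a) (X.Ξ a))
    (hi : ∀ a b, IntertwinesAt X.Φ X.Ψ a b (Ξ a) (Ξ b)) (hb : ∃ M : ℝ, ∀ a, B.ops.nrm (Ξ a) ≤ M) :
    Transfor A B :=
  ofBlock (X.src ⊤) (X.tgt ⊤) X.src_tgt_top_functors Ξ (fun a => (h a).1) (fun a => (h a).2) hi hb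

end Transfor

end SmallCStarCat

namespace SmallCStarCat

variable {n : ℕ} [NeZero n] {A B C D : SmallCStarCat.{u} n} {j k : Fin n}

namespace Transfor

variable (X Y : Transfor A B)

/-! ### Sources, targets and identities -/

/-- With identities as components, naturality at a cell `x` reads `Ψ(x) = Φ(x)`. This covers all
cells, as every cell has a source and a target object. -/
theorem functors_eq_of_isIdent {X : Transfor A B} (h : ∀ a, B.ops.IsIdent 0 (X.Ξ a)) :
    X.Φ = X.Ψ := by
  have h1 : ∀ a, X.Ξ a = X.Φ a.1 := fun a => by
    rw [← (X.over_coe a).1, source_eq_of_isIdent (h a)]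
  have h2 : ∀ a, X.Ξ a = X.Ψ a.1 := fun a => by
    rw [← (X.over_coe a).2, target_eq_of_isIdent (h a)]
  have h3 : ∀ (x : A.Cell) (a b : A.Ob), A.ops.source 0 x = a.1 → A.ops.target 0 x = b.1 →
      X.Φ x = X.Ψ x := fun x a b hs ht => by
    have h4 := X.intertwinesAt a b x hs ht
    rw [h2, h1, ← hs, ← ht, X.Ψ.map_source, X.Φ.map_target, mul_source, target_mul] at h4
    exact h4.symm
  exact StarIso.ext fun x => h3 x ⟨_, isIdent_source 0 x⟩ ⟨_, isIdent_target 0 x⟩ rfl rfl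

theorem src_eq_self_iff : X.src k = X ↔ ∀ a, B.ops.IsIdent k (X.Ξ a) := by
  constructor
  · intro h a
    rw [← h]; exact isIdent_source k _
  · intro h
    refine Transfor.ext rfl ?_ (funext fun a => source_eq_of_isIdent (h a))
    rw [src_Ψ]
    split_ifs with hk
    · subst hk; exact functors_eq_of_isIdent h
    · rfl

theorem tgt_eq_self_iff : X.tgt k = X ↔ ∀ a, B.ops.IsIdent k (X.Ξ a) := by
  constructor
  · intro h a
    rw [← h]; exact isIdent_target k _
  · intro h
    refine Transfor.ext ?_ rfl (funext fun a => target_eq_of_isIdent (h a))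
    rw [tgt_Φ]
    split_ifs with hk
    · subst hk; exact (functors_eq_of_isIdent h).symm
    · rfl

@[simp] theorem src_src (k : Fin n) : (X.src k).src k = X.src k :=
  (src_eq_self_iff _).2 fun _ => isIdent_source k _
@[simp] theorem tgt_src (k : Fin n) : (X.src k).tgt k = X.src k :=
  (tgt_eq_self_iff _).2 fun _ => isIdent_source k _
@[simp] theorem src_tgt (k : Fin n) : (X.tgt k).src k = X.tgt k :=
  (src_eq_self_iff _).2 fun _ => isIdent_target k _

theorem compSucc_src (k : Fin n) : X.compSucc (X.src k) k (X.tgt_src k).symm = X :=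
  Transfor.ext rfl rfl (funext fun _ => mul_source k _)

theorem tgt_compSucc (k : Fin n) : (X.tgt k).compSucc X k (X.src_tgt k) = X :=
  Transfor.ext rfl rfl (funext fun _ => target_mul k _)

variable {X Y}

theorem source_eq_target (h : X.src k = Y.tgt k) (a : A.Ob) :
    B.ops.source k (X.Ξ a) = B.ops.target k (Y.Ξ a) := (src_eq_tgt_iff.1 h).2.2 a

theorem src_compSucc (h : X.src k = Y.tgt k) : (X.compSucc Y k h).src k = Y.src k := by
  have h' := src_eq_tgt_iff.1 h
  refine Transfor.ext rfl ?_ (funext fun a => source_mul_self (h'.2.2 a))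
  rw [src_Ψ, src_Ψ]
  split_ifs with hk
  · rfl
  · exact (h'.2.1 hk).2

theorem tgt_compSucc_self (h : X.src k = Y.tgt k) : (X.compSucc Y k h).tgt k = X.tgt k := by
  have h' := src_eq_tgt_iff.1 h
  refine Transfor.ext ?_ rfl (funext fun a => target_mul_self (h'.2.2 a))
  rw [tgt_Φ, tgt_Φ]
  split_ifs with hk
  · rfl
  · exact (h'.2.1 hk).1.symm

theorem compSucc_assoc {Z : Transfor A B} (h : X.src k = Y.tgt k) (h' : Y.src k = Z.tgt k) :
    (X.compSucc Y k h).compSucc Z k ((src_compSucc h).trans h') =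
      X.compSucc (Y.compSucc Z k h') k (h.trans (tgt_compSucc_self h').symm) :=
  Transfor.ext rfl rfl (funext fun a =>
    (mul_assoc (source_eq_target h a) (source_eq_target h' a)).1)

/-! ### Composition over objects -/

theorem composable (X : Transfor B C) (Y : Transfor A B) (a : A.Ob) :
    C.ops.source 0 (X.Ξ (Y.Ψ.ob a)) = C.ops.target 0 (X.Φ (Y.Ξ a)) :=
  (X.over_coe _).composable (Y.over_coe a)

theorem compZero_assoc (X : Transfor C D) (Y : Transfor B C) (Z : Transfor A B) :
    (X.compZero Y).compZero Z = X.compZero (Y.compZero Z) := by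
  refine Transfor.ext rfl rfl (funext fun a => ?_)
  have h1 := composable Y Z a
  have h2 : D.ops.source 0 (X.Φ (Y.Ξ (Z.Ψ.ob a))) = D.ops.target 0 (X.Φ (Y.Φ (Z.Ξ a))) := by
    rw [← X.Φ.map_source, h1, X.Φ.map_target]
  have h3 := (mul_assoc (composable X Y (Z.Ψ.ob a)) h2).1
  simp only [compZero_Ξ, compZero_Φ, compZero_Ψ, StarIso.trans_apply]
  rw [X.Φ.map_mul h1]
  exact h3

theorem compZero_idZero (X : Transfor A B) : X.compZero (idZero A) = X := by
  refine Transfor.ext rfl rfl (funext fun a => ?_)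
  change B.mul 0 (X.Ξ a) (X.Φ a.1) = X.Ξ a
  rw [← (X.over_coe a).1, mul_source]

theorem idZero_compZero (X : Transfor A B) : (idZero B).compZero X = X := by
  refine Transfor.ext rfl rfl (funext fun a => ?_)
  change B.mul 0 (X.Ψ a.1) (X.Ξ a) = X.Ξ a
  rw [← (X.over_coe a).2, target_mul]

theorem compZero_src_eq_tgt {X Y : Transfor B C} {W Z : Transfor A B} (h : X.src k = Y.tgt k)
    (h' : W.src k = Z.tgt k) : (X.compZero W).src k = (Y.compZero Z).tgt k := by
  obtain ⟨h0, h1, h2⟩ := src_eq_tgt_iff.1 h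
  obtain ⟨h0', h1', h2'⟩ := src_eq_tgt_iff.1 h'
  refine src_eq_tgt_iff.2 ⟨fun hk => ?_, fun hk => ?_, fun a => ?_⟩
  · rw [compZero_Φ, compZero_Ψ, h0 hk, h0' hk]
  · rw [compZero_Φ, compZero_Ψ, compZero_Φ, compZero_Ψ, (h1 hk).1, (h1 hk).2, (h1' hk).1,
      (h1' hk).2]; exact ⟨rfl, rfl⟩
  · rcases eq_or_ne k 0 with rfl | hk
    · rw [((X.compZero W).over_coe a).1, ((Y.compZero Z).over_coe a).2, compZero_Φ, compZero_Ψ,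
        h0 rfl, h0' rfl]
    · have hk' := pos_of_ne_zero hk
      rw [compZero_Ξ, compZero_Ξ, source_mul_gt hk' (composable X W a),
        target_mul_gt hk' (composable Y Z a), h2, ← X.Φ.map_source, h2', X.Φ.map_target,
        (h1 hk).1, (h1' hk).2]

/-- For `k > 0` this is exchange in `C`. For `k = 0` both sides are fourfold `∘_0`-composites that
differ in the middle, and naturality of `Y` at the cell `W(a)` interchanges the two inner factors.
-/
theorem exchange_zero {X Y : Transfor B C} {W Z : Transfor A B} (h : X.src k = Y.tgt k)
    (h' : W.src k = Z.tgt k) : (X.compSucc Y k h).compZero (W.compSucc Z k h') =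
      (X.compZero W).compSucc (Y.compZero Z) k (compZero_src_eq_tgt h h') := by
  obtain ⟨h0, h1, h2⟩ := src_eq_tgt_iff.1 h
  obtain ⟨h0', h1', h2'⟩ := src_eq_tgt_iff.1 h'
  refine Transfor.ext rfl rfl (funext fun a => ?_)
  change C.mul 0 (C.mul k (X.Ξ (W.Ψ.ob a)) (Y.Ξ (W.Ψ.ob a))) (Y.Φ (B.mul k (W.Ξ a) (Z.Ξ a))) =
    C.mul k (C.mul 0 (X.Ξ (W.Ψ.ob a)) (X.Φ (W.Ξ a))) (C.mul 0 (Y.Ξ (Z.Ψ.ob a)) (Y.Φ (Z.Ξ a)))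
  have hYW := composable Y W a
  have hXW := composable X W a
  have hYZ := composable Y Z a
  rw [Y.Φ.map_mul (h2' a)]
  have hWZ : C.ops.source k (Y.Φ (W.Ξ a)) = C.ops.target k (Y.Φ (Z.Ξ a)) := by
    rw [← Y.Φ.map_source, h2' a, Y.Φ.map_target]
  rcases eq_or_ne k 0 with rfl | hk
  · have e1 := Y.intertwinesAt (Z.Ψ.ob a) (W.Ψ.ob a) (W.Ξ a)
      (by rw [(W.over_coe a).1, h0' rfl]; rfl) (W.over_coe a).2
    have hWY : C.ops.source 0 (Y.Ψ (W.Ξ a)) = C.ops.target 0 (Y.Ξ (Z.Ψ.ob a)) := by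
      rw [← Y.Ψ.map_source, (Y.over_coe _).2, h2' a, (Z.over_coe a).2]; rfl
    rw [h0 rfl] at hXW ⊢
    have hc1 : C.ops.source 0 (Y.Ξ (W.Ψ.ob a)) =
        C.ops.target 0 (C.mul 0 (Y.Φ (W.Ξ a)) (Y.Φ (Z.Ξ a))) := by
      rw [target_mul_self hWZ, hYW]
    have hc2 : C.ops.source 0 (Y.Ψ (W.Ξ a)) =
        C.ops.target 0 (C.mul 0 (Y.Ξ (Z.Ψ.ob a)) (Y.Φ (Z.Ξ a))) := by
      rw [target_mul_self hYZ, hWY]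
    rw [(mul_assoc (h2 _) hc1).1, (mul_assoc hXW hc2).1, ← (mul_assoc hYW hWZ).1, ← e1,
      (mul_assoc hWY hYZ).1]
  · rw [(h1 hk).1] at hXW ⊢
    rw [exchange (pos_of_ne_zero hk) (h2 _) hWZ hXW, (h1' hk).2]

/-- The exchange axiom also asserts that the inner composites exist. For `j < k`, the `j`-source and
`j`-target of a `∘_k`-composite are those of either factor. -/
theorem exchange_succ_aux {X Y W Z : Transfor A B} (hjk : j < k) (h₁ : X.src k = Y.tgt k)
    (h₂ : W.src k = Z.tgt k) (h₃ : (X.compSucc Y k h₁).src j = (W.compSucc Z k h₂).tgt j) :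
    X.src j = W.tgt j ∧ Y.src j = Z.tgt j := by
  have hk := index_ne_zero_of_lt hjk
  obtain ⟨-, h1, h2⟩ := src_eq_tgt_iff.1 h₁
  obtain ⟨-, h1', h2'⟩ := src_eq_tgt_iff.1 h₂
  obtain ⟨g0, g1, g2⟩ := src_eq_tgt_iff.1 h₃
  simp only [compSucc_Φ, compSucc_Ψ, compSucc_Ξ] at g0 g1 g2
  refine ⟨src_eq_tgt_iff.2 ⟨fun hj => ?_, fun hj => ?_, fun a => ?_⟩,
    src_eq_tgt_iff.2 ⟨fun hj => ?_, fun hj => ?_, fun a => ?_⟩⟩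
  · rw [(h1 hk).1, g0 hj]
  · rw [(h1 hk).1, (g1 hj).1, (g1 hj).2, (h1' hk).1]; exact ⟨rfl, rfl⟩
  · rw [← source_mul_lt hjk (h2 a), g2, target_mul_lt hjk (h2' a)]
  · rw [g0 hj, (h1' hk).2]
  · rw [(g1 hj).1, ← (h1 hk).2, (g1 hj).2, (h1' hk).2]; exact ⟨rfl, rfl⟩
  · rw [← source_mul_lt' hjk (h2 a), g2, target_mul_lt' hjk (h2' a)]

theorem exchange_succ {X Y W Z : Transfor A B} (hjk : j < k) (h₁ : X.src k = Y.tgt k)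
    (h₂ : W.src k = Z.tgt k) (h₃ : (X.compSucc Y k h₁).src j = (W.compSucc Z k h₂).tgt j)
    (h₄ : X.src j = W.tgt j) (h₅ : Y.src j = Z.tgt j) :
    ∃ h₆, (X.compSucc Y k h₁).compSucc (W.compSucc Z k h₂) j h₃ =
      (X.compSucc W j h₄).compSucc (Y.compSucc Z j h₅) k h₆ := by
  have hk := index_ne_zero_of_lt hjk
  obtain ⟨-, h1, h2⟩ := src_eq_tgt_iff.1 h₁
  obtain ⟨-, h1', h2'⟩ := src_eq_tgt_iff.1 h₂
  obtain ⟨-, -, g2⟩ := src_eq_tgt_iff.1 h₄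
  obtain ⟨-, -, g2'⟩ := src_eq_tgt_iff.1 h₅
  refine ⟨src_eq_tgt_iff.2 ⟨fun hk' => absurd hk' hk, fun _ => ⟨(h1' hk).1, (h1 hk).2⟩,
    fun a => ?_⟩, Transfor.ext rfl rfl (funext fun a => exchange hjk (h2 a) (h2' a) (g2 a))⟩
  rw [compSucc_Ξ, compSucc_Ξ, source_mul_gt hjk (g2 a), target_mul_gt hjk (g2' a), h2, h2']

/-! ### Adjoints -/

@[simp] theorem starZero_starZero (X : Transfor A B) : X.starZero.starZero = X := by
  refine Transfor.ext rfl rfl (funext fun a => ?_)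
  change X.Φ (A.ops.star 0 (X.Φ.symm (B.ops.star 0 (X.Ξ (X.Ψ.symm.ob (X.Ψ.ob a)))))) = X.Ξ a
  rw [X.Φ.map_star, StarIso.apply_symm_apply, star_star, StarIso.symm_ob_ob]

@[simp] theorem starSucc_starSucc (k : Fin n) (X : Transfor A B) :
    (X.starSucc k).starSucc k = X := by
  refine Transfor.ext ?_ ?_ (funext fun a => star_star k _) <;>
    simp only [starSucc_Φ, starSucc_Ψ] <;> split_ifs <;> rfl

theorem starSucc_comm (j k : Fin n) (X : Transfor A B) :
    (X.starSucc j).starSucc k = (X.starSucc k).starSucc j := by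
  refine Transfor.ext ?_ ?_ (funext fun a => star_comm k j _) <;>
    simp only [starSucc_Φ, starSucc_Ψ] <;> split_ifs <;> rfl

/-- The two ways to transport the components of a transfor back along its functors agree. -/
theorem symm_apply_eq (X : Transfor A B) (b : B.Ob) :
    X.Φ.symm (X.Ξ (X.Ψ.symm.ob b)) = X.Ψ.symm (X.Ξ (X.Φ.symm.ob b)) := by
  set θ : StarIso B B := X.Ψ.symm.trans X.Φ with hθ
  have hrefl : X.Ψ.symm.trans X.Ψ = StarIso.refl B := StarIso.ext fun x => by simp
  have hover : ∀ {Ξ : A.Ob → B.Cell}, (∀ a, Over X.Φ X.Ψ a (Ξ a)) → ∀ c,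
      Over θ (StarIso.refl B) c (Ξ (X.Ψ.symm.ob c)) := fun h c =>
    hrefl ▸ (h (X.Ψ.symm.ob c)).precomp X.Ψ.symm
  have hint : ∀ {Ξ : A.Ob → B.Cell}, (∀ a b, IntertwinesAt X.Φ X.Ψ a b (Ξ a) (Ξ b)) → ∀ c d,
      IntertwinesAt θ (StarIso.refl B) c d (Ξ (X.Ψ.symm.ob c)) (Ξ (X.Ψ.symm.ob d)) :=
    fun h c d => hrefl ▸ (h (X.Ψ.symm.ob c) (X.Ψ.symm.ob d)).precomp X.Ψ.symm
  -- Chosen so that `θ(c) = b` and `Ψ⁻¹ c = Φ⁻¹ b`.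
  set c : B.Ob := X.Ψ.ob (X.Φ.symm.ob b) with hc
  have hθc : X.Ψ.symm.ob (θ.ob c) = X.Ψ.symm.ob b := Subtype.ext (by simp [θ, c])
  have hψc : X.Ψ.symm.ob c = X.Φ.symm.ob b := by simp [c]
  -- For `n = 1` a block is fixed by its endpoints. For `n > 1` the `(n-1)`-sources and targets are
  -- natural families of lower-order cells, for which the unitary argument applies.
  have hb : B.ops.SameBlock (X.Ξ (X.Ψ.symm.ob (θ.ob c))) (θ (X.Ξ (X.Ψ.symm.ob c))) := by
    rcases eq_or_ne (⊤ : Fin n) 0 with h0 | h0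
    · have h1 := hover X.over_coe c
      have h2 := hover X.over_coe (θ.ob c)
      constructor
      · rw [← θ.map_source, h0, h1.1, h2.1]; rfl
      · rw [← θ.map_target, h0, h1.2, h2.2]; rfl
    · have h0' := pos_of_ne_zero h0
      constructor
      · rw [← θ.map_source]
        exact apply_comm_of_isIdent (T := fun c => B.ops.source ⊤ (X.Ξ (X.Ψ.symm.ob c)))
          (hover fun a => (X.over_coe a).source_pos h0') (hint (X.intertwinesAt_source h0)) h0'
          (fun _ => isIdent_source _ _) c
      · rw [← θ.map_target]
        exact apply_comm_of_isIdent (T := fun c => B.ops.target ⊤ (X.Ξ (X.Ψ.symm.ob c)))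
          (hover fun a => (X.over_coe a).target_pos h0') (hint (X.intertwinesAt_target h0)) h0'
          (fun _ => isIdent_target _ _) c
  have key := apply_comm (T := fun c => X.Ξ (X.Ψ.symm.ob c)) (hover X.over_coe)
    (hint X.intertwinesAt) c hb
  simp only [hθc, hψc] at key
  rw [key, hθ, StarIso.trans_apply, StarIso.symm_apply_apply]

/-- For `k = 0` the two stars cancel in each component, and the sides differ only in the functor
used for transport, which is the content of `symm_apply_eq`. -/
theorem starZero_starSucc (k : Fin n) (X : Transfor A B) :
    X.starZero.starSucc k = (X.starSucc k).starZero := by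
  rcases eq_or_ne k 0 with rfl | hk
  · refine Transfor.ext ?_ ?_ (funext fun b => ?_)
    · simp [starSucc_Φ]
    · simp [starSucc_Ψ]
    · change A.ops.star 0 (X.Φ.symm (B.ops.star 0 (X.Ξ (X.Ψ.symm.ob b)))) =
        (X.starSucc 0).Φ.symm (B.ops.star 0 (B.ops.star 0 (X.Ξ ((X.starSucc 0).Ψ.symm.ob b))))
      rw [starSucc_Φ, starSucc_Ψ, if_pos rfl, if_pos rfl, star_star, ← StarIso.map_star, star_star,
        symm_apply_eq]
  · refine Transfor.ext ?_ ?_ (funext fun b => ?_)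
    · simp [starSucc_Φ, hk]
    · simp [starSucc_Ψ, hk]
    · change A.ops.star k (X.Φ.symm (B.ops.star 0 (X.Ξ (X.Ψ.symm.ob b)))) =
        (X.starSucc k).Φ.symm (B.ops.star 0 (B.ops.star k (X.Ξ ((X.starSucc k).Ψ.symm.ob b))))
      rw [starSucc_Φ, starSucc_Ψ, if_neg hk, if_neg hk, ← StarIso.map_star, star_comm]

theorem starZero_compZero (X : Transfor B C) (Y : Transfor A B) :
    (X.compZero Y).starZero = Y.starZero.compZero X.starZero := by
  refine Transfor.ext rfl rfl (funext fun c => ?_)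
  have h := composable X Y (Y.Ψ.symm.ob (X.Ψ.symm.ob c))
  have h1 : (X.compZero Y).Ψ.symm.ob c = Y.Ψ.symm.ob (X.Ψ.symm.ob c) := rfl
  have h2 : Y.Ψ.ob (Y.Ψ.symm.ob (X.Ψ.symm.ob c)) = X.Ψ.symm.ob c := by simp
  change Y.Φ.symm (X.Φ.symm (C.ops.star 0 (C.mul 0 (X.Ξ (Y.Ψ.ob ((X.compZero Y).Ψ.symm.ob c)))
    (X.Φ (Y.Ξ ((X.compZero Y).Ψ.symm.ob c)))))) = A.mul 0
      (Y.Φ.symm (B.ops.star 0 (Y.Ξ (Y.Ψ.symm.ob (X.Ψ.symm.ob c)))))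
      (Y.Φ.symm (X.Φ.symm (C.ops.star 0 (X.Ξ (X.Ψ.symm.ob c)))))
  rw [h1, star_mul_self h]
  rw [h2] at h ⊢
  rw [← X.Φ.map_star] at *
  have h3 : C.ops.source 0 (X.Φ (B.ops.star 0 (Y.Ξ (Y.Ψ.symm.ob (X.Ψ.symm.ob c))))) =
      C.ops.target 0 (C.ops.star 0 (X.Ξ (X.Ψ.symm.ob c))) := by
    rw [X.Φ.map_star, source_star_self, target_star_self, h]
  have h4 := congrArg X.Φ.symm h3
  rw [StarIso.map_source, StarIso.map_target, StarIso.symm_apply_apply] at h4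
  rw [X.Φ.symm.map_mul h3, StarIso.symm_apply_apply, Y.Φ.symm.map_mul h4]

/-- For `k = 0` the adjoint reverses the factors of `X(Ψ a) ∘ Φ(Y a)`. Naturality of `X` at `Y(a)`
supplies the other form of the composite, whose adjoint has the factors in the required order. -/
theorem starSucc_compZero (k : Fin n) (X : Transfor B C) (Y : Transfor A B) :
    (X.compZero Y).starSucc k = (X.starSucc k).compZero (Y.starSucc k) := by
  rcases eq_or_ne k 0 with rfl | hk
  · refine Transfor.ext (by simp [starSucc_Φ]) (by simp [starSucc_Ψ]) (funext fun a => ?_)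
    rw [starSucc_Ξ, compZero_Ξ, compZero_Ξ, starSucc_Ξ, starSucc_Ξ, starSucc_Φ, starSucc_Ψ,
      if_pos rfl, if_pos rfl]
    have h1 := X.intertwinesAt (Y.Φ.ob a) (Y.Ψ.ob a) (Y.Ξ a) (Y.over_coe a).1 (Y.over_coe a).2
    have h2 : C.ops.source 0 (X.Ψ (Y.Ξ a)) = C.ops.target 0 (X.Ξ (Y.Φ.ob a)) :=
      (X.over_coe _).left_composable (Y.over_coe a).1
    rw [← h1, star_mul_self h2, X.Ψ.map_star]
  · refine Transfor.ext (by simp [starSucc_Φ, hk]) (by simp [starSucc_Ψ, hk]) (funext fun a => ?_)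
    rw [starSucc_Ξ, compZero_Ξ, compZero_Ξ, starSucc_Ξ, starSucc_Ξ, starSucc_Φ, starSucc_Ψ,
      if_neg hk, if_neg hk, star_mul_ne hk.symm (composable X Y a), X.Φ.map_star]

theorem starZero_src_eq_tgt {X Y : Transfor A B} (h : X.src k = Y.tgt k) :
    X.starZero.src k = Y.starZero.tgt k := by
  obtain ⟨h0, h1, h2⟩ := src_eq_tgt_iff.1 h
  refine src_eq_tgt_iff.2 ⟨fun hk => ?_, fun hk => ?_, fun b => ?_⟩
  · rw [starZero_Φ, starZero_Ψ, h0 hk]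
  · rw [starZero_Φ, starZero_Ψ, starZero_Φ, starZero_Ψ, (h1 hk).1, (h1 hk).2]; exact ⟨rfl, rfl⟩
  · rcases eq_or_ne k 0 with rfl | hk
    · rw [(X.starZero.over_coe b).1, (Y.starZero.over_coe b).2, starZero_Φ, starZero_Ψ, h0 rfl]
    · rw [starZero_Ξ, starZero_Ξ, ← StarIso.map_source, ← StarIso.map_target, source_star_ne hk,
        target_star_ne hk, h2, (h1 hk).1, (h1 hk).2]

/-- For `k = 0` the reversed factors are put back in order by naturality of `Y^{*_0}` at the adjoint
of a component of `X`. -/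
theorem starZero_compSucc {X Y : Transfor A B} (h : X.src k = Y.tgt k) :
    (X.compSucc Y k h).starZero = X.starZero.compSucc Y.starZero k (starZero_src_eq_tgt h) := by
  obtain ⟨h0, h1, h2⟩ := src_eq_tgt_iff.1 h
  refine Transfor.ext rfl rfl (funext fun b => ?_)
  change Y.Φ.symm (B.ops.star 0 (B.mul k (X.Ξ (X.Ψ.symm.ob b)) (Y.Ξ (X.Ψ.symm.ob b)))) =
    A.mul k (X.Φ.symm (B.ops.star 0 (X.Ξ (X.Ψ.symm.ob b)))) (Y.starZero.Ξ b)
  rcases eq_or_ne k 0 with rfl | hk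
  · have hYX : B.ops.source 0 (B.ops.star 0 (Y.Ξ (X.Ψ.symm.ob b))) =
        B.ops.target 0 (B.ops.star 0 (X.Ξ (X.Ψ.symm.ob b))) := by
      rw [source_star_self, target_star_self, h2]
    have hs : B.ops.source 0 (B.ops.star 0 (X.Ξ (X.Ψ.symm.ob b))) = b.1 := by
      rw [source_star_self, (X.over_coe _).2]; simp
    have ht : B.ops.target 0 (B.ops.star 0 (X.Ξ (X.Ψ.symm.ob b))) =
        (Y.Ψ.ob (X.Ψ.symm.ob b)).1 := by
      rw [target_star_self, h2, (Y.over_coe _).2]; rfl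
    have e := Y.starZero.intertwinesAt b (Y.Ψ.ob (X.Ψ.symm.ob b)) _ hs ht
    rw [star_mul_self (h2 _), Y.Φ.symm.map_mul hYX, h0 rfl]
    rw [starZero_Φ, starZero_Ψ] at e
    rw [e, starZero_Ξ, StarIso.symm_ob_ob]
  · rw [star_mul_ne hk (h2 _), Y.Φ.symm.map_mul, (h1 hk).1, starZero_Ξ, (h1 hk).2]
    rw [source_star_ne hk, target_star_ne hk, h2]

theorem starSucc_compSucc_self {X Y : Transfor A B} (h : X.src k = Y.tgt k) :
    ∃ h', (X.compSucc Y k h).starSucc k = (Y.starSucc k).compSucc (X.starSucc k) k h' := by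
  obtain ⟨h0, h1, h2⟩ := src_eq_tgt_iff.1 h
  refine ⟨src_eq_tgt_iff.2 ⟨fun hk => ?_, fun hk => ?_, fun a => ?_⟩,
    Transfor.ext ?_ ?_ (funext fun a => star_mul_self (h2 a))⟩
  · rw [starSucc_Φ, starSucc_Ψ, if_pos hk, if_pos hk, h0 hk]
  · simp only [starSucc_Φ, starSucc_Ψ, if_neg hk, (h1 hk).1, (h1 hk).2, and_self]
  · rw [starSucc_Ξ, starSucc_Ξ, source_star_self, target_star_self, h2]
  · change (if k = 0 then X.Ψ else Y.Φ) = if k = 0 then X.Ψ else X.Φ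
    split_ifs with hk; exacts [rfl, (h1 hk).1.symm]
  · change (if k = 0 then Y.Φ else X.Ψ) = if k = 0 then Y.Φ else Y.Ψ
    split_ifs with hk; exacts [rfl, (h1 hk).2]

theorem starSucc_compSucc_ne (hjk : k ≠ j) {X Y : Transfor A B} (h : X.src k = Y.tgt k) :
    ∃ h', (X.compSucc Y k h).starSucc j = (X.starSucc j).compSucc (Y.starSucc j) k h' := by
  obtain ⟨h0, h1, h2⟩ := src_eq_tgt_iff.1 h
  refine ⟨src_eq_tgt_iff.2 ⟨fun hk => ?_, fun hk => ?_, fun a => ?_⟩,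
    Transfor.ext ?_ ?_ (funext fun a => star_mul_ne hjk (h2 a))⟩
  · have hj : j ≠ 0 := fun hj => hjk (hk.trans hj.symm)
    rw [starSucc_Φ, starSucc_Ψ, if_neg hj, if_neg hj, h0 hk]
  · simp only [starSucc_Φ, starSucc_Ψ, (h1 hk).1, (h1 hk).2, and_self]
  · rw [starSucc_Ξ, starSucc_Ξ, source_star_ne hjk, target_star_ne hjk, h2]
  · change (if j = 0 then X.Ψ else Y.Φ) = if j = 0 then Y.Ψ else Y.Φ
    split_ifs with hj
    · exact (h1 (hj ▸ hjk)).2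
    · rfl
  · change (if j = 0 then Y.Φ else X.Ψ) = if j = 0 then X.Φ else X.Ψ
    split_ifs with hj
    · exact (h1 (hj ▸ hjk)).1.symm
    · rfl

theorem starZero_idZero : (idZero A).starZero = idZero A :=
  Transfor.ext rfl rfl (funext fun a => star_eq_of_isIdent le_rfl a.2)

theorem starSucc_idZero (k : Fin n) : (idZero A).starSucc k = idZero A := by
  refine Transfor.ext ?_ ?_ (funext fun a => star_eq_of_isIdent (Fin.zero_le k) a.2)
  · rw [starSucc_Φ]; split_ifs <;> rfl
  · rw [starSucc_Ψ]; split_ifs <;> rfl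

/-! ### Positivity -/

/-- Componentwise square roots stay in the blocks `C_{ee}`, and they are natural because functional
calculus preserves intertwining pairs. The choice of the canonical root matters: arbitrary witnesses
of positivity need not be natural. -/
theorem exists_root {E Z : Transfor A B} (hE : E.src k = E) (hs : Z.src ⊤ = E) (ht : Z.tgt ⊤ = E)
    (hpos : ∀ a, B.ops.IsPositiveAt k (E.Ξ a) (Z.Ξ a)) :
    ∃ Y : Transfor A B, Y.src ⊤ = E ∧ Y.tgt ⊤ = E ∧ Y.Φ = E.Φ ∧ Y.Ψ = E.Ψ ∧
      ∀ a, Z.Ξ a = B.mul k (B.ops.star k (Y.Ξ a)) (Y.Ξ a) := by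
  have hid := (src_eq_self_iff E).1 hE
  have hEF : k = 0 → E.Φ = E.Ψ := fun hk => by subst hk; exact functors_eq_of_isIdent hid
  have hEt : (⊤ : Fin n) = 0 → E.Φ = E.Ψ := fun h =>
    hEF (le_antisymm (h ▸ le_top) (Fin.zero_le k))
  have hZΦ : Z.Φ = E.Φ := congrArg (fun T => T.Φ) hs
  have hZΨ : Z.Ψ = E.Ψ := congrArg (fun T => T.Ψ) ht
  let e : A.Ob → {e : B.Cell // B.ops.IsIdent k e} := fun a => ⟨E.Ξ a, hid a⟩
  let z : ∀ a, B.EndAlg k (e a) := fun a => ⟨Z.Ξ a, (hpos a).1⟩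
  have hz : ∀ a, ∃ y, z a = star y * y := fun a => by
    obtain ⟨-, y, hy, hzy⟩ := hpos a
    exact ⟨⟨y, hy⟩, EndAlg.ext (mem_comp_iff.1 hzy).2⟩
  have hzsa : ∀ a, IsSelfAdjoint (z a) := fun a => by
    obtain ⟨y, hy⟩ := hz a
    rw [hy]; exact IsSelfAdjoint.star_mul_self y
  have hroot := fun a => EndAlg.star_root_mul_root (hz a)
  have hmul : ∀ a, Z.Ξ a = B.mul k (B.ops.star k (EndAlg.root (z a)).1) (EndAlg.root (z a)).1 :=
    fun a => (congrArg Subtype.val (hroot a)).symm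
  let Y : Transfor A B := ofBlock E E (fun _ => ⟨rfl, rfl⟩) (fun a => (EndAlg.root (z a)).1)
    (fun a => EndAlg.source_top _) (fun a => EndAlg.target_top _)
    (fun a b => EndAlg.intertwinesAt_cfc hEF (E.over_coe a) (E.over_coe b) (E.intertwinesAt a b)
      (hzsa a) (hzsa b) (by rw [← hZΦ, ← hZΨ]; exact Z.intertwinesAt a b) Real.continuous_sqrt)
    (by
      obtain ⟨M, hM⟩ := Z.bounded
      -- The norm `r` of the root satisfies `r² ≤ M`, and `r ≤ r² + 1`.
      refine ⟨M + 1, fun a => ?_⟩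
      have h1 := nrm_star_mul k (EndAlg.root (z a)).1
      rw [← hmul] at h1
      nlinarith [hM a, nrm_nonneg (EndAlg.root (z a)).1])
  refine ⟨Y, ?_, ?_, rfl, rfl, hmul⟩
  · refine Transfor.ext rfl ?_ (funext fun a => EndAlg.source_top _)
    rw [src_Ψ]; split_ifs with h; exacts [hEt h, rfl]
  · refine Transfor.ext ?_ rfl (funext fun a => EndAlg.target_top _)
    rw [tgt_Φ]; split_ifs with h; exacts [(hEt h).symm, rfl]

end Transfor

end SmallCStarCat

namespace SmallCStarCat

variable {n : ℕ} [NeZero n] {A B C : SmallCStarCat.{u} n} {j k : Fin n}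

theorem nrm_plus_le {x y : B.Cell} (h : B.ops.SameBlock x y) :
    B.ops.nrm (B.ops.plus x y) ≤ B.ops.nrm x + B.ops.nrm y := by
  have h1 := norm_add_le (toHom (pair x) x rfl rfl) (toHom (pair x) y h.1.symm h.2.symm)
  rwa [Pair.norm_eq, Pair.norm_eq, Pair.norm_eq, Pair.coe_add] at h1

theorem nrm_scale (c : ℂ) (x : B.Cell) : B.ops.nrm (B.ops.scale c x) = ‖c‖ * B.ops.nrm x := by
  have h1 := norm_smul c (toHom (pair x) x rfl rfl)
  rwa [Pair.norm_eq, Pair.norm_eq, Pair.coe_smul] at h1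

namespace Transfor

/-- The sum of two transfors in a common block. -/
noncomputable def plus (X Y : Transfor A B) (hΦ : X.Φ = Y.Φ) (hΨ : X.Ψ = Y.Ψ)
    (h : ∀ a, B.ops.SameBlock (X.Ξ a) (Y.Ξ a)) : Transfor A B :=
  X.ofSameBlock (fun a => B.ops.plus (X.Ξ a) (Y.Ξ a)) (fun a => sameBlock_plus (h a))
    (fun a b => (X.intertwinesAt a b).plus (X.over_coe a) (X.over_coe b) (h a) (h b)
      (by rw [hΦ, hΨ]; exact Y.intertwinesAt a b))
    (by
      obtain ⟨M, hM⟩ := X.bounded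
      obtain ⟨N, hN⟩ := Y.bounded
      exact ⟨M + N, fun a => (nrm_plus_le (h a)).trans (add_le_add (hM a) (hN a))⟩)

/-- The scalar multiples of a transfor. -/
noncomputable def scale (c : ℂ) (X : Transfor A B) : Transfor A B :=
  X.ofSameBlock (fun a => B.ops.scale c (X.Ξ a)) (fun a => sameBlock_scale c _)
    (fun a b => (X.intertwinesAt a b).scale c (X.over_coe a) (X.over_coe b))
    (by
      obtain ⟨M, hM⟩ := X.bounded
      exact ⟨‖c‖ * M, fun a => by
        rw [nrm_scale]; exact mul_le_mul_of_nonneg_left (hM a) (norm_nonneg c)⟩)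

end Transfor

/-- The cell of a transfor. -/
abbrev Transfor.cell (X : Transfor A B) : TransforCell.{u} n := ⟨A, B, X⟩

theorem Transfor.cell_injective {X Y : Transfor A B} (h : X.cell = Y.cell) : X = Y := by
  cases h; rfl

/-! ### The operations -/

theorem isCompZero_iff {P Q Z : TransforCell.{u} n} : IsCompZero P Q Z ↔
    ∃ (A B C : SmallCStarCat.{u} n) (X : Transfor B C) (Y : Transfor A B),
      P = X.cell ∧ Q = Y.cell ∧ Z = (X.compZero Y).cell := by
  constructor
  · rintro ⟨A, B, C, X, Y, Z, hΦ, hΨ, hΞ⟩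
    refine ⟨A, B, C, X, Y, rfl, rfl, ?_⟩
    have : Z = X.compZero Y := Transfor.ext (StarIso.ext hΦ) (StarIso.ext hΨ)
      (funext fun a => (mem_comp_iff.1 (hΞ a)).2)
    rw [this]
  · rintro ⟨A, B, C, X, Y, rfl, rfl, rfl⟩
    exact ⟨A, B, C, X, Y, _, fun _ => rfl, fun _ => rfl, fun a => mul_mem (X.composable Y a)⟩

theorem isCompSucc_iff {P Q Z : TransforCell.{u} n} : IsCompSucc k P Q Z ↔
    ∃ (A B : SmallCStarCat.{u} n) (X Y : Transfor A B) (h : X.src k = Y.tgt k),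
      P = X.cell ∧ Q = Y.cell ∧ Z = (X.compSucc Y k h).cell := by
  constructor
  · rintro ⟨A, B, X, Y, Z, h0, h1, hΞ⟩
    have h1' := fun hk => h1 (pos_of_ne_zero hk)
    have h : X.src k = Y.tgt k := Transfor.src_eq_tgt_iff.2 ⟨fun hk => (h0 hk).1,
      fun hk => ⟨(h1' hk).1, (h1' hk).2.1⟩, fun a => (mem_comp_iff.1 (hΞ a)).1⟩
    refine ⟨A, B, X, Y, h, rfl, rfl, ?_⟩
    have : Z = X.compSucc Y k h := by
      refine Transfor.ext ?_ ?_ (funext fun a => (mem_comp_iff.1 (hΞ a)).2)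
      · by_cases hk : k = 0
        exacts [(h0 hk).2.1, (h1' hk).2.2.1.trans (h1' hk).1]
      · by_cases hk : k = 0
        exacts [(h0 hk).2.2, (h1' hk).2.2.2]
    rw [this]
  · rintro ⟨A, B, X, Y, h, rfl, rfl, rfl⟩
    obtain ⟨h0, h1, h2⟩ := Transfor.src_eq_tgt_iff.1 h
    exact ⟨A, B, X, Y, _, fun hk => ⟨h0 hk, rfl, rfl⟩, fun hk => ⟨(h1 hk.ne').1, (h1 hk.ne').2,
      (h1 hk.ne').1.symm, rfl⟩, fun a => mul_mem (h2 a)⟩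

/-- The partial value defined by a relation. -/
noncomputable def partOf {α : Type*} (R : α → Prop) : Part α := ⟨∃ z, R z, fun h => h.choose⟩

theorem mem_partOf {α : Type*} {R : α → Prop} (h : ∀ y z, R y → R z → y = z) {z : α} :
    z ∈ partOf R ↔ R z :=
  ⟨fun ⟨hd, hz⟩ => hz ▸ hd.choose_spec, fun hz => ⟨⟨z, hz⟩, h _ _ (Exists.choose_spec _) hz⟩⟩

/-- `Z` is the sum of `P` and `Q`. -/
def IsPlus (P Q Z : TransforCell.{u} n) : Prop :=
  ∃ (A B : SmallCStarCat.{u} n) (X Y : Transfor A B) (hΦ : X.Φ = Y.Φ) (hΨ : X.Ψ = Y.Ψ)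
    (h : ∀ a, B.ops.SameBlock (X.Ξ a) (Y.Ξ a)),
    P = X.cell ∧ Q = Y.cell ∧ Z = (X.plus Y hΦ hΨ h).cell

/-- The operations on transfors. -/
noncomputable def transforOps (n : ℕ) [NeZero n] : CellOps (n + 1) (TransforCell.{u} n) where
  comp := Fin.cases (fun P Q => partOf (IsCompZero P Q)) (fun k P Q => partOf (IsCompSucc k P Q))
  star := Fin.cases (fun P => P.transfor.starZero.cell) (fun k P => (P.transfor.starSucc k).cell)
  -- Outside a common block the sum takes the irrelevant value `P`.
  plus P Q := @dite _ (∃ Z, IsPlus P Q Z) (Classical.propDecidable _) (fun h => h.choose) fun _ => P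
  scale c P := (P.transfor.scale c).cell
  nrm P := ⨆ a, P.cod.ops.nrm (P.transfor.Ξ a)

namespace TransforOps

variable {P Q Z : TransforCell.{u} n} {X Y : Transfor A B}

local notation "𝓓" => transforOps n

theorem mem_comp_zero_iff : Z ∈ (𝓓).comp 0 P Q ↔ IsCompZero P Q Z := by
  refine mem_partOf fun y z hy hz => ?_
  obtain ⟨A, B, C, X, Y, rfl, rfl, rfl⟩ := isCompZero_iff.1 hy
  obtain ⟨A', B', C', X', Y', h1, h2, rfl⟩ := isCompZero_iff.1 hz
  cases h1
  cases h2
  rfl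

theorem mem_comp_succ_iff : Z ∈ (𝓓).comp k.succ P Q ↔ IsCompSucc k P Q Z := by
  refine mem_partOf fun y z hy hz => ?_
  obtain ⟨A, B, X, Y, h, rfl, rfl, rfl⟩ := isCompSucc_iff.1 hy
  obtain ⟨A', B', X', Y', h', h1, h2, rfl⟩ := isCompSucc_iff.1 hz
  cases h1
  cases h2
  rfl

theorem mem_comp_zero : Z ∈ (𝓓).comp 0 P Q ↔
    ∃ (A B C : SmallCStarCat.{u} n) (X : Transfor B C) (Y : Transfor A B),
      P = X.cell ∧ Q = Y.cell ∧ Z = (X.compZero Y).cell :=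
  mem_comp_zero_iff.trans isCompZero_iff

theorem mem_comp_succ : Z ∈ (𝓓).comp k.succ P Q ↔
    ∃ (A B : SmallCStarCat.{u} n) (X Y : Transfor A B) (h : X.src k = Y.tgt k),
      P = X.cell ∧ Q = Y.cell ∧ Z = (X.compSucc Y k h).cell :=
  mem_comp_succ_iff.trans isCompSucc_iff

theorem mem_comp_zero_cell {X : Transfor B C} {Y : Transfor A B} :
    Z ∈ (𝓓).comp 0 X.cell Y.cell ↔ Z = (X.compZero Y).cell := by
  rw [mem_comp_zero]
  constructor
  · rintro ⟨A', B', C', X', Y', h1, h2, rfl⟩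
    cases h1
    cases h2
    rfl
  · rintro rfl
    exact ⟨A, B, C, X, Y, rfl, rfl, rfl⟩

theorem mem_comp_succ_cell :
    Z ∈ (𝓓).comp k.succ X.cell Y.cell ↔ ∃ h, Z = (X.compSucc Y k h).cell := by
  rw [mem_comp_succ]
  constructor
  · rintro ⟨A', B', X', Y', h, h1, h2, rfl⟩
    cases h1
    cases h2
    exact ⟨h, rfl⟩
  · rintro ⟨h, rfl⟩
    exact ⟨A, B, X, Y, h, rfl, rfl, rfl⟩

@[simp] theorem star_zero_cell (X : Transfor A B) : (𝓓).star 0 X.cell = X.starZero.cell := rfl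

@[simp] theorem star_succ_cell (k : Fin n) (X : Transfor A B) :
    (𝓓).star k.succ X.cell = (X.starSucc k).cell := rfl

theorem nrm_cell (X : Transfor A B) : (𝓓).nrm X.cell = ⨆ a, B.ops.nrm (X.Ξ a) := rfl

theorem plus_cell (hΦ : X.Φ = Y.Φ) (hΨ : X.Ψ = Y.Ψ)
    (h : ∀ a, B.ops.SameBlock (X.Ξ a) (Y.Ξ a)) :
    (𝓓).plus X.cell Y.cell = (X.plus Y hΦ hΨ h).cell := by
  have hex : ∃ Z, IsPlus X.cell Y.cell Z := ⟨_, A, B, X, Y, hΦ, hΨ, h, rfl, rfl, rfl⟩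
  have h1 : (𝓓).plus X.cell Y.cell = hex.choose := dif_pos hex
  rw [h1]
  obtain ⟨A', B', X', Y', hΦ', hΨ', h', e1, e2, e3⟩ := hex.choose_spec
  rw [e3]
  cases e1
  cases e2
  rfl

theorem isTransforOps : IsTransforOps (transforOps.{u} n) where
  comp_zero _ _ _ := mem_comp_zero_iff
  comp_succ _ _ _ _ := mem_comp_succ_iff
  star_zero := fun ⟨A, B, X⟩ => ⟨A, B, X, _, rfl, rfl, fun _ => rfl⟩
  star_succ := fun k ⟨A, B, X⟩ => ⟨A, B, X, X.starSucc k, fun hk => by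
      rw [Transfor.starSucc_Φ, Transfor.starSucc_Ψ, if_pos hk, if_pos hk]; exact ⟨rfl, rfl⟩,
    fun hk => by
      rw [Transfor.starSucc_Φ, Transfor.starSucc_Ψ, if_neg hk.ne', if_neg hk.ne']
      exact ⟨rfl, rfl⟩,
    fun _ => rfl⟩
  plus _ _ _ _ hΦ hΨ h := ⟨_, plus_cell hΦ hΨ h, rfl, rfl, fun _ => rfl⟩
  scale c _ _ X := ⟨X.scale c, rfl, rfl, rfl, fun _ => rfl⟩
  nrm _ _ _ := rfl

/-! ### Identities, sources and targets -/

/-- Composing with the identity of the domain returns `X`, while an identity `X` must return the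
other factor. -/
theorem isIdent_zero_iff : (𝓓).IsIdent 0 P ↔
    ∃ A : SmallCStarCat.{u} n, P = (Transfor.idZero A).cell := by
  constructor
  · intro h
    obtain ⟨A, B, X⟩ := P
    have h1 := h.2 _ _ (mem_comp_zero_cell (X := X) (Y := Transfor.idZero A) |>.2 rfl)
    rw [Transfor.compZero_idZero] at h1
    exact ⟨A, h1⟩
  · rintro ⟨A, rfl⟩
    constructor
    · intro H K hK
      obtain ⟨A', B', C', X', Y', rfl, h2, rfl⟩ := mem_comp_zero.1 hK
      cases h2
      rw [Transfor.compZero_idZero]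
    · intro H K hK
      obtain ⟨A', B', C', X', Y', h1, rfl, rfl⟩ := mem_comp_zero.1 hK
      cases h1
      rw [Transfor.idZero_compZero]

theorem isIdent_succ_iff : (𝓓).IsIdent k.succ X.cell ↔ ∀ a, B.ops.IsIdent k (X.Ξ a) := by
  constructor
  · intro h
    have h1 := h.1 _ _ (mem_comp_succ_cell.2 ⟨X.src_tgt k, rfl⟩)
    rw [Transfor.tgt_compSucc] at h1
    exact (Transfor.tgt_eq_self_iff X).1 (Transfor.cell_injective h1).symm
  · intro h
    have hs := (Transfor.src_eq_self_iff X).2 h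
    have ht := (Transfor.tgt_eq_self_iff X).2 h
    constructor
    · intro H K hK
      obtain ⟨A', B', X', Y', h', rfl, h2, rfl⟩ := mem_comp_succ.1 hK
      cases h2
      have e : X = X'.src k := by rw [h', ht]
      have := X'.compSucc_src k
      simp only [← e] at this
      rw [this]
    · intro H K hK
      obtain ⟨A', B', X', Y', h', h1, rfl, rfl⟩ := mem_comp_succ.1 hK
      cases h1
      have e : X = Y'.tgt k := by rw [← h', hs]
      have := Y'.tgt_compSucc k
      simp only [← e] at this
      rw [this]

theorem isSource_zero (X : Transfor A B) : (𝓓).IsSource 0 X.cell (Transfor.idZero A).cell :=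
  ⟨isIdent_zero_iff.2 ⟨A, rfl⟩, Part.dom_iff_mem.2 ⟨_, mem_comp_zero_cell.2 rfl⟩⟩

theorem isTarget_zero (X : Transfor A B) : (𝓓).IsTarget 0 X.cell (Transfor.idZero B).cell :=
  ⟨isIdent_zero_iff.2 ⟨B, rfl⟩, Part.dom_iff_mem.2 ⟨_, mem_comp_zero_cell.2 rfl⟩⟩

theorem isSource_succ (k : Fin n) (X : Transfor A B) :
    (𝓓).IsSource k.succ X.cell (X.src k).cell :=
  ⟨isIdent_succ_iff.2 fun _ => isIdent_source k _,
    Part.dom_iff_mem.2 ⟨_, mem_comp_succ_cell.2 ⟨(X.tgt_src k).symm, rfl⟩⟩⟩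

theorem isTarget_succ (k : Fin n) (X : Transfor A B) :
    (𝓓).IsTarget k.succ X.cell (X.tgt k).cell :=
  ⟨isIdent_succ_iff.2 fun _ => isIdent_target k _,
    Part.dom_iff_mem.2 ⟨_, mem_comp_succ_cell.2 ⟨X.src_tgt k, rfl⟩⟩⟩

theorem isOneCategory_zero : (𝓓).IsOneCategory 0 where
  assoc f g h K := by
    constructor
    · rintro ⟨m, hm, hK⟩
      obtain ⟨A, B, C, Y, Z, rfl, rfl, rfl⟩ := mem_comp_zero.1 hm
      obtain ⟨A', B', D, X, W, rfl, h2, rfl⟩ := mem_comp_zero.1 hK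
      cases h2
      exact ⟨_, mem_comp_zero_cell.2 rfl, mem_comp_zero_cell.2 (by rw [Transfor.compZero_assoc])⟩
    · rintro ⟨m, hm, hK⟩
      obtain ⟨A, B, C, Y, Z, rfl, rfl, rfl⟩ := mem_comp_zero.1 hm
      obtain ⟨A', B', D, X, W, h1, rfl, rfl⟩ := mem_comp_zero.1 hK
      cases h1
      exact ⟨_, mem_comp_zero_cell.2 rfl, mem_comp_zero_cell.2 (by rw [Transfor.compZero_assoc])⟩
  exists_source := fun ⟨_, _, X⟩ => ⟨_, isSource_zero X⟩
  exists_target := fun ⟨_, _, X⟩ => ⟨_, isTarget_zero X⟩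
  comp_dom f g e hf hg := by
    obtain ⟨E, rfl⟩ := isIdent_zero_iff.1 hf.1
    obtain ⟨K, hK⟩ := Part.dom_iff_mem.1 hf.2
    obtain ⟨K', hK'⟩ := Part.dom_iff_mem.1 hg.2
    obtain ⟨A, B, C, X, Y, rfl, h2, -⟩ := mem_comp_zero.1 hK
    obtain ⟨A', B', C', X', Y', h1, rfl, -⟩ := mem_comp_zero.1 hK'
    cases h2
    cases h1
    exact Part.dom_iff_mem.2 ⟨_, mem_comp_zero_cell.2 rfl⟩

theorem isOneCategory_succ (k : Fin n) : (𝓓).IsOneCategory k.succ where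
  assoc f g h K := by
    constructor
    · rintro ⟨m, hm, hK⟩
      obtain ⟨A, B, Y, Z, h, rfl, rfl, rfl⟩ := mem_comp_succ.1 hm
      obtain ⟨A', B', X, W, h', rfl, h2, rfl⟩ := mem_comp_succ.1 hK
      cases h2
      have hXY := h'.trans (Transfor.tgt_compSucc_self h)
      exact ⟨_, mem_comp_succ_cell.2 ⟨hXY, rfl⟩, mem_comp_succ_cell.2
        ⟨_, congrArg _ (Transfor.compSucc_assoc hXY h).symm⟩⟩
    · rintro ⟨m, hm, hK⟩
      obtain ⟨A, B, X, Y, h, rfl, rfl, rfl⟩ := mem_comp_succ.1 hm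
      obtain ⟨A', B', W, Z, h', h1, rfl, rfl⟩ := mem_comp_succ.1 hK
      cases h1
      have hYZ := (Transfor.src_compSucc h).symm.trans h'
      exact ⟨_, mem_comp_succ_cell.2 ⟨hYZ, rfl⟩, mem_comp_succ_cell.2
        ⟨_, congrArg _ (Transfor.compSucc_assoc h hYZ)⟩⟩
  exists_source := fun ⟨_, _, X⟩ => ⟨_, isSource_succ k X⟩
  exists_target := fun ⟨_, _, X⟩ => ⟨_, isTarget_succ k X⟩
  comp_dom f g e hf hg := by
    obtain ⟨K, hK⟩ := Part.dom_iff_mem.1 hf.2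
    obtain ⟨K', hK'⟩ := Part.dom_iff_mem.1 hg.2
    obtain ⟨A, B, X, E, h, rfl, rfl, -⟩ := mem_comp_succ.1 hK
    obtain ⟨A', B', E', Y, h', h1, rfl, -⟩ := mem_comp_succ.1 hK'
    cases h1
    have hE := isIdent_succ_iff.1 hf.1
    have h2 : X.src k = Y.tgt k := by
      rw [h, ← h', (Transfor.tgt_eq_self_iff E).2 hE, (Transfor.src_eq_self_iff E).2 hE]
    exact Part.dom_iff_mem.2 ⟨_, mem_comp_succ_cell.2 ⟨h2, rfl⟩⟩

theorem isOneCategory (q : Fin (n + 1)) : (𝓓).IsOneCategory q :=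
  Fin.cases isOneCategory_zero isOneCategory_succ q

theorem source_zero (X : Transfor A B) : (𝓓).source 0 X.cell = (Transfor.idZero A).cell :=
  (isOneCategory 0).source_unique ((isOneCategory 0).isSource_source _) (isSource_zero X)

theorem target_zero (X : Transfor A B) : (𝓓).target 0 X.cell = (Transfor.idZero B).cell :=
  (isOneCategory 0).target_unique ((isOneCategory 0).isTarget_target _) (isTarget_zero X)

theorem source_succ (k : Fin n) (X : Transfor A B) :
    (𝓓).source k.succ X.cell = (X.src k).cell :=
  (isOneCategory _).source_unique ((isOneCategory _).isSource_source _) (isSource_succ k X)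

theorem target_succ (k : Fin n) (X : Transfor A B) :
    (𝓓).target k.succ X.cell = (X.tgt k).cell :=
  (isOneCategory _).target_unique ((isOneCategory _).isTarget_target _) (isTarget_succ k X)

/-! ### Globular axioms and involutions -/

theorem isGlobularCategory : (𝓓).IsGlobularCategory where
  oneCategory := isOneCategory
  ident_mono q p hqp E hE := by
    obtain ⟨k, rfl⟩ := Fin.exists_succ_eq.2 (Fin.ne_zero_of_lt hqp)
    induction q using Fin.cases with
    | zero =>
      obtain ⟨A, rfl⟩ := isIdent_zero_iff.1 hE
      exact isIdent_succ_iff.2 fun a => isIdent_of_le (Fin.zero_le k) a.2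
    | succ j =>
      obtain ⟨A, B, X⟩ := E
      exact isIdent_succ_iff.2 fun a =>
        isIdent_of_le (Fin.succ_lt_succ_iff.1 hqp).le (isIdent_succ_iff.1 hE a)
  ident_comp q p hqp x y z hx hy hz := by
    obtain ⟨k, rfl⟩ := Fin.exists_succ_eq.2 (Fin.ne_zero_of_lt hqp)
    induction q using Fin.cases with
    | zero =>
      obtain ⟨A, B, C, X, Y, rfl, rfl, rfl⟩ := mem_comp_zero.1 hz
      have hX := isIdent_succ_iff.1 hx
      have hY := isIdent_succ_iff.1 hy
      refine isIdent_succ_iff.2 fun a => ?_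
      have hc := X.composable Y a
      -- For `k = 0` the closure axiom in `C` does not apply, as both orders are `0` there. The
      -- components are then objects, and the composite is just the first factor.
      rcases eq_or_ne k 0 with rfl | hk
      · have h1 : C.ops.source 0 (X.Φ (Y.Ξ a)) = X.Φ (Y.Ξ a) := by
          rw [← X.Φ.map_source, source_eq_of_isIdent (hY a)]
        have h2 : C.ops.target 0 (X.Φ (Y.Ξ a)) = X.Φ (Y.Ξ a) :=
          target_eq_of_isIdent (X.Φ.map_isIdent (hY a))
        rw [h2] at hc
        rw [Transfor.compZero_Ξ, ← hc, mul_source]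
        exact hX _
      · exact C.isCStar.globular.ident_comp 0 k (pos_of_ne_zero hk) _ _ _ (hX _)
          (X.Φ.map_isIdent (hY a)) (mul_mem hc)
    | succ j =>
      obtain ⟨A, B, X, Y, h, rfl, rfl, rfl⟩ := mem_comp_succ.1 hz
      exact isIdent_succ_iff.2 fun a => B.isCStar.globular.ident_comp j k
        (Fin.succ_lt_succ_iff.1 hqp) _ _ _ (isIdent_succ_iff.1 hx a) (isIdent_succ_iff.1 hy a)
        (mul_mem (Transfor.source_eq_target h a))
  exchange q p hqp x y w z u v r hu hv hr := by
    obtain ⟨k, rfl⟩ := Fin.exists_succ_eq.2 (Fin.ne_zero_of_lt hqp)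
    obtain ⟨A, B, X, Y, h, rfl, rfl, rfl⟩ := mem_comp_succ.1 hu
    obtain ⟨A', B', W, Z, h', rfl, rfl, rfl⟩ := mem_comp_succ.1 hv
    induction q using Fin.cases with
    | zero =>
      obtain ⟨A₁, B₁, C₁, S, T, h1, h2, rfl⟩ := mem_comp_zero.1 hr
      cases h1
      cases h2
      exact ⟨_, _, mem_comp_zero_cell.2 rfl, mem_comp_zero_cell.2 rfl, mem_comp_succ_cell.2
        ⟨_, congrArg _ (Transfor.exchange_zero h h')⟩⟩
    | succ j =>
      obtain ⟨A₁, B₁, S, T, h'', h1, h2, rfl⟩ := mem_comp_succ.1 hr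
      cases h1
      cases h2
      have hjk := Fin.succ_lt_succ_iff.1 hqp
      obtain ⟨h₄, h₅⟩ := Transfor.exchange_succ_aux hjk h h' h''
      obtain ⟨h₆, e⟩ := Transfor.exchange_succ hjk h h' h'' h₄ h₅
      exact ⟨_, _, mem_comp_succ_cell.2 ⟨h₄, rfl⟩, mem_comp_succ_cell.2 ⟨h₅, rfl⟩,
        mem_comp_succ_cell.2 ⟨h₆, congrArg _ e⟩⟩

theorem isFullyInvolutive : (𝓓).IsFullyInvolutive where
  star_star q := fun ⟨A, B, X⟩ => by
    induction q using Fin.cases with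
    | zero => exact congrArg Transfor.cell (Transfor.starZero_starZero X)
    | succ k => exact congrArg Transfor.cell (Transfor.starSucc_starSucc k X)
  star_comm p q := fun ⟨A, B, X⟩ => by
    induction q using Fin.cases with
    | zero =>
      induction p using Fin.cases with
      | zero => rfl
      | succ k => exact congrArg Transfor.cell (Transfor.starZero_starSucc k X)
    | succ j =>
      induction p using Fin.cases with
      | zero => exact congrArg Transfor.cell (Transfor.starZero_starSucc j X).symm
      | succ k => exact congrArg Transfor.cell (Transfor.starSucc_comm j k X)
  star_comp_of_ne p q hpq x y z hz := by
    induction p using Fin.cases with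
    | zero =>
      obtain ⟨j, rfl⟩ := Fin.exists_succ_eq.2 hpq.symm
      obtain ⟨A, B, C, X, Y, rfl, rfl, rfl⟩ := mem_comp_zero.1 hz
      exact mem_comp_zero_cell.2 (congrArg Transfor.cell (Transfor.starSucc_compZero j X Y))
    | succ k =>
      obtain ⟨A, B, X, Y, h, rfl, rfl, rfl⟩ := mem_comp_succ.1 hz
      induction q using Fin.cases with
      | zero =>
        exact mem_comp_succ_cell.2 ⟨_, congrArg Transfor.cell (Transfor.starZero_compSucc h)⟩
      | succ j =>
        obtain ⟨h', e⟩ := Transfor.starSucc_compSucc_ne (fun e => hpq (congrArg Fin.succ e)) h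
        exact mem_comp_succ_cell.2 ⟨h', congrArg Transfor.cell e⟩
  star_comp_self q x y z hz := by
    induction q using Fin.cases with
    | zero =>
      obtain ⟨A, B, C, X, Y, rfl, rfl, rfl⟩ := mem_comp_zero.1 hz
      exact mem_comp_zero_cell.2 (congrArg Transfor.cell (Transfor.starZero_compZero X Y))
    | succ k =>
      obtain ⟨A, B, X, Y, h, rfl, rfl, rfl⟩ := mem_comp_succ.1 hz
      obtain ⟨h', e⟩ := Transfor.starSucc_compSucc_self h
      exact mem_comp_succ_cell.2 ⟨h', congrArg Transfor.cell e⟩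
  star_ident p q e he := by
    induction p using Fin.cases with
    | zero =>
      obtain ⟨A, rfl⟩ := isIdent_zero_iff.1 he
      refine isIdent_zero_iff.2 ⟨A, ?_⟩
      induction q using Fin.cases with
      | zero => exact congrArg Transfor.cell Transfor.starZero_idZero
      | succ k => exact congrArg Transfor.cell (Transfor.starSucc_idZero k)
    | succ k =>
      obtain ⟨A, B, X⟩ := e
      have hX := isIdent_succ_iff.1 he
      induction q using Fin.cases with
      | zero =>
        exact isIdent_succ_iff.2 fun b => X.Φ.symm.map_isIdent (isIdent_star 0 (hX _))
      | succ j => exact isIdent_succ_iff.2 fun a => isIdent_star j (hX a)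

end TransforOps

end SmallCStarCat

/-! ### Banach spaces of transfors -/

namespace SmallCStarCat

variable {n : ℕ} [NeZero n] {A B C : SmallCStarCat.{u} n} {j k : Fin n}

/-- A Banach space structure transported along a bijection. -/
theorem exists_banach_of_bijective {V α : Type*} [NormedAddCommGroup V] [NormedSpace ℂ V]
    [CompleteSpace V] (g : V → α) (hg : Function.Bijective g) :
    ∃ (_ : NormedAddCommGroup α) (_ : NormedSpace ℂ α), CompleteSpace α ∧
      (∀ v w, g v + g w = g (v + w)) ∧ (∀ (c : ℂ) v, c • g v = g (c • v)) ∧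
      ∀ v, ‖g v‖ = ‖v‖ := by
  let e : α ≃ V := (Equiv.ofBijective g hg).symm
  have he : ∀ v, e (g v) = v := fun v => (Equiv.ofBijective g hg).symm_apply_apply v
  let _ : NormedAddCommGroup α := e.normedAddCommGroup
  let _ : Module ℂ α := e.module ℂ
  have hnorm : ∀ x : α, ‖x‖ = ‖e x‖ := fun x => rfl
  have hsmul : ∀ (c : ℂ) (x : α), c • x = g (c • e x) := fun c x => rfl
  let _ : NormedSpace ℂ α := ⟨fun c x => by rw [hnorm, hnorm, hsmul, he, norm_smul]⟩
  have hiso : Isometry e := fun x y => rfl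
  refine ⟨inferInstance, inferInstance, ?_, fun v w => ?_, fun c v => ?_, fun v => ?_⟩
  · exact (completeSpace_congr (e := e) hiso.isUniformEmbedding).2 inferInstance
  · change g (e (g v) + e (g w)) = _
    rw [he, he]
  · rw [hsmul, he]
  · rw [hnorm, he]

/-- Shift of order by one: the top source and target of a transfor are formed from the top sources
and targets of its components. -/
theorem top_eq_succ : (⊤ : Fin (n + 1)) = (⊤ : Fin n).succ := by
  refine le_antisymm ?_ le_top
  induction (⊤ : Fin (n + 1)) using Fin.cases with
  | zero => exact Fin.zero_le _
  | succ i => exact Fin.succ_le_succ_iff.2 le_top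

/-- Both are the zero of the common block. -/
theorem scale_zero_eq {x y : B.Cell} (h : B.ops.SameBlock x y) :
    B.ops.scale 0 x = B.ops.scale 0 y := by
  have h1 := Pair.coe_smul 0 (toHom (pair x) x rfl rfl)
  have h2 := Pair.coe_smul 0 (toHom (pair x) y h.1.symm h.2.symm)
  rw [zero_smul] at h1 h2
  exact h1.symm.trans h2

theorem sameBlock_mul_of_top_eq_zero (h0 : (⊤ : Fin n) = 0) {Φ Ψ : StarIso A B} {a b : A.Ob}
    {x : A.Cell} {u v : B.Cell} (hs : A.ops.source 0 x = a.1) (ht : A.ops.target 0 x = b.1)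
    (hu : Over Φ Ψ a u) (hv : Over Φ Ψ b v) :
    B.ops.SameBlock (B.mul 0 (Ψ x) u) (B.mul 0 v (Φ x)) := by
  constructor
  · rw [h0, source_mul_self (hu.left_composable hs), source_mul_self (hv.right_composable ht),
      ← Φ.map_source, hs]
    exact hu.1
  · rw [h0, target_mul_self (hu.left_composable hs), target_mul_self (hv.right_composable ht),
      ← Ψ.map_target, ht]
    exact hv.2.symm

section Block

variable {S T : Transfor A B}

/-- The block of the components at an object. -/
def blockPair (h : ∀ a, B.ops.Parallel (T.Ξ a) (S.Ξ a)) (a : A.Ob) : B.Pair := ⟨_, _, h a⟩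

variable (h : ∀ a, B.ops.Parallel (T.Ξ a) (S.Ξ a))

theorem blockPair_over {a : A.Ob} (x : (blockPair h a).Hom) : Over S.Φ T.Ψ a x.1 :=
  ⟨by rw [← source_source_top, x.2.1]; exact (S.over_coe a).1,
    by rw [← target_target_top, x.2.2]; exact (T.over_coe a).2⟩

theorem sameBlock_blockPair {a : A.Ob} (x y : (blockPair h a).Hom) : B.ops.SameBlock x.1 y.1 :=
  ⟨x.2.1.trans y.2.1.symm, x.2.2.trans y.2.2.symm⟩

/-- The zero cells are `0`-multiples, so both sides of the equation are `0`-multiples of composites.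
It suffices that these composites share a block; for `n > 1` that is the naturality of `S` and `T`,
for `n = 1` it holds by endpoints. -/
theorem intertwinesAt_zero (hF : (⊤ : Fin n) ≠ 0 → S.Φ = T.Φ ∧ S.Ψ = T.Ψ) (a b : A.Ob) :
    IntertwinesAt S.Φ T.Ψ a b (0 : (blockPair h a).Hom).1 (0 : (blockPair h b).Hom).1 := by
  intro x hs ht
  have hu := (blockPair_over h (0 : (blockPair h a).Hom)).left_composable hs
  have hv := (blockPair_over h (0 : (blockPair h b).Hom)).right_composable ht
  have hb : B.ops.SameBlock (B.mul 0 (T.Ψ x) (0 : (blockPair h a).Hom).1)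
      (B.mul 0 (0 : (blockPair h b).Hom).1 (S.Φ x)) := by
    rcases eq_or_ne (⊤ : Fin n) 0 with h0 | h0
    · exact sameBlock_mul_of_top_eq_zero h0 hs ht (blockPair_over h _) (blockPair_over h _)
    · have h0' := pos_of_ne_zero h0
      constructor
      · rw [source_mul_gt h0' hu, source_mul_gt h0' hv, ← S.Φ.map_source, ← T.Ψ.map_source,
          ← (hF h0).2, Pair.source_coe, Pair.source_coe]
        exact S.intertwinesAt a b _ (by rw [source_source_of_lt h0', hs])
          (by rw [target_source_of_lt h0', ht])
      · rw [target_mul_gt h0' hu, target_mul_gt h0' hv, ← S.Φ.map_target, ← T.Ψ.map_target,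
          (hF h0).1, Pair.target_coe, Pair.target_coe]
        exact T.intertwinesAt a b _ (by rw [source_target_of_lt h0', hs])
          (by rw [target_target_of_lt h0', ht])
  have hz : ∀ a, (0 : (blockPair h a).Hom).1 = B.ops.scale 0 (0 : (blockPair h a).Hom).1 :=
    fun a => by rw [← Pair.coe_smul, zero_smul]
  rw [hz a, hz b, mul_scale 0 hu, scale_mul 0 hv, scale_zero_eq hb]

open scoped ENNReal in
/-- The Banach space of the bounded intertwining families of cells in the blocks given by two
transfors. -/
noncomputable def blockSpace (hF : (⊤ : Fin n) ≠ 0 → S.Φ = T.Φ ∧ S.Ψ = T.Ψ) :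
    Submodule ℂ (lp (fun a => (blockPair h a).Hom) ∞) where
  carrier := {ξ | ∀ a b, IntertwinesAt S.Φ T.Ψ a b (ξ a).1 (ξ b).1}
  zero_mem' := intertwinesAt_zero h hF
  add_mem' := fun {ξ η} hξ hη a b => by
    change IntertwinesAt S.Φ T.Ψ a b (ξ a + η a).1 (ξ b + η b).1
    rw [Pair.coe_add, Pair.coe_add]
    exact (hξ a b).plus (blockPair_over h _) (blockPair_over h _) (sameBlock_blockPair h _ _)
      (sameBlock_blockPair h _ _) (hη a b)
  smul_mem' := fun c ξ hξ a b => by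
    change IntertwinesAt S.Φ T.Ψ a b (c • ξ a).1 (c • ξ b).1
    rw [Pair.coe_smul, Pair.coe_smul]
    exact (hξ a b).scale c (blockPair_over h _) (blockPair_over h _)

theorem completeSpace_blockSpace (hF : (⊤ : Fin n) ≠ 0 → S.Φ = T.Φ ∧ S.Ψ = T.Ψ) :
    CompleteSpace (blockSpace h hF) := by
  have hc : IsClosed (blockSpace h hF : Set (lp (fun a => (blockPair h a).Hom) ⊤)) := by
    have : (blockSpace h hF : Set (lp (fun a => (blockPair h a).Hom) ⊤)) =
        ⋂ a, ⋂ b, {ξ | IntertwinesAt S.Φ T.Ψ a b (ξ a).1 (ξ b).1} := by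
      ext ξ
      simp only [Set.mem_iInter]
      rfl
    rw [this]
    refine isClosed_iInter fun a => isClosed_iInter fun b => ?_
    have hcont : Continuous fun ξ : lp (fun a => (blockPair h a).Hom) ⊤ => (ξ a, ξ b) :=
      (lp.evalCLM ℂ (fun a => (blockPair h a).Hom) ⊤ a).continuous.prodMk
        (lp.evalCLM ℂ (fun a => (blockPair h a).Hom) ⊤ b).continuous
    exact (isClosed_intertwinesAt (fun y => blockPair_over h y)
      (fun y => blockPair_over h y)).preimage hcont
  exact hc.completeSpace_coe

end Block

theorem Transfor.src_starSucc (k : Fin n) (X : Transfor A B) : (X.starSucc k).src k = X.tgt k := by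
  refine Transfor.ext rfl ?_ (funext fun a => source_star_self k _)
  rw [Transfor.src_Ψ, Transfor.starSucc_Φ, Transfor.starSucc_Ψ]
  split_ifs <;> rfl

namespace TransforOps

variable {P Q Z : TransforCell.{u} n} {X Y : Transfor A B}

local notation "𝓓" => transforOps n

theorem sameBlock_cell_iff : (𝓓).SameBlock X.cell Y.cell ↔
    X.Φ = Y.Φ ∧ X.Ψ = Y.Ψ ∧ ∀ a, B.ops.SameBlock (X.Ξ a) (Y.Ξ a) := by
  unfold CellOps.SameBlock
  rw [top_eq_succ, source_succ, source_succ, target_succ, target_succ]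
  constructor
  · rintro ⟨hs, ht⟩
    have hs := Transfor.cell_injective hs
    have ht := Transfor.cell_injective ht
    exact ⟨congrArg (fun T => T.Φ) hs, congrArg (fun T => T.Ψ) ht, fun a =>
      ⟨congrArg (fun T => T.Ξ a) hs, congrArg (fun T => T.Ξ a) ht⟩⟩
  · rintro ⟨hΦ, hΨ, h⟩
    refine ⟨congrArg _ (Transfor.ext hΦ ?_ (funext fun a => (h a).1)),
      congrArg _ (Transfor.ext ?_ hΨ (funext fun a => (h a).2))⟩
    · rw [Transfor.src_Ψ, Transfor.src_Ψ, hΦ, hΨ]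
    · rw [Transfor.tgt_Φ, Transfor.tgt_Φ, hΦ, hΨ]

theorem sameBlock_iff_exists : (𝓓).SameBlock X.cell Q ↔ ∃ Y : Transfor A B, Q = Y.cell ∧
    X.Φ = Y.Φ ∧ X.Ψ = Y.Ψ ∧ ∀ a, B.ops.SameBlock (X.Ξ a) (Y.Ξ a) := by
  constructor
  · intro h
    obtain ⟨A', B', Y⟩ := Q
    have h1 := h.1
    rw [top_eq_succ, source_succ, source_succ] at h1
    have hA : A = A' := congrArg TransforCell.dom h1
    have hB : B = B' := congrArg TransforCell.cod h1
    subst hA hB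
    exact ⟨Y, rfl, sameBlock_cell_iff.1 h⟩
  · rintro ⟨Y, rfl, h⟩
    exact sameBlock_cell_iff.2 h

/-- The block is in bijection with `blockSpace`, along which the Banach structure is transported.
Globular position forces equal functors when `n > 1`; when `n = 1`, the two transfors are identities
of possibly different functors. -/
theorem exists_banach {P Q : TransforCell.{u} n} (hPQ : (𝓓).Parallel P Q) :
    ∃ (_ : NormedAddCommGroup ((𝓓).Block P Q)) (_ : NormedSpace ℂ ((𝓓).Block P Q)),
      CompleteSpace ((𝓓).Block P Q) ∧
      (∀ x y : (𝓓).Block P Q, (x + y).1 = (𝓓).plus x.1 y.1) ∧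
      (∀ (c : ℂ) (x : (𝓓).Block P Q), (c • x).1 = (𝓓).scale c x.1) ∧
      (∀ x : (𝓓).Block P Q, ‖x‖ = (𝓓).nrm x.1) := by
  obtain ⟨hP, hQ, hpar⟩ := hPQ
  obtain ⟨A, B, T⟩ := P
  obtain ⟨A', B', S⟩ := Q
  have hlt : ∀ k : Fin n, k < ⊤ → k.succ < (⊤ : Fin (n + 1)) := fun k hk => by
    rw [top_eq_succ]; exact Fin.succ_lt_succ_iff.2 hk
  have hpos : (0 : Fin (n + 1)) < ⊤ := by rw [top_eq_succ]; exact Fin.succ_pos _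
  obtain ⟨h1, h2⟩ := hpar 0 hpos
  rw [source_zero, source_zero] at h1
  rw [target_zero, target_zero] at h2
  have hA : A = A' := congrArg TransforCell.dom h1
  have hB : B = B' := congrArg TransforCell.cod h2
  subst hA hB
  rw [top_eq_succ] at hP hQ
  have hsrc : ∀ k : Fin n, k < ⊤ → T.src k = S.src k ∧ T.tgt k = S.tgt k := fun k hk => by
    obtain ⟨h1, h2⟩ := hpar _ (hlt k hk)
    rw [source_succ, source_succ] at h1
    rw [target_succ, target_succ] at h2
    exact ⟨Transfor.cell_injective h1, Transfor.cell_injective h2⟩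
  have hT := isIdent_succ_iff.1 hP
  have hS := isIdent_succ_iff.1 hQ
  have hF : (⊤ : Fin n) ≠ 0 → S.Φ = T.Φ ∧ S.Ψ = T.Ψ := fun h0 =>
    ⟨congrArg (fun T => T.Φ) (hsrc 0 (pos_of_ne_zero h0)).1.symm,
      congrArg (fun T => T.Ψ) (hsrc 0 (pos_of_ne_zero h0)).2.symm⟩
  have h : ∀ a, B.ops.Parallel (T.Ξ a) (S.Ξ a) := fun a => ⟨hT a, hS a, fun q hq =>
    ⟨congrArg (fun T => T.Ξ a) (hsrc q hq).1, congrArg (fun T => T.Ξ a) (hsrc q hq).2⟩⟩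
  have := completeSpace_blockSpace h hF
  have hbdd : ∀ ξ : lp (fun a => (blockPair h a).Hom) ⊤, ∃ M : ℝ, ∀ a, B.ops.nrm (ξ a).1 ≤ M :=
    fun ξ => ⟨‖ξ‖, fun a => by
      rw [← Pair.norm_eq]; exact lp.norm_apply_le_norm ENNReal.top_ne_zero ξ a⟩
  let X : blockSpace h hF → Transfor A B := fun ξ => Transfor.ofBlock S T hF (fun a => (ξ.1 a).1)
    (fun a => (ξ.1 a).2.1) (fun a => (ξ.1 a).2.2) ξ.2 (hbdd ξ.1)
  have hT0 : (⊤ : Fin n) = 0 → T.Φ = T.Ψ := fun h0 =>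
    Transfor.functors_eq_of_isIdent fun a => h0 ▸ hT a
  have hS0 : (⊤ : Fin n) = 0 → S.Φ = S.Ψ := fun h0 =>
    Transfor.functors_eq_of_isIdent fun a => h0 ▸ hS a
  have hXS : ∀ ξ, (X ξ).src ⊤ = S := fun ξ => by
    refine Transfor.ext rfl ?_ (funext fun a => (ξ.1 a).2.1)
    rw [Transfor.src_Ψ]
    split_ifs with h0
    exacts [hS0 h0, (hF h0).2.symm]
  have hXT : ∀ ξ, (X ξ).tgt ⊤ = T := fun ξ => by
    refine Transfor.ext ?_ rfl (funext fun a => (ξ.1 a).2.2)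
    rw [Transfor.tgt_Φ]
    split_ifs with h0
    exacts [(hT0 h0).symm, (hF h0).1]
  let g : blockSpace h hF → (𝓓).Block T.cell S.cell := fun ξ => ⟨(X ξ).cell, by
    rw [top_eq_succ, source_succ, target_succ, hXS, hXT]; exact ⟨rfl, rfl⟩⟩
  have hg : Function.Bijective g := by
    constructor
    · intro ξ η hξη
      have h1 : X ξ = X η :=
        Transfor.cell_injective (congrArg (fun z : (𝓓).Block T.cell S.cell => z.1) hξη)
      refine Subtype.ext (lp.ext (funext fun a => Pair.Hom.ext ?_))
      exact congrArg (fun T => T.Ξ a) h1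
    · rintro ⟨⟨A', B', Y⟩, hY⟩
      rw [top_eq_succ, source_succ, target_succ] at hY
      obtain ⟨h1, h2⟩ := hY
      have hA : A' = A := congrArg TransforCell.dom h1
      have hB : B' = B := congrArg TransforCell.cod h1
      subst hA hB
      have h1 := Transfor.cell_injective h1
      have h2 := Transfor.cell_injective h2
      have hΦ : Y.Φ = S.Φ := congrArg (fun T => T.Φ) h1
      have hΨ : Y.Ψ = T.Ψ := congrArg (fun T => T.Ψ) h2
      let ξ : ∀ a, (blockPair h a).Hom := fun a => ⟨Y.Ξ a, congrArg (fun T => T.Ξ a) h1,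
        congrArg (fun T => T.Ξ a) h2⟩
      have hξ : Memℓp ξ ⊤ := by
        obtain ⟨M, hM⟩ := Y.bounded
        refine memℓp_infty ⟨M, ?_⟩
        rintro _ ⟨a, rfl⟩
        change ‖ξ a‖ ≤ M
        rw [Pair.norm_eq]
        exact hM a
      refine ⟨⟨⟨ξ, hξ⟩, fun a b => ?_⟩, Subtype.ext ?_⟩
      · rw [← hΦ, ← hΨ]
        exact Y.intertwinesAt a b
      · exact congrArg Transfor.cell (Transfor.ext hΦ.symm hΨ.symm rfl)
  obtain ⟨i₁, i₂, hcomp, hadd, hsmul, hnorm⟩ := exists_banach_of_bijective g hg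
  refine ⟨i₁, i₂, hcomp, fun x y => ?_, fun c x => ?_, fun x => ?_⟩
  · obtain ⟨ξ, rfl⟩ := hg.2 x
    obtain ⟨η, rfl⟩ := hg.2 y
    rw [hadd]
    refine Eq.trans ?_ (plus_cell (X := X ξ) (Y := X η) rfl rfl fun a =>
      sameBlock_blockPair h (ξ.1 a) (η.1 a)).symm
    exact congrArg Transfor.cell (Transfor.ext rfl rfl (funext fun a =>
      Pair.coe_add (ξ.1 a) (η.1 a)))
  · obtain ⟨ξ, rfl⟩ := hg.2 x
    rw [hsmul]
    exact congrArg Transfor.cell (Transfor.ext rfl rfl (funext fun a =>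
      Pair.coe_smul c (ξ.1 a)))
  · obtain ⟨ξ, rfl⟩ := hg.2 x
    rw [hnorm]
    change ‖ξ.1‖ = ⨆ a, B.ops.nrm (ξ.1 a).1
    rw [lp.norm_eq_ciSup]
    exact iSup_congr fun a => Pair.norm_eq _

/-! ### Positivity -/

theorem isPositiveAt_zero (X : Transfor A B) :
    (𝓓).IsPositiveAt 0 (Transfor.idZero A).cell (X.starZero.compZero X).cell := by
  set Z := X.starZero.compZero X with hZ
  have hZa : ∀ a, Z.Ξ a =
      A.mul 0 (A.ops.star 0 (X.Φ.symm (X.Ξ a))) (X.Φ.symm (X.Ξ a)) := fun a => by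
    change A.mul 0 (X.Φ.symm (B.ops.star 0 (X.Ξ (X.Ψ.symm.ob (X.Ψ.ob a))))) _ = _
    rw [StarIso.symm_ob_ob, X.Φ.symm.map_star]; rfl
  have hsrc : ∀ a, A.ops.source 0 (X.Φ.symm (X.Ξ a)) = a.1 := fun a => by
    rw [← StarIso.map_source, (X.over_coe a).1, StarIso.symm_apply_apply]
  have hpos : ∀ a, A.ops.IsPositiveAt 0 a.1 (Z.Ξ a) := fun a => by
    rw [hZa]
    have := A.isCStar.positive 0 (X.Φ.symm (X.Ξ a)) _ (mul_mem (source_star_self _ _))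
    rwa [hsrc] at this
  have hΦ : Z.Φ = StarIso.refl A := StarIso.ext fun x => by simp [Z]
  have hΨ : Z.Ψ = StarIso.refl A := StarIso.ext fun x => by simp [Z]
  have hs : Z.src ⊤ = Transfor.idZero A := by
    refine Transfor.ext hΦ ?_ (funext fun a => (hpos a).1.1)
    rw [Transfor.src_Ψ, hΦ, hΨ, ite_self]; rfl
  have ht : Z.tgt ⊤ = Transfor.idZero A := by
    refine Transfor.ext ?_ hΨ (funext fun a => (hpos a).1.2)
    rw [Transfor.tgt_Φ, hΦ, hΨ, ite_self]; rfl
  have hE : (Transfor.idZero A).src 0 = Transfor.idZero A :=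
    (Transfor.src_eq_self_iff _).2 fun a => a.2
  -- The root runs between identity functors, so its adjoint over objects is the componentwise
  -- `*_0`.
  obtain ⟨Y, hYs, hYt, hYΦ, hYΨ, hY⟩ := Transfor.exists_root hE hs ht hpos
  unfold CellOps.IsPositiveAt
  rw [top_eq_succ, source_succ, target_succ, hs, ht]
  refine ⟨⟨rfl, rfl⟩, Y.cell, ?_, mem_comp_zero_cell.2 (congrArg _ ?_)⟩
  · rw [source_succ, target_succ, hYs, hYt]; exact ⟨rfl, rfl⟩
  · refine Transfor.ext ?_ ?_ (funext fun a => ?_)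
    · rw [hΦ]; exact StarIso.ext fun x => by simp
    · rw [hΨ]; exact StarIso.ext fun x => by simp
    · rw [hY]
      change _ = A.mul 0 (Y.Φ.symm (A.ops.star 0 (Y.Ξ (Y.Ψ.symm.ob (Y.Ψ.ob a)))))
        (Y.Φ.symm (Y.Ξ a))
      rw [StarIso.symm_ob_ob, hYΦ]
      rfl

theorem isPositiveAt_succ (k : Fin n) (X : Transfor A B) (h) :
    (𝓓).IsPositiveAt k.succ (X.src k).cell ((X.starSucc k).compSucc X k h).cell := by
  set Z := (X.starSucc k).compSucc X k h with hZ
  have hZa : ∀ a, Z.Ξ a = B.mul k (B.ops.star k (X.Ξ a)) (X.Ξ a) := fun a => rfl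
  have hpos : ∀ a, B.ops.IsPositiveAt k ((X.src k).Ξ a) (Z.Ξ a) := fun a =>
    B.isCStar.positive k (X.Ξ a) _ (mul_mem (source_star_self _ _))
  have hΨ : Z.Ψ = (X.src k).Ψ := rfl
  have htop : (⊤ : Fin n) = 0 → k = 0 := fun h0 => le_antisymm (h0 ▸ le_top) (Fin.zero_le k)
  have hs : Z.src ⊤ = X.src k := by
    refine Transfor.ext rfl ?_ (funext fun a => (hpos a).1.1)
    rw [Transfor.src_Ψ, hΨ]
    split_ifs with h0
    · rw [Transfor.src_Ψ, if_pos (htop h0)]; rfl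
    · rfl
  have ht : Z.tgt ⊤ = X.src k := by
    refine Transfor.ext ?_ hΨ (funext fun a => (hpos a).1.2)
    rw [Transfor.tgt_Φ, hΨ]
    split_ifs with h0
    · rw [Transfor.src_Ψ, if_pos (htop h0)]; rfl
    · rfl
  obtain ⟨Y, hYs, hYt, hYΦ, hYΨ, hY⟩ := Transfor.exists_root (X.src_src k) hs ht hpos
  unfold CellOps.IsPositiveAt
  rw [top_eq_succ, source_succ, target_succ, hs, ht]
  refine ⟨⟨rfl, rfl⟩, Y.cell, ?_, mem_comp_succ_cell.2 ⟨Y.src_starSucc k, congrArg _ ?_⟩⟩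
  · rw [source_succ, target_succ, hYs, hYt]; exact ⟨rfl, rfl⟩
  · refine Transfor.ext hYΦ.symm ?_ (funext hY)
    rw [hΨ, Transfor.compSucc_Ψ, Transfor.starSucc_Ψ, Transfor.src_Ψ, hYΦ, hYΨ, Transfor.src_Φ,
      Transfor.src_Ψ]
    split_ifs <;> rfl

end TransforOps

end SmallCStarCat

/-! ### Norm and linear axioms -/

namespace SmallCStarCat

variable {n : ℕ} [NeZero n] {A B C : SmallCStarCat.{u} n} {j k : Fin n}

namespace Transfor

theorem bddAbove (X : Transfor A B) : BddAbove (Set.range fun a => B.ops.nrm (X.Ξ a)) := by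
  obtain ⟨M, hM⟩ := X.bounded
  exact ⟨M, by rintro _ ⟨a, rfl⟩; exact hM a⟩

theorem nrm_le_iSup (X : Transfor A B) (a : A.Ob) :
    B.ops.nrm (X.Ξ a) ≤ ⨆ a, B.ops.nrm (X.Ξ a) := le_ciSup X.bddAbove a

theorem iSup_nrm_nonneg (X : Transfor A B) : 0 ≤ ⨆ a, B.ops.nrm (X.Ξ a) :=
  Real.iSup_nonneg fun _ => nrm_nonneg _

theorem nrm_starZero_compZero (X : Transfor A B) (a : A.Ob) :
    A.ops.nrm ((X.starZero.compZero X).Ξ a) = B.ops.nrm (X.Ξ a) ^ 2 := by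
  change A.ops.nrm (A.mul 0 (X.Φ.symm (B.ops.star 0 (X.Ξ (X.Ψ.symm.ob (X.Ψ.ob a)))))
    (X.Φ.symm (X.Ξ a))) = _
  rw [StarIso.symm_ob_ob, X.Φ.symm.map_star, nrm_star_mul, StarIso.nrm_apply]

end Transfor

/-- Squaring is monotone on nonnegative reals. With no objects both suprema are `0` by convention.
-/
theorem iSup_nrm_sq (X : Transfor A B) :
    ⨆ a, B.ops.nrm (X.Ξ a) ^ 2 = (⨆ a, B.ops.nrm (X.Ξ a)) ^ 2 := by
  rcases isEmpty_or_nonempty A.Ob with h | h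
  · rw [Real.iSup_of_isEmpty, Real.iSup_of_isEmpty, zero_pow two_ne_zero]
  · exact (Real.iSup_pow (fun a => nrm_nonneg (X.Ξ a)) 2).symm

namespace TransforOps

local notation "𝓓" => transforOps n

theorem plus_comp (p : Fin (n + 1)) (x x' y z z' : TransforCell.{u} n)
    (h : (𝓓).SameBlock x x') (hz : z ∈ (𝓓).comp p x y) (hz' : z' ∈ (𝓓).comp p x' y) :
    (𝓓).plus z z' ∈ (𝓓).comp p ((𝓓).plus x x') y := by
  induction p using Fin.cases with
  | zero =>
    obtain ⟨A, B, C, X, Y, rfl, rfl, rfl⟩ := mem_comp_zero.1 hz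
    obtain ⟨X', rfl, hΦ, hΨ, hb⟩ := sameBlock_iff_exists.1 h
    rw [mem_comp_zero_cell] at hz'
    subst hz'
    have hc : ∀ a, C.ops.SameBlock ((X.compZero Y).Ξ a) ((X'.compZero Y).Ξ a) := fun a => by
      rw [Transfor.compZero_Ξ, Transfor.compZero_Ξ, ← hΦ]
      exact (hb _).mul ⟨rfl, rfl⟩ (X.composable Y a)
    rw [plus_cell hΦ hΨ hb, plus_cell (congrArg Y.Φ.trans hΦ) (congrArg Y.Ψ.trans hΨ) hc,
      mem_comp_zero_cell]
    refine congrArg _ (Transfor.ext rfl rfl (funext fun a => ?_))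
    change C.ops.plus (C.mul 0 (X.Ξ _) (X.Φ (Y.Ξ a))) (C.mul 0 (X'.Ξ _) (X'.Φ (Y.Ξ a))) =
      C.mul 0 (C.ops.plus (X.Ξ (Y.Ψ.ob a)) (X'.Ξ (Y.Ψ.ob a))) (X.Φ (Y.Ξ a))
    rw [← hΦ, plus_mul (hb _) (X.composable Y a)]
  | succ k =>
    obtain ⟨A, B, X, Y, hXY, rfl, rfl, rfl⟩ := mem_comp_succ.1 hz
    obtain ⟨X', rfl, hΦ, hΨ, hb⟩ := sameBlock_iff_exists.1 h
    obtain ⟨hXY', rfl⟩ := mem_comp_succ_cell.1 hz'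
    have hc := Transfor.source_eq_target hXY
    have hs : (X.plus X' hΦ hΨ hb).src k = Y.tgt k := by
      obtain ⟨h0, h1, h2⟩ := Transfor.src_eq_tgt_iff.1 hXY
      exact Transfor.src_eq_tgt_iff.2 ⟨h0, h1, fun a =>
        ((sameBlock_plus (hb a)).source_eq k).trans (h2 a)⟩
    rw [plus_cell hΦ hΨ hb, plus_cell (X := X.compSucc Y k hXY) (Y := X'.compSucc Y k hXY') rfl hΨ
      fun a => (hb a).mul ⟨rfl, rfl⟩ (hc a), mem_comp_succ_cell]
    exact ⟨hs, congrArg _ (Transfor.ext rfl rfl (funext fun a =>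
      (plus_mul (hb a) (hc a)).symm))⟩

theorem comp_plus (p : Fin (n + 1)) (x y y' z z' : TransforCell.{u} n)
    (h : (𝓓).SameBlock y y') (hz : z ∈ (𝓓).comp p x y) (hz' : z' ∈ (𝓓).comp p x y') :
    (𝓓).plus z z' ∈ (𝓓).comp p x ((𝓓).plus y y') := by
  induction p using Fin.cases with
  | zero =>
    obtain ⟨A, B, C, X, Y, rfl, rfl, rfl⟩ := mem_comp_zero.1 hz
    obtain ⟨Y', rfl, hΦ, hΨ, hb⟩ := sameBlock_iff_exists.1 h
    rw [mem_comp_zero_cell] at hz'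
    subst hz'
    have hb' : ∀ a, C.ops.SameBlock (X.Φ (Y.Ξ a)) (X.Φ (Y'.Ξ a)) := fun a =>
      X.Φ.map_sameBlock (hb a)
    have hc : ∀ a, C.ops.SameBlock ((X.compZero Y).Ξ a) ((X.compZero Y').Ξ a) := fun a => by
      rw [Transfor.compZero_Ξ, Transfor.compZero_Ξ, ← hΨ]
      exact CellOps.SameBlock.mul ⟨rfl, rfl⟩ (hb' a) (X.composable Y a)
    rw [plus_cell hΦ hΨ hb, plus_cell (congrArg (·.trans X.Φ) hΦ) (congrArg (·.trans X.Ψ) hΨ) hc,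
      mem_comp_zero_cell]
    refine congrArg _ (Transfor.ext rfl rfl (funext fun a => ?_))
    change C.ops.plus (C.mul 0 (X.Ξ (Y.Ψ.ob a)) _) (C.mul 0 (X.Ξ (Y'.Ψ.ob a)) _) =
      C.mul 0 (X.Ξ (Y.Ψ.ob a)) (X.Φ (B.ops.plus (Y.Ξ a) (Y'.Ξ a)))
    rw [← hΨ, X.Φ.map_plus (hb a), mul_plus (hb' a) (X.composable Y a)]
  | succ k =>
    obtain ⟨A, B, X, Y, hXY, rfl, rfl, rfl⟩ := mem_comp_succ.1 hz
    obtain ⟨Y', rfl, hΦ, hΨ, hb⟩ := sameBlock_iff_exists.1 h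
    obtain ⟨hXY', rfl⟩ := mem_comp_succ_cell.1 hz'
    have hc := Transfor.source_eq_target hXY
    have hs : X.src k = (Y.plus Y' hΦ hΨ hb).tgt k := by
      obtain ⟨h0, h1, h2⟩ := Transfor.src_eq_tgt_iff.1 hXY
      exact Transfor.src_eq_tgt_iff.2 ⟨h0, h1, fun a =>
        (h2 a).trans ((sameBlock_plus (hb a)).target_eq k).symm⟩
    rw [plus_cell hΦ hΨ hb, plus_cell (X := X.compSucc Y k hXY) (Y := X.compSucc Y' k hXY') hΦ rfl
      fun a => CellOps.SameBlock.mul ⟨rfl, rfl⟩ (hb a) (hc a), mem_comp_succ_cell]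
    exact ⟨hs, congrArg Transfor.cell (Transfor.ext rfl rfl (funext fun a =>
      (mul_plus (hb a) (hc a)).symm))⟩

theorem scale_comp (p : Fin (n + 1)) (c : ℂ) (x y z : TransforCell.{u} n)
    (hz : z ∈ (𝓓).comp p x y) : (𝓓).scale c z ∈ (𝓓).comp p ((𝓓).scale c x) y := by
  induction p using Fin.cases with
  | zero =>
    obtain ⟨A, B, C, X, Y, rfl, rfl, rfl⟩ := mem_comp_zero.1 hz
    exact mem_comp_zero_cell.2 (congrArg Transfor.cell (Transfor.ext rfl rfl (funext fun a =>
      (scale_mul c (X.composable Y a)).symm)))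
  | succ k =>
    obtain ⟨A, B, X, Y, hXY, rfl, rfl, rfl⟩ := mem_comp_succ.1 hz
    obtain ⟨h0, h1, h2⟩ := Transfor.src_eq_tgt_iff.1 hXY
    have hs : (X.scale c).src k = Y.tgt k := Transfor.src_eq_tgt_iff.2 ⟨h0, h1, fun a =>
      ((sameBlock_scale c _).source_eq k).trans (h2 a)⟩
    exact mem_comp_succ_cell.2 ⟨hs, congrArg Transfor.cell (Transfor.ext rfl rfl (funext fun a =>
      (scale_mul c (h2 a)).symm))⟩

theorem comp_scale (p : Fin (n + 1)) (c : ℂ) (x y z : TransforCell.{u} n)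
    (hz : z ∈ (𝓓).comp p x y) : (𝓓).scale c z ∈ (𝓓).comp p x ((𝓓).scale c y) := by
  induction p using Fin.cases with
  | zero =>
    obtain ⟨A, B, C, X, Y, rfl, rfl, rfl⟩ := mem_comp_zero.1 hz
    refine mem_comp_zero_cell.2 (congrArg Transfor.cell (Transfor.ext rfl rfl (funext fun a => ?_)))
    change _ = C.mul 0 (X.Ξ (Y.Ψ.ob a)) (X.Φ (B.ops.scale c (Y.Ξ a)))
    rw [X.Φ.map_scale, mul_scale c (X.composable Y a)]
    rfl
  | succ k =>
    obtain ⟨A, B, X, Y, hXY, rfl, rfl, rfl⟩ := mem_comp_succ.1 hz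
    obtain ⟨h0, h1, h2⟩ := Transfor.src_eq_tgt_iff.1 hXY
    have hs : X.src k = (Y.scale c).tgt k := Transfor.src_eq_tgt_iff.2 ⟨h0, h1, fun a =>
      (h2 a).trans ((sameBlock_scale c _).target_eq k).symm⟩
    exact mem_comp_succ_cell.2 ⟨hs, congrArg Transfor.cell (Transfor.ext rfl rfl (funext fun a =>
      (mul_scale c (h2 a)).symm))⟩

theorem star_plus (p : Fin (n + 1)) (x y : TransforCell.{u} n) (h : (𝓓).SameBlock x y) :
    (𝓓).star p ((𝓓).plus x y) = (𝓓).plus ((𝓓).star p x) ((𝓓).star p y) := by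
  obtain ⟨A, B, X⟩ := x
  obtain ⟨Y, rfl, hΦ, hΨ, hb⟩ := sameBlock_iff_exists.1 h
  rw [plus_cell hΦ hΨ hb]
  induction p using Fin.cases with
  | zero =>
    have hb' : ∀ b, A.ops.SameBlock (X.starZero.Ξ b) (Y.starZero.Ξ b) := fun b => by
      rw [Transfor.starZero_Ξ, Transfor.starZero_Ξ, ← hΦ, ← hΨ]
      exact X.Φ.symm.map_sameBlock ((hb _).star 0)
    rw [star_zero_cell, star_zero_cell, star_zero_cell,
      plus_cell (congrArg StarIso.symm hΦ) (congrArg StarIso.symm hΨ) hb']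
    refine congrArg _ (Transfor.ext rfl rfl (funext fun b => ?_))
    change X.Φ.symm (B.ops.star 0 (B.ops.plus (X.Ξ (X.Ψ.symm.ob b)) (Y.Ξ (X.Ψ.symm.ob b)))) =
      A.ops.plus (X.Φ.symm (B.ops.star 0 (X.Ξ (X.Ψ.symm.ob b))))
        (Y.Φ.symm (B.ops.star 0 (Y.Ξ (Y.Ψ.symm.ob b))))
    rw [← hΦ, ← hΨ, SmallCStarCat.star_plus 0 (hb _), X.Φ.symm.map_plus ((hb _).star 0)]
  | succ k =>
    rw [star_succ_cell, star_succ_cell, star_succ_cell,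
      plus_cell (X := X.starSucc k) (Y := Y.starSucc k)
        (by rw [Transfor.starSucc_Φ, Transfor.starSucc_Φ, hΦ, hΨ])
        (by rw [Transfor.starSucc_Ψ, Transfor.starSucc_Ψ, hΦ, hΨ]) fun a => (hb a).star k]
    exact congrArg _ (Transfor.ext rfl rfl (funext fun a => SmallCStarCat.star_plus k (hb a)))

theorem star_scale (p : Fin (n + 1)) (c : ℂ) (x : TransforCell.{u} n) :
    (𝓓).star p ((𝓓).scale c x) = (𝓓).scale (starRingEnd ℂ c) ((𝓓).star p x) := by
  obtain ⟨A, B, X⟩ := x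
  induction p using Fin.cases with
  | zero =>
    refine congrArg Transfor.cell (Transfor.ext rfl rfl (funext fun b => ?_))
    change X.Φ.symm (B.ops.star 0 (B.ops.scale c (X.Ξ (X.Ψ.symm.ob b)))) =
      A.ops.scale (starRingEnd ℂ c) (X.Φ.symm (B.ops.star 0 (X.Ξ (X.Ψ.symm.ob b))))
    rw [SmallCStarCat.star_scale, X.Φ.symm.map_scale]
  | succ k =>
    exact congrArg Transfor.cell (Transfor.ext rfl rfl (funext fun a =>
      SmallCStarCat.star_scale k c _))

theorem nrm_comp_le (p : Fin (n + 1)) (x y z : TransforCell.{u} n) (hz : z ∈ (𝓓).comp p x y) :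
    (𝓓).nrm z ≤ (𝓓).nrm x * (𝓓).nrm y := by
  induction p using Fin.cases with
  | zero =>
    obtain ⟨A, B, C, X, Y, rfl, rfl, rfl⟩ := mem_comp_zero.1 hz
    refine Real.iSup_le (fun a => ?_) (mul_nonneg X.iSup_nrm_nonneg Y.iSup_nrm_nonneg)
    refine (nrm_mul_le (X.composable Y a)).trans ?_
    rw [StarIso.nrm_apply]
    exact mul_le_mul (X.nrm_le_iSup _) (Y.nrm_le_iSup a) (nrm_nonneg _) X.iSup_nrm_nonneg
  | succ k =>
    obtain ⟨A, B, X, Y, h, rfl, rfl, rfl⟩ := mem_comp_succ.1 hz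
    refine Real.iSup_le (fun a => ?_) (mul_nonneg X.iSup_nrm_nonneg Y.iSup_nrm_nonneg)
    exact (nrm_mul_le (Transfor.source_eq_target h a)).trans
      (mul_le_mul (X.nrm_le_iSup a) (Y.nrm_le_iSup a) (nrm_nonneg _) X.iSup_nrm_nonneg)

theorem nrm_star_comp (p : Fin (n + 1)) (x : TransforCell.{u} n) :
    ∃ z, z ∈ (𝓓).comp p ((𝓓).star p x) x ∧ (𝓓).nrm z = (𝓓).nrm x ^ 2 := by
  obtain ⟨A, B, X⟩ := x
  induction p using Fin.cases with
  | zero =>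
    refine ⟨_, mem_comp_zero_cell.2 rfl, ?_⟩
    rw [nrm_cell, nrm_cell, ← iSup_nrm_sq]
    exact iSup_congr X.nrm_starZero_compZero
  | succ k =>
    refine ⟨_, mem_comp_succ_cell.2 ⟨X.src_starSucc k, rfl⟩, ?_⟩
    rw [nrm_cell, nrm_cell, ← iSup_nrm_sq]
    exact iSup_congr fun a => nrm_star_mul k _

theorem isPositiveAt (p : Fin (n + 1)) (x z : TransforCell.{u} n)
    (hz : z ∈ (𝓓).comp p ((𝓓).star p x) x) : (𝓓).IsPositiveAt p ((𝓓).source p x) z := by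
  obtain ⟨A, B, X⟩ := x
  induction p using Fin.cases with
  | zero =>
    rw [star_zero_cell, mem_comp_zero_cell] at hz
    rw [hz, source_zero]
    exact isPositiveAt_zero X
  | succ k =>
    rw [star_succ_cell, mem_comp_succ_cell] at hz
    obtain ⟨h, rfl⟩ := hz
    rw [source_succ]
    exact isPositiveAt_succ k X h

theorem isCStarCategory : (transforOps.{u} n).IsCStarCategory where
  globular := isGlobularCategory
  involutive := isFullyInvolutive
  banach _ _ := exists_banach
  plus_comp := plus_comp
  comp_plus := comp_plus
  scale_comp := scale_comp
  comp_scale := comp_scale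
  star_plus := star_plus
  star_scale := star_scale
  nrm_comp_le := nrm_comp_le
  nrm_star_comp := nrm_star_comp
  positive := isPositiveAt

end TransforOps

end SmallCStarCat

theorem mainTheorem6 (n : ℕ) [NeZero n] :
    ∃ D : CellOps (n + 1) (SmallCStarCat.TransforCell.{u} n),
      SmallCStarCat.IsTransforOps D ∧ D.IsCStarCategory :=
  ⟨SmallCStarCat.transforOps n, SmallCStarCat.TransforOps.isTransforOps,
    SmallCStarCat.TransforOps.isCStarCategory⟩
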